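/- \textbf{Setting.} Let $(Z,\varpi)$ be a Poisson manifold (a smooth, finite-dimensional, Hausdorff, second countable manifold), with $\varpi^\sharp:T^*Z\to TZ$, $\varpi(\beta,\beta')=\beta(\varpi^\sharp\beta')$, $\{f,g\}=\varpi(df,dg)$. Let $i_S:S\hookrightarrow Z$ be a symplectic leaf (a maximal connected integral manifold of $\varpi^\sharp(T^*Z)$) that is an embedded submanifold, with symplectic form $\omega_S$ and $\omega_S^\flat(v)=\omega_S(v,\cdot)$, determined by $\omega_S^\flat(v)=(Ti_S)^*\beta$ whenever $Ti_S(v)=\varpi^\sharp\beta$. Let $X\subset S$ be an embedded Lagrangian submanifold, i.e. at every point $TX$ is its own $\omega_S$-orthogonal complement in $TS|_X$. Put $E_X=(TX)^0\subset T^*Z|_X$, $L_X=(TS)^0|_X\subset T^*Z|_X$, let $(\underline{TX})^0\subset T^*S|_X$ be the annihilator of $TX$ in $T^*S$, and let $\omega_X^\flat=\omega_S^\flat|_{TX}:TX\to(\underline{TX})^0$, with dual $(\omega_X^\flat)^*:TS|_X/TX\cong((\underline{TX})^0)^*\to T^*X$. The fibres of $L=(TS)^0\subset T^*Z|_S$ are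 Lie algebras with $[\beta,\beta']=d\{f,g\}_z$ for $df_z=\beta$, $dg_z=\beta'$, all isomorphic to one Lie algebra $\mathfrak g$. The Lie frame bundle $R_X\to X$ has as fibre over $x$ the Lie algebra isomorphisms $\mathfrak g\to (L_X)_x$; the group $\mathrm{Aut}(\mathfrak g)$ acts on it from the right by composition. An $E_X$-connection form is a smooth bundle morphism $\alpha^\flat:TX\to E_X$ over $X$ with $-\varpi^\sharp\circ\alpha^\flat=\mathrm{id}_{TX}$, i.e. a splitting of $0\to L_X\to E_X\xrightarrow{-\varpi^\sharp}TX\to 0$. It gives the covariant derivative $\nabla^\alpha_V\eta=\{\alpha^\flat(V),\eta\}$ on $L_X$, where sections of $E_X$ are extended to one-forms on $Z$ and $\{\beta,\beta'\}=i_{\varpi^\sharp\beta'}d\beta-i_{\varpi^\sharp\beta}d\beta'+d(\varpi(\beta,\beta'))$. \textbf{Theorem.} Let $H\in C^\infty(Z)$ with $dH=0$ at all points of $X$. There is a unique family of fibrewise linear maps $$t^VH:\ TS|_X/TX\longrightarrow E_X$$ over $X$ such that, for $x\in X$ and $v\in T_xS$, the vector $T(dH)(Ti_S v)\in T_{0_x}(T^*Z)=T_xZ\oplus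 T^*_xZ$ (decomposition along the zero section) has vertical component $t^VH([v])$ and horizontal component $Ti_S v$; and $t^VH$ is a smooth bundle morphism. Suppose that the composition $$t^VH_0=(Ti_S)^*\circ t^VH:\ TS|_X/TX\longrightarrow (\underline{TX})^0$$ is invertible. Then: (1) $\gamma_H^\flat=(-\omega_X^\flat)^*\circ(t^VH_0)^{-1}\circ(-\omega_X^\flat):TX\to T^*X$ defines a (pseudo-Riemannian) metric $\gamma_H$ on $X$, i.e. a smooth field of nondegenerate symmetric bilinear forms; (2) $\alpha_H^\flat=t^VH\circ(t^VH_0)^{-1}\circ(-\omega_X^\flat):TX\to E_X$ is an $E_X$-connection form on $X$; (3) $R_X$ is a principal $\mathrm{Aut}(\mathfrak g)$-bundle over $X$, and there is a unique principal connection form $A_H$ on $R_X$ (with values in $\mathrm{Lie}(\mathrm{Aut}(\mathfrak g))=\mathrm{Der}(\mathfrak g)$) which induces $\nabla^{\alpha_H}$ on $L_X$: for every local smooth section $\sigma$ of $R_X$, every $\xi\in\mathfrak g$ and $u\in TX$, $\nabla^{\alpha_H}_u(\sigma\xi)=\sigma\big(A_H(T\sigma\,u)\,\xi\big)$. -/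

import Mathlib

open scoped Manifold ContDiff Bundle

noncomputable section

namespace PoissonGauge

universe u v w

/-! ### Cotangent bundles, one-forms, exterior derivative -/

/-- The model space of an `n`-dimensional manifold. -/
abbrev Model (n : ℕ) : Type := EuclideanSpace ℝ (Fin n)

section Cotangent

variable (n : ℕ) {Z : Type u} [TopologicalSpace Z] [ChartedSpace (Model n) Z]

/-- The cotangent space `T*_z Z`. -/
abbrev Cot (z : Z) : Type := TangentSpace (𝓡 n) z →L[ℝ] ℝ

variable (Z) in
/-- The total space of the cotangent bundle `T*Z`. -/
abbrev CotBundle [IsManifold (𝓡 n) ∞ Z] : Type u :=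
  Bundle.TotalSpace (Model n →L[ℝ] ℝ) (fun z : Z => TangentSpace (𝓡 n) z →L[ℝ] ℝ)

/-- The model with corners of the manifold `T*Z`. -/
abbrev cotModel : ModelWithCorners ℝ (Model n × (Model n →L[ℝ] ℝ))
    (ModelProd (Model n) (Model n →L[ℝ] ℝ)) :=
  (𝓡 n).prod 𝓘(ℝ, Model n →L[ℝ] ℝ)

/-- The differential `dH` at a point, as a covector. -/
def diff (H : Z → ℝ) (z : Z) : Cot n z := mfderiv (𝓡 n) 𝓘(ℝ, ℝ) H z

variable [IsManifold (𝓡 n) ∞ Z]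

/-- The element of the total space `T*Z` given by a covector at `z`. -/
def cot (z : Z) (β : Cot n z) : CotBundle n Z := ⟨z, β⟩

/-- A smooth differential one-form on `Z`: a smooth section of `T*Z`. -/
structure OneForm (Z : Type u) [TopologicalSpace Z] [ChartedSpace (Model n) Z]
    [IsManifold (𝓡 n) ∞ Z] where
  val : ∀ z : Z, Cot n z
  smooth : ContMDiff (𝓡 n) (cotModel n) ∞ (fun z => cot n z (val z))

/-- A smooth vector field on `Z`: a smooth section of `TZ`. -/
structure VField (Z : Type u) [TopologicalSpace Z] [ChartedSpace (Model n) Z]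
    [IsManifold (𝓡 n) ∞ Z] where
  val : ∀ z : Z, TangentSpace (𝓡 n) z
  smooth : ContMDiff (𝓡 n) (𝓡 n).tangent ∞ (fun z => (⟨z, val z⟩ : TangentBundle (𝓡 n) Z))

variable {n}

/-- The derivative `(U · f)(z)` of a real function `f` along the vector field `U`. -/
def dirDeriv (U : ∀ z : Z, TangentSpace (𝓡 n) z) (f : Z → ℝ) (z : Z) : ℝ := diff n f z (U z)

/-- The exterior derivative of a one-form,
`dα(U, V) = U · α(V) - V · α(U) - α([U, V])`. -/
def extDer (α : ∀ z : Z, Cot n z) (U V : ∀ z : Z, TangentSpace (𝓡 n) z) (z : Z) : ℝ :=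
  dirDeriv U (fun y => α y (V y)) z - dirDeriv V (fun y => α y (U y)) z
    - α z (VectorField.mlieBracket (𝓡 n) U V z)

end Cotangent

/-! ### Poisson manifolds -/

/-- A Poisson structure on `Z`: a smooth bivector field `ϖ`, given by the bundle morphism
`ϖ♯ : T*Z → TZ` with `ϖ(α, β) = α(ϖ♯ β)`, such that the bracket `{f, g} = ϖ(df, dg)` satisfies the
Jacobi identity. -/
structure PoissonStructure (n : ℕ) (Z : Type u) [TopologicalSpace Z] [ChartedSpace (Model n) Z]
    [IsManifold (𝓡 n) ∞ Z] where
  sharp : ∀ z : Z, Cot n z →ₗ[ℝ] TangentSpace (𝓡 n) z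
  skew : ∀ (z : Z) (α β : Cot n z), α (sharp z β) = - β (sharp z α)
  smooth : ContMDiff (cotModel n) (𝓡 n).tangent ∞
    (fun p : CotBundle n Z => (⟨p.1, sharp p.1 p.2⟩ : TangentBundle (𝓡 n) Z))
  jacobi : ∀ f g h : Z → ℝ, ContMDiff (𝓡 n) 𝓘(ℝ, ℝ) ∞ f → ContMDiff (𝓡 n) 𝓘(ℝ, ℝ) ∞ g →
    ContMDiff (𝓡 n) 𝓘(ℝ, ℝ) ∞ h → ∀ z,
    diff n f z (sharp z (diff n (fun y => diff n g y (sharp y (diff n h y))) z))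
    + diff n g z (sharp z (diff n (fun y => diff n h y (sharp y (diff n f y))) z))
    + diff n h z (sharp z (diff n (fun y => diff n f y (sharp y (diff n g y))) z)) = 0

section Poisson

variable {n : ℕ} {Z : Type u} [TopologicalSpace Z] [ChartedSpace (Model n) Z]
  [IsManifold (𝓡 n) ∞ Z]

/-- The Poisson bracket `{f, g} = ϖ(df, dg) = df(ϖ♯ dg)`. -/
def PoissonStructure.bracket (P : PoissonStructure n Z) (f g : Z → ℝ) (z : Z) : ℝ :=
  diff n f z (P.sharp z (diff n g z))

/-- The bracket of one-forms
`{α, β} = i_{ϖ♯β} dα - i_{ϖ♯α} dβ + d(ϖ(α, β))`,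
evaluated on a vector field `W` at the point `z`. -/
def PoissonStructure.formBracket (P : PoissonStructure n Z) (α β : ∀ z : Z, Cot n z)
    (W : ∀ z : Z, TangentSpace (𝓡 n) z) (z : Z) : ℝ :=
  extDer α (fun y => P.sharp y (β y)) W z - extDer β (fun y => P.sharp y (α y)) W z
    + dirDeriv W (fun y => α y (P.sharp y (β y))) z

/-- `κ : N → Z` is an injectively immersed integral manifold of the distribution `ϖ♯(T*Z)`. -/
structure PoissonStructure.IsIntegralManifold (P : PoissonStructure n Z) {k : ℕ} {N : Type v}
    [TopologicalSpace N] [ChartedSpace (Model k) N] (κ : N → Z) : Prop where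
  injective : Function.Injective κ
  immersion : Manifold.IsImmersion (𝓡 k) (𝓡 n) ∞ κ
  tangent : ∀ s : N, LinearMap.range (mfderiv (𝓡 k) (𝓡 n) κ s).toLinearMap
    = LinearMap.range (P.sharp (κ s))

end Poisson

/-- A symplectic leaf of `(Z, ϖ)` that is an embedded submanifold `i_S : S → Z`:
a maximal connected integral manifold of the distribution `ϖ♯(T*Z)`. -/
structure SymplecticLeaf {n : ℕ} {Z : Type u} [TopologicalSpace Z] [ChartedSpace (Model n) Z]
    [IsManifold (𝓡 n) ∞ Z] (P : PoissonStructure n Z) (k : ℕ) (S : Type v) [TopologicalSpace S]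
    [ChartedSpace (Model k) S] [IsManifold (𝓡 k) ∞ S] where
  incl : S → Z
  embedding : Manifold.IsSmoothEmbedding (𝓡 k) (𝓡 n) ∞ incl
  integral : P.IsIntegralManifold (k := k) incl
  connected : ConnectedSpace S
  maximal : ∀ (l : ℕ) (N : Type u) [TopologicalSpace N] [ChartedSpace (Model l) N]
    [IsManifold (𝓡 l) ∞ N] [ConnectedSpace N] (κ : N → Z), P.IsIntegralManifold (k := l) κ →
    (Set.range κ ∩ Set.range incl).Nonempty → Set.range κ ⊆ Set.range incl

section Leaf

variable {n : ℕ} {Z : Type u} [TopologicalSpace Z] [ChartedSpace (Model n) Z]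
  [IsManifold (𝓡 n) ∞ Z] {P : PoissonStructure n Z} {k : ℕ} {S : Type v} [TopologicalSpace S]
  [ChartedSpace (Model k) S] [IsManifold (𝓡 k) ∞ S]

namespace SymplecticLeaf

/-- The tangent map `T i_S : T_s S → T_{i_S(s)} Z`. -/
def tmap (L : SymplecticLeaf P k S) (s : S) :
    TangentSpace (𝓡 k) s →L[ℝ] TangentSpace (𝓡 n) (L.incl s) :=
  mfderiv (𝓡 k) (𝓡 n) L.incl s

theorem exists_sharp (L : SymplecticLeaf P k S) (s : S) (v : TangentSpace (𝓡 k) s) :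
    ∃ β : Cot n (L.incl s), P.sharp (L.incl s) β = L.tmap s v := by
  have h : L.tmap s v ∈ LinearMap.range (P.sharp (L.incl s)) := by
    rw [← L.integral.tangent s]
    exact ⟨v, rfl⟩
  exact h

theorem sharp_mem (L : SymplecticLeaf P k S) (s : S) (β : Cot n (L.incl s)) :
    ∃ v : TangentSpace (𝓡 k) s, L.tmap s v = P.sharp (L.incl s) β := by
  have h : P.sharp (L.incl s) β ∈
      LinearMap.range (mfderiv (𝓡 k) (𝓡 n) L.incl s).toLinearMap := by
    rw [L.integral.tangent s]
    exact ⟨β, rfl⟩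
  exact h

theorem eq_on_tangent (L : SymplecticLeaf P k S) (s : S) {β β' : Cot n (L.incl s)}
    (h : P.sharp (L.incl s) β = P.sharp (L.incl s) β') (w : TangentSpace (𝓡 k) s) :
    β (L.tmap s w) = β' (L.tmap s w) := by
  obtain ⟨δ, hδ⟩ := L.exists_sharp s w
  rw [← hδ, P.skew, P.skew _ β', h]

/-- The map `ω_S♭ : TS → T*S` of the symplectic form of the leaf, `ω_S♭(v) = ω_S(v, ·)`. It is the
inverse of the map `T*S → TS` of the induced Poisson structure on `S`: if
`T i_S (v) = ϖ♯ β` then `ω_S♭(v) = (T i_S)* β`. -/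
def omegaFlat (L : SymplecticLeaf P k S) (s : S) : TangentSpace (𝓡 k) s →ₗ[ℝ] Cot k s where
  toFun v := (L.exists_sharp s v).choose.comp (L.tmap s)
  map_add' v v' := by
    ext w
    refine (L.eq_on_tangent s (β' := (L.exists_sharp s v).choose + (L.exists_sharp s v').choose)
      ?_ w).trans rfl
    exact (L.exists_sharp s (v + v')).choose_spec.trans ((map_add _ _ _).trans
      ((congrArg₂ (· + ·) (L.exists_sharp s v).choose_spec.symm
        (L.exists_sharp s v').choose_spec.symm).trans (map_add _ _ _).symm))
  map_smul' c v := by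
    ext w
    refine (L.eq_on_tangent s (β' := c • (L.exists_sharp s v).choose) ?_ w).trans rfl
    exact (L.exists_sharp s (c • v)).choose_spec.trans ((map_smul _ _ _).trans
      ((congrArg (c • ·) (L.exists_sharp s v).choose_spec.symm).trans (map_smul _ _ _).symm))

theorem omegaFlat_apply (L : SymplecticLeaf P k S) (s : S) (v w : TangentSpace (𝓡 k) s)
    (β : Cot n (L.incl s)) (h : P.sharp (L.incl s) β = L.tmap s v) :
    L.omegaFlat s v w = β (L.tmap s w) :=
  L.eq_on_tangent s ((L.exists_sharp s v).choose_spec.trans h.symm) w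

/-- The fibre of `L = (TS)⁰` over `s`: the covectors of `Z` that vanish on `TS`. -/
def isotropy (L : SymplecticLeaf P k S) (s : S) : Submodule ℝ (Cot n (L.incl s)) where
  carrier := {β | ∀ v, β (L.tmap s v) = 0}
  add_mem' := by
    intro a b ha hb v
    simp [ha v, hb v]
  zero_mem' := by
    intro v
    simp
  smul_mem' := by
    intro c a ha v
    simp [ha v]

end SymplecticLeaf

end Leaf

/-- An embedded Lagrangian submanifold `X → S` of a symplectic leaf: at every point, `TX` is its own
`ω_S`-orthogonal complement. -/
structure LagrangianSubmanifold {n : ℕ} {Z : Type u} [TopologicalSpace Z]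
    [ChartedSpace (Model n) Z] [IsManifold (𝓡 n) ∞ Z] {P : PoissonStructure n Z} {k : ℕ}
    {S : Type v} [TopologicalSpace S] [ChartedSpace (Model k) S] [IsManifold (𝓡 k) ∞ S]
    (L : SymplecticLeaf P k S) (m : ℕ) (X : Type w) [TopologicalSpace X]
    [ChartedSpace (Model m) X] [IsManifold (𝓡 m) ∞ X] where
  incl : C^∞⟮𝓡 m, X; 𝓡 k, S⟯
  embedding : Manifold.IsSmoothEmbedding (𝓡 m) (𝓡 k) ∞ incl
  lagrangian : ∀ (x : X) (v : TangentSpace (𝓡 k) (incl x)),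
    v ∈ LinearMap.range (mfderiv (𝓡 m) (𝓡 k) incl x).toLinearMap ↔
      ∀ u : TangentSpace (𝓡 m) x, L.omegaFlat (incl x) v (mfderiv (𝓡 m) (𝓡 k) incl x u) = 0

section Lagrangian

variable {n : ℕ} {Z : Type u} [TopologicalSpace Z] [ChartedSpace (Model n) Z]
  [IsManifold (𝓡 n) ∞ Z] {P : PoissonStructure n Z} {k : ℕ} {S : Type v} [TopologicalSpace S]
  [ChartedSpace (Model k) S] [IsManifold (𝓡 k) ∞ S] {L : SymplecticLeaf P k S}
  {m : ℕ} {X : Type w} [TopologicalSpace X] [ChartedSpace (Model m) X] [IsManifold (𝓡 m) ∞ X]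

namespace LagrangianSubmanifold

/-- The inclusion `X → Z`. -/
def toZ (Λ : LagrangianSubmanifold L m X) (x : X) : Z := L.incl (Λ.incl x)

/-- The tangent map `T_x X → T_x S` of the inclusion. -/
def tmap (Λ : LagrangianSubmanifold L m X) (x : X) :
    TangentSpace (𝓡 m) x →L[ℝ] TangentSpace (𝓡 k) (Λ.incl x) :=
  mfderiv (𝓡 m) (𝓡 k) Λ.incl x

/-- `TX` as a subspace of `TS|_X`. -/
def tangent (Λ : LagrangianSubmanifold L m X) (x : X) :
    Submodule ℝ (TangentSpace (𝓡 k) (Λ.incl x)) := LinearMap.range (Λ.tmap x).toLinearMap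

/-- The fibre at `x` of the normal bundle `TS|_X / TX`. -/
abbrev Normal (Λ : LagrangianSubmanifold L m X) (x : X) : Type :=
  TangentSpace (𝓡 k) (Λ.incl x) ⧸ Λ.tangent x

/-- The fibre at `x` of `E_X = (TX)⁰ ⊂ T*Z|_X`. -/
def EX (Λ : LagrangianSubmanifold L m X) (x : X) : Submodule ℝ (Cot n (Λ.toZ x)) where
  carrier := {β | ∀ u, β (L.tmap (Λ.incl x) (Λ.tmap x u)) = 0}
  add_mem' := by
    intro a b ha hb v
    exact (congrArg₂ (· + ·) (ha v) (hb v)).trans (add_zero 0)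
  zero_mem' := by
    intro v
    rfl
  smul_mem' := by
    intro c a ha v
    exact (congrArg (c * ·) (ha v)).trans (mul_zero c)

/-- The fibre at `x` of the annihilator `(TX)⁰ ⊂ T*S|_X` of `TX` in `T*S`. -/
def annS (Λ : LagrangianSubmanifold L m X) (x : X) : Submodule ℝ (Cot k (Λ.incl x)) where
  carrier := {β | ∀ u, β (Λ.tmap x u) = 0}
  add_mem' := by
    intro a b ha hb v
    simp [ha v, hb v]
  zero_mem' := by
    intro v
    simp
  smul_mem' := by
    intro c a ha v
    simp [ha v]

/-- The fibre at `x` of `L_X = (TS)⁰|_X ⊂ T*Z|_X`. -/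
def LX (Λ : LagrangianSubmanifold L m X) (x : X) : Submodule ℝ (Cot n (Λ.toZ x)) :=
  L.isotropy (Λ.incl x)

/-- The restriction map `(T i_S)* : E_X → (TX)⁰ ⊂ T*S|_X`. -/
def restrict (Λ : LagrangianSubmanifold L m X) (x : X) : Λ.EX x →ₗ[ℝ] Λ.annS x where
  toFun β := ⟨ContinuousLinearMap.comp (β : Cot n (Λ.toZ x)) (L.tmap (Λ.incl x)), fun u => β.2 u⟩
  map_add' _ _ := rfl
  map_smul' _ _ := rfl

/-- `ω_X♭ = ω_S♭|_{TX} : TX → (TX)⁰ ⊂ T*S|_X`. -/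
def omegaX (Λ : LagrangianSubmanifold L m X) (x : X) :
    TangentSpace (𝓡 m) x →ₗ[ℝ] Λ.annS x where
  toFun u := ⟨L.omegaFlat (Λ.incl x) (Λ.tmap x u), (Λ.lagrangian x _).1 ⟨u, rfl⟩⟩
  map_add' u u' := by
    ext1
    simp
  map_smul' c u := by
    ext1
    simp

/-- The map `-ω_X♭ : TX → (TX)⁰ ⊂ T*S|_X`. -/
def negOmegaX (Λ : LagrangianSubmanifold L m X) (x : X) :
    TangentSpace (𝓡 m) x →ₗ[ℝ] Λ.annS x where
  toFun u := ⟨- (Λ.omegaX x u : Cot k (Λ.incl x)), fun w =>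
    (congrArg Neg.neg ((Λ.omegaX x u).2 w)).trans neg_zero⟩
  map_add' u u' := by
    ext1
    exact (congrArg Neg.neg (congrArg Subtype.val ((Λ.omegaX x).map_add u u'))).trans (neg_add _ _)
  map_smul' c u := by
    ext1
    exact (congrArg Neg.neg (congrArg Subtype.val ((Λ.omegaX x).map_smul c u))).trans
      (smul_neg c _).symm

/-- The dual map `(-ω_X♭)* : TS|_X / TX ≅ ((TX)⁰)* → T*X`, that is
`[v] ↦ (u ↦ (-ω_X♭ u)(v))`. -/
def negOmegaXDual (Λ : LagrangianSubmanifold L m X) (x : X) :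
    Λ.Normal x →ₗ[ℝ] (TangentSpace (𝓡 m) x →ₗ[ℝ] ℝ) :=
  (Λ.tangent x).liftQ
    { toFun := fun v =>
        { toFun := fun u => (Λ.negOmegaX x u : Cot k (Λ.incl x)) v
          map_add' := by intros; simp
          map_smul' := by intros; simp }
      map_add' := by intros; ext; simp
      map_smul' := by intros; ext; simp }
    (by
      rintro _ ⟨u', rfl⟩
      ext u
      exact (Λ.negOmegaX x u).2 u')

/-- A family of linear maps `TS|_X / TX → E_X` over `X` is a (smooth) bundle morphism: the induced
fibrewise linear map from the total space of `TS|_X` to that of `T*Z` is smooth. -/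
def IsBundleMorphism (Λ : LagrangianSubmanifold L m X)
    (t : ∀ x : X, Λ.Normal x →ₗ[ℝ] Λ.EX x) : Prop :=
  ContMDiff ((𝓡 m).prod 𝓘(ℝ, Model k)) (cotModel n) ∞
    (fun p : Bundle.TotalSpace (Model k)
        (Λ.incl *ᵖ (TangentSpace (𝓡 k) : S → Type)) =>
      cot n (Λ.toZ p.1) (t p.1 (Submodule.Quotient.mk p.2) : Cot n (Λ.toZ p.1)))

/-- The section `dH : Z → T*Z`. -/
def dSection (H : Z → ℝ) (z : Z) : CotBundle n Z := cot n z (diff n H z)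

/-- The vertical tangent vector of `T*Z` at the covector `α` with vertical component `β`. -/
def vertical (z : Z) (α β : Cot n z) : TangentSpace (cotModel n) (cot n z α) :=
  mfderiv 𝓘(ℝ, ℝ) (cotModel n) (fun t : ℝ => cot n z (α + t • β)) 0 (1 : ℝ)

/-- For `dH|_X = 0`, the family `t` is the transverse part `t^V H` of `T(dH)`: with respect to the
decomposition `T(T*Z) = TZ ⊕ T*Z` along the zero section `o` (the first summand embedded by `T o`,
the second as vertical vectors), `T(dH)(T i_S v) = T o (T i_S v) + t [v]` for all `v ∈ TS|_X`. -/
def IsTransverseDerivative (Λ : LagrangianSubmanifold L m X) (H : Z → ℝ)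
    (t : ∀ x : X, Λ.Normal x →ₗ[ℝ] Λ.EX x) : Prop :=
  ∀ (x : X) (v : TangentSpace (𝓡 k) (Λ.incl x)),
    (mfderiv (𝓡 n) (cotModel n) (dSection (n := n) H) (Λ.toZ x) (L.tmap (Λ.incl x) v) :
      Model n × (Model n →L[ℝ] ℝ))
    = (mfderiv (𝓡 n) (cotModel n) (fun z : Z => cot n z 0) (Λ.toZ x) (L.tmap (Λ.incl x) v) :
        Model n × (Model n →L[ℝ] ℝ))
      + (vertical (Λ.toZ x) 0 (t x (Submodule.Quotient.mk v) : Cot n (Λ.toZ x)) :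
        Model n × (Model n →L[ℝ] ℝ))

/-- `t^V H_0 = (T i_S)* ∘ t^V H : TS|_X / TX → (TX)⁰ ⊂ T*S|_X`. -/
def compose (Λ : LagrangianSubmanifold L m X) (t : ∀ x : X, Λ.Normal x →ₗ[ℝ] Λ.EX x) (x : X) :
    Λ.Normal x →ₗ[ℝ] Λ.annS x := Λ.restrict x ∘ₗ t x

/-- `γ♭ = (-ω_X♭)* ∘ t_0⁻¹ ∘ (-ω_X♭) : TX → T*X`. -/
def gammaFlat (Λ : LagrangianSubmanifold L m X) (t : ∀ x : X, Λ.Normal x →ₗ[ℝ] Λ.EX x)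
    (ht : ∀ x, Function.Bijective (Λ.compose t x)) (x : X) :
    TangentSpace (𝓡 m) x →ₗ[ℝ] (TangentSpace (𝓡 m) x →ₗ[ℝ] ℝ) :=
  Λ.negOmegaXDual x ∘ₗ (LinearEquiv.ofBijective _ (ht x)).symm.toLinearMap ∘ₗ Λ.negOmegaX x

/-- `α♭ = t ∘ t_0⁻¹ ∘ (-ω_X♭) : TX → E_X`. -/
def alphaFlat (Λ : LagrangianSubmanifold L m X) (t : ∀ x : X, Λ.Normal x →ₗ[ℝ] Λ.EX x)
    (ht : ∀ x, Function.Bijective (Λ.compose t x)) (x : X) :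
    TangentSpace (𝓡 m) x →ₗ[ℝ] Λ.EX x :=
  t x ∘ₗ (LinearEquiv.ofBijective _ (ht x)).symm.toLinearMap ∘ₗ Λ.negOmegaX x

end LagrangianSubmanifold

/-- A linear functional on a tangent space, as a covector. -/
def toCot {m : ℕ} {X : Type w} [TopologicalSpace X] [ChartedSpace (Model m) X] {x : X}
    (f : TangentSpace (𝓡 m) x →ₗ[ℝ] ℝ) : Cot m x where
  toLinearMap := f
  cont :=
    haveI : T2Space (TangentSpace (𝓡 m) x) := inferInstanceAs (T2Space (Model m))
    haveI : FiniteDimensional ℝ (TangentSpace (𝓡 m) x) :=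
      inferInstanceAs (FiniteDimensional ℝ (Model m))
    LinearMap.continuous_of_finiteDimensional f

/-- A (pseudo-Riemannian) metric on `X`: a smooth field of nondegenerate symmetric bilinear forms on
the tangent spaces. Smoothness is that of the fibrewise linear map `γ♭ : TX → T*X`. -/
structure IsMetric (m : ℕ) {X : Type w} [TopologicalSpace X] [ChartedSpace (Model m) X]
    [IsManifold (𝓡 m) ∞ X]
    (γ : ∀ x : X, TangentSpace (𝓡 m) x →ₗ[ℝ] (TangentSpace (𝓡 m) x →ₗ[ℝ] ℝ)) : Prop where
  symm : ∀ x u u', γ x u u' = γ x u' u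
  nondegenerate : ∀ x u, (∀ u', γ x u u' = 0) → u = 0
  smooth : ContMDiff (𝓡 m).tangent (cotModel m) ∞
    (fun p : TangentBundle (𝓡 m) X =>
      cot m p.1 (toCot (γ p.1 p.2)))

namespace LagrangianSubmanifold

/-- An `E_X`-connection form: a smooth bundle morphism `α♭ : TX → E_X` with `-ϖ♯ ∘ α♭ = id_{TX}`,
that is, a splitting of `0 → L_X → E_X → TX → 0`. -/
structure IsConnectionForm (Λ : LagrangianSubmanifold L m X)
    (α : ∀ x : X, TangentSpace (𝓡 m) x →ₗ[ℝ] Λ.EX x) : Prop where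
  split : ∀ x u, - P.sharp (Λ.toZ x) (α x u) = L.tmap (Λ.incl x) (Λ.tmap x u)
  smooth : ContMDiff (𝓡 m).tangent (cotModel n) ∞
    (fun p : TangentBundle (𝓡 m) X =>
      cot n (Λ.toZ p.1) (α p.1 p.2 : Cot n (Λ.toZ p.1)))

end LagrangianSubmanifold


/-! ### The Lie frame bundle -/

/-- A linear isomorphism `f : 𝔤 → L_s` is an isomorphism of Lie algebras, where the bracket on
`L_s = (T_s S)⁰` is the one of the transverse Lie algebra:
`[α, β] = d{F, G}` at `s` for any functions `F`, `G` with `dF = α` and `dG = β` at `s`. -/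
def SymplecticLeaf.IsLieIso (L : SymplecticLeaf P k S) {𝔤 : Type*} [LieRing 𝔤] [LieAlgebra ℝ 𝔤]
    (s : S) (f : 𝔤 ≃ₗ[ℝ] L.isotropy s) : Prop :=
  ∀ (ξ η : 𝔤) (F G : Z → ℝ), ContMDiff (𝓡 n) 𝓘(ℝ, ℝ) ∞ F → ContMDiff (𝓡 n) 𝓘(ℝ, ℝ) ∞ G →
    diff n F (L.incl s) = (f ξ : Cot n (L.incl s)) →
    diff n G (L.incl s) = (f η : Cot n (L.incl s)) →
    diff n (P.bracket F G) (L.incl s) = (f ⁅ξ, η⁆ : Cot n (L.incl s))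

/-- The Lie frame bundle `R_X`: its points over `x ∈ X` are the Lie algebra isomorphisms
`𝔤 → (L_X)_x`. -/
structure LieFrame (Λ : LagrangianSubmanifold L m X) (𝔤 : Type*) [LieRing 𝔤]
    [LieAlgebra ℝ 𝔤] where
  base : X
  iso : 𝔤 ≃ₗ[ℝ] Λ.LX base
  isLie : L.IsLieIso (Λ.incl base) iso

namespace LieFrame

variable {Λ : LagrangianSubmanifold L m X} {𝔤 : Type*} [LieRing 𝔤] [LieAlgebra ℝ 𝔤]

/-- The covector `f(ξ) ∈ T*Z`. The map `f ↦ (ξ ↦ f(ξ))` realizes `R_X` inside `(T*Z)^𝔤`, and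
smoothness and tangent vectors are those of this realization. -/
def cov (r : LieFrame Λ 𝔤) (ξ : 𝔤) : CotBundle n Z :=
  cot n (Λ.toZ r.base) (r.iso ξ : Cot n (Λ.toZ r.base))

/-- The right action `(f, a) ↦ f ∘ a` of `Aut(𝔤)` on `R_X`. -/
def act (r : LieFrame Λ 𝔤) (a : 𝔤 ≃ₗ⁅ℝ⁆ 𝔤) : LieFrame Λ 𝔤 where
  base := r.base
  iso := a.toLinearEquiv.trans r.iso
  isLie ξ η F G hF hG h₁ h₂ := by
    have h := r.isLie (a ξ) (a η) F G hF hG h₁ h₂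
    rw [← LieEquiv.map_lie] at h
    exact h

/-- Smooth maps from a finite-dimensional vector space to `R_X`. -/
structure IsSmooth {k' : ℕ} (φ : Model k' → LieFrame Λ 𝔤) : Prop where
  base : ContMDiff (𝓡 k') (𝓡 m) ∞ (fun y => (φ y).base)
  cov : ∀ ξ, ContMDiff (𝓡 k') (cotModel n) ∞ (fun y => (φ y).cov ξ)

variable (Λ 𝔤) in
/-- A smooth curve in `R_X`. -/
structure Curve where
  val : ℝ → LieFrame Λ 𝔤
  base : ContMDiff 𝓘(ℝ, ℝ) (𝓡 m) ∞ (fun t => (val t).base)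
  cov : ∀ ξ, ContMDiff 𝓘(ℝ, ℝ) (cotModel n) ∞ (fun t => (val t).cov ξ)

/-- Vectors along the realization of `R_X` in `(T*Z)^𝔤`. -/
abbrev Ambient (r : LieFrame Λ 𝔤) : Type _ := ∀ ξ : 𝔤, TangentSpace (cotModel n) (r.cov ξ)

/-- The velocity at time `0` of a curve in `R_X`. -/
def Curve.vel (c : Curve Λ 𝔤) : Ambient (c.val 0) := fun ξ =>
  mfderiv 𝓘(ℝ, ℝ) (cotModel n) (fun t : ℝ => (c.val t).cov ξ) 0 (1 : ℝ)

/-- The velocity at time `0` in `X` of the base curve. -/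
def Curve.baseVel (c : Curve Λ 𝔤) : TangentSpace (𝓡 m) (c.val 0).base :=
  mfderiv 𝓘(ℝ, ℝ) (𝓡 m) (fun t : ℝ => (c.val t).base) 0 (1 : ℝ)

/-- The tangent space `T_r R_X`, spanned by the velocities of smooth curves through `r`. -/
def tangent (r : LieFrame Λ 𝔤) : Submodule ℝ (Ambient r) :=
  Submodule.span ℝ {τ | ∃ c : Curve Λ 𝔤, ∃ h : c.val 0 = r, h ▸ c.vel = τ}

/-- The tangent vector of `R_X` given by a smooth curve. -/
def Curve.tan (c : Curve Λ 𝔤) : tangent (c.val 0) :=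
  ⟨c.vel, Submodule.subset_span ⟨c, rfl, rfl⟩⟩

/-- The curve `t ↦ c(t) ∘ a`. -/
def Curve.act (c : Curve Λ 𝔤) (a : 𝔤 ≃ₗ⁅ℝ⁆ 𝔤) : Curve Λ 𝔤 where
  val t := (c.val t).act a
  base := c.base
  cov ξ := c.cov (a ξ)

/-- The curve `t ↦ φ(y + t w)` for a smooth map `φ` to `R_X`. -/
def IsSmooth.curve {k' : ℕ} {φ : Model k' → LieFrame Λ 𝔤} (hφ : IsSmooth φ) (y w : Model k') :
    Curve Λ 𝔤 where
  val t := φ (y + t • w)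
  base := hφ.base.comp (ContDiff.contMDiff (by fun_prop))
  cov ξ := (hφ.cov ξ).comp (ContDiff.contMDiff (by fun_prop))

/-- The fundamental vertical vector at `r = f` of a derivation `D ∈ Lie(Aut(𝔤)) = Der(𝔤)`, that is
the velocity of `t ↦ f ∘ exp(tD)`: its `ξ`-component is the vertical vector `f(Dξ)` at `f(ξ)`. -/
def fundamental (r : LieFrame Λ 𝔤) (D : LieDerivation ℝ 𝔤 𝔤) : Ambient r := fun ξ =>
  LagrangianSubmanifold.vertical (Λ.toZ r.base) (r.iso ξ : Cot n (Λ.toZ r.base))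
    (r.iso (D ξ) : Cot n (Λ.toZ r.base))

/-- `σ` is a smooth section of `R_X` over the open set `U ⊂ X`. (Its values outside of `U` are
irrelevant.) -/
structure IsLocalSection (σ : X → LieFrame Λ 𝔤) (U : Set X) : Prop where
  isOpen : IsOpen U
  base : ∀ y ∈ U, (σ y).base = y
  smooth : ∀ ξ, ContMDiffOn (𝓡 m) (cotModel n) ∞ (fun y => (σ y).cov ξ) U

variable (Λ 𝔤) in
/-- `R_X` is a principal bundle with structure group `Aut(𝔤)`: the group acts simply transitively on
the fibres, and there is a smooth section around every point of `X`. -/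
structure IsPrincipalBundle : Prop where
  simplyTransitive : ∀ r r' : LieFrame Λ 𝔤, r.base = r'.base → ∃! a : 𝔤 ≃ₗ⁅ℝ⁆ 𝔤, r' = r.act a
  localSection : ∀ x : X, ∃ (U : Set X) (σ : X → LieFrame Λ 𝔤), x ∈ U ∧ IsLocalSection σ U

/-- `A` is a principal connection form on `R_X`: a smooth one-form with values in
`Lie(Aut(𝔤)) = Der(𝔤)` that reproduces the generators of fundamental vector fields and satisfies
`R_a^* A = Ad(a⁻¹) A`. -/
structure IsPrincipalConnectionForm
    (A : ∀ r : LieFrame Λ 𝔤, tangent r →ₗ[ℝ] LieDerivation ℝ 𝔤 𝔤) : Prop where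
  smooth : ∀ (k' : ℕ) (φ : Model k' → LieFrame Λ 𝔤) (hφ : IsSmooth φ) (w : Model k') (ξ : 𝔤)
    (l : Module.Dual ℝ 𝔤),
    ContDiff ℝ ∞ (fun y : Model k' => l (A _ (hφ.curve y w).tan ξ))
  vertical : ∀ (r : LieFrame Λ 𝔤) (D : LieDerivation ℝ 𝔤 𝔤) (τ : tangent r),
    τ.1 = fundamental r D → A r τ = D
  equivariant : ∀ (c : Curve Λ 𝔤) (a : 𝔤 ≃ₗ⁅ℝ⁆ 𝔤) (ξ : 𝔤),
    A _ (c.act a).tan ξ = a.symm (A _ c.tan (a ξ))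

end LieFrame

/-- `β` is the value at `x` of `∇^α_u η = {α(V), η}`, where `V` is a vector field on `X` with
`V(x) = u`, `η` is a section of `L_X` near `x`, and the bracket of sections of `E_X` is computed by
extending them to one-forms on `Z`. -/
def LagrangianSubmanifold.IsNabla (Λ : LagrangianSubmanifold L m X)
    (α : ∀ x : X, TangentSpace (𝓡 m) x →ₗ[ℝ] Λ.EX x) (x : X) (u : TangentSpace (𝓡 m) x)
    (η : X → CotBundle n Z) (β : Cot n (Λ.toZ x)) : Prop :=
  ∀ (V : VField m X) (a e : OneForm n Z), V.val x = u →
    (∀ᶠ y in nhds x, a.val (Λ.toZ y) = (α y (V.val y) : Cot n (Λ.toZ y))) →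
    (∀ᶠ y in nhds x, cot n (Λ.toZ y) (e.val (Λ.toZ y)) = η y) →
    ∀ W : VField n Z, P.formBracket a.val e.val W.val (Λ.toZ x) = β (W.val (Λ.toZ x))

/-- The one-form `A` on `R_X` induces the covariant derivative `∇^α` on `L_X = 𝔤(R_X)`:
`∇^α_u (σ ξ) = σ (A(Tσ u) ξ)` for every local section `σ` of `R_X` and `ξ ∈ 𝔤`. The vector `Tσ u` is
given by a curve `c` that lies on `σ` near time `0`. -/
def LieFrame.Induces {Λ : LagrangianSubmanifold L m X} {𝔤 : Type*} [LieRing 𝔤] [LieAlgebra ℝ 𝔤]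
    (A : ∀ r : LieFrame Λ 𝔤, LieFrame.tangent r →ₗ[ℝ] LieDerivation ℝ 𝔤 𝔤)
    (α : ∀ x : X, TangentSpace (𝓡 m) x →ₗ[ℝ] Λ.EX x) : Prop :=
  ∀ (U : Set X) (σ : X → LieFrame Λ 𝔤), LieFrame.IsLocalSection σ U →
    ∀ c : LieFrame.Curve Λ 𝔤, (c.val 0).base ∈ U →
      (∀ᶠ t in nhds (0 : ℝ), c.val t = σ (c.val t).base) →
      ∀ ξ : 𝔤, Λ.IsNabla α (c.val 0).base c.baseVel (fun y => (σ y).cov ξ)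
        ((c.val 0).iso (A _ c.tan ξ) : Cot n (Λ.toZ (c.val 0).base))

end Lagrangian
end PoissonGauge
end

/-!
# The connection on the Lie frame bundle of a Lagrangian submanifold

Write `B` for the Poisson tensor in a chart. At a point `x` where `dH = 0` the second derivative
`D²H` is a well-defined symmetric bilinear form on `T_x Z`, and the vertical part of `T(dH)(v)` is the
covector `D²H(v, ·)`. As `dH` vanishes along `X`, so does `D²H(u, ·)` for `u ∈ TX`; by symmetry
`D²H(v, ·)` annihilates `TX`. This is the map `t^V H` (`LagrangianSubmanifold.transverse`).

**Metric and splitting.** If `t^V H₀` is invertible, then each `u ∈ TX` has a unique normal vector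
`[v]` with `D²H(v, ·) = -ω(u, ·)` on `TS`. Then `γ(u, u') = D²H(v', v)` is symmetric, and it is
nondegenerate because `TX` is its own `ω`-orthogonal complement. The covector `α(u) = D²H(v, ·)`
restricts on `TS` to `-ω(u, ·)`, and therefore `-ϖ♯ α(u) = u`. Smoothness is that of the solution of a
linear system with smooth coefficients (`contMDiffAt_of_clm_apply_eq`), applied to the
representative `v` orthogonal to `TX` in coordinates.

**The covariant derivative.** The isotropy algebra at a point is the kernel of `B`, with the bracket
`[a, b] = a(∂B b)` (`isoBracket`), an expression that makes sense for all covectors. Along a curve with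
velocity `-B a`, the covariant derivative of a curve `b` of covectors is `∇b = b' + a(∂B b)`. The Jacobi
identity of `B` shows that `∇` preserves the kernel of `B`, and the derivative of the Jacobi identity
shows that `∇` is a derivation of the bracket (`IsPoissonNear.hasDerivAt_sharp`,
`IsPoissonNear.hasDerivAt_isoBracket`). The bracket `{α, e}` of one-forms reduces to `∇e` in coordinates
(`PoissonStructure.formBracket_eq`).

**The principal bundle.** Parallel transport for such a connection along the rays of a chart of `S`
trivializes the bundle of isotropy algebras (`exists_local_trivialization`). The smooth dependence of
the transport on the end point comes from the inversion of Volterra operators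
(`exists_radial_transport`). As `S` is connected, all isotropy algebras are isomorphic, and the frame
bundle has local sections.

**The connection form.** For a curve `c` of Lie frames, `∇(c ξ) = c(D ξ)` with a derivation `D`. The
derivation depends on the velocity of `c` only, and linearly so (`LieFrame.IsCovariant`); it is the
value of the connection form (`LieFrame.inducedForm`). Conversely, a velocity of a curve of frames is
the sum of the velocity of a curve in the image of a local section, where a form inducing `∇` is
determined by `α`, and of a fundamental vector, where it is prescribed. Hence the form is unique.
-/

noncomputable section

set_option maxSynthPendingDepth 3

namespace PoissonGauge

universe u v w

open Filter Topology Bundle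

/-! ### Poisson tensors on a vector space -/

section LocalPoisson

variable {E : Type*} [NormedAddCommGroup E] [NormedSpace ℝ E]

/-- The field `B : E → Hom(E*, E)` is a Poisson tensor near the point `y` of the vector space `E`:
it is smooth, skew, and satisfies the Jacobi identity for the differentials of linear functions. These
span the covectors, so that nothing is lost, and all identities below become linear combinations of
derivatives of the two identities. -/
structure IsPoissonNear (B : E → ((E →L[ℝ] ℝ) →L[ℝ] E)) (y : E) : Prop where
  smooth : ∀ᶠ z in 𝓝 y, ContDiffAt ℝ ∞ B z
  skew : ∀ᶠ z in 𝓝 y, ∀ f g : E →L[ℝ] ℝ, f (B z g) = - g (B z f)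
  jacobi : ∀ᶠ z in 𝓝 y, ∀ f g h : E →L[ℝ] ℝ, g (fderiv ℝ B z (B z f) h)
    + h (fderiv ℝ B z (B z g) f) + f (fderiv ℝ B z (B z h) g) = 0

/-- The covector `w ↦ a (∂_w B b)`. If `a` and `b` lie in the kernel of `B y`, this is the bracket of
the isotropy Lie algebra at `y`. -/
def isoBracket (B : E → ((E →L[ℝ] ℝ) →L[ℝ] E)) (y : E) (a b : E →L[ℝ] ℝ) : E →L[ℝ] ℝ :=
  a.comp ((fderiv ℝ B y).flip b)

@[simp] theorem isoBracket_apply (B : E → ((E →L[ℝ] ℝ) →L[ℝ] E)) (y : E) (a b : E →L[ℝ] ℝ) (w : E) :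
    isoBracket B y a b w = a (fderiv ℝ B y w b) := rfl

namespace IsPoissonNear

variable {B : E → ((E →L[ℝ] ℝ) →L[ℝ] E)} {y : E}

theorem eventually (h : IsPoissonNear B y) : ∀ᶠ z in 𝓝 y, IsPoissonNear B z := by
  filter_upwards [h.smooth.eventually_nhds, h.skew.eventually_nhds, h.jacobi.eventually_nhds]
    with z h₁ h₂ h₃ using ⟨h₁, h₂, h₃⟩

theorem contDiffAt (h : IsPoissonNear B y) : ContDiffAt ℝ ∞ B y := h.smooth.self_of_nhds

theorem hasFDerivAt (h : IsPoissonNear B y) : HasFDerivAt B (fderiv ℝ B y) y :=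
  (h.contDiffAt.differentiableAt (by simp)).hasFDerivAt

theorem hasFDerivAt_fderiv (h : IsPoissonNear B y) :
    HasFDerivAt (fderiv ℝ B) (fderiv ℝ (fderiv ℝ B) y) y :=
  ((h.contDiffAt.fderiv_right (m := ∞) (by simp)).differentiableAt (by simp)).hasFDerivAt

theorem symm_second (h : IsPoissonNear B y) (u w : E) :
    fderiv ℝ (fderiv ℝ B) y u w = fderiv ℝ (fderiv ℝ B) y w u :=
  second_derivative_symmetric_of_eventually
    (h.eventually.mono fun _ hz => hz.hasFDerivAt) h.hasFDerivAt_fderiv u w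

theorem skew_at (h : IsPoissonNear B y) (f g : E →L[ℝ] ℝ) : f (B y g) = - g (B y f) :=
  h.skew.self_of_nhds f g

theorem jacobi_at (h : IsPoissonNear B y) (f g k : E →L[ℝ] ℝ) :
    g (fderiv ℝ B y (B y f) k) + k (fderiv ℝ B y (B y g) f) + f (fderiv ℝ B y (B y k) g) = 0 :=
  h.jacobi.self_of_nhds f g k

/-- The derivatives of a skew tensor are skew. -/
theorem skew_fderiv (h : IsPoissonNear B y) (w : E) (f g : E →L[ℝ] ℝ) :
    f (fderiv ℝ B y w g) = - g (fderiv ℝ B y w f) := by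
  have h₁ : ∀ f g : E →L[ℝ] ℝ, HasFDerivAt (fun z => f (B z g))
      (f.comp ((fderiv ℝ B y).flip g)) y := fun f g =>
    f.hasFDerivAt.comp y ((h.hasFDerivAt.clm_apply (hasFDerivAt_const g y)).congr_fderiv
      (by ext; simp))
  have h₂ := ((h₁ g f).neg.congr_of_eventuallyEq (h.skew.mono fun z hz => hz f g)).unique (h₁ f g)
  simpa using (congrArg (fun T => T w) h₂).symm

theorem skew_second (h : IsPoissonNear B y) (u w : E) (f g : E →L[ℝ] ℝ) :
    f (fderiv ℝ (fderiv ℝ B) y u w g) = - g (fderiv ℝ (fderiv ℝ B) y u w f) := by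
  have h₁ : ∀ f g : E →L[ℝ] ℝ, HasFDerivAt (fun z => f (fderiv ℝ B z w g))
      (f.comp (((fderiv ℝ (fderiv ℝ B) y).flip w).flip g)) y := fun f g =>
    f.hasFDerivAt.comp y (((h.hasFDerivAt_fderiv.clm_apply (hasFDerivAt_const w y)).clm_apply
      (hasFDerivAt_const g y)).congr_fderiv (by ext; simp))
  have h₂ := ((h₁ g f).neg.congr_of_eventuallyEq
    (h.eventually.mono fun z hz => hz.skew_fderiv w f g)).unique (h₁ f g)
  simpa using (congrArg (fun T => T u) h₂).symm

/-- The derivative of the Jacobi identity in the direction `w`. -/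
theorem jacobi_fderiv (h : IsPoissonNear B y) (w : E) (f g k : E →L[ℝ] ℝ) :
    g (fderiv ℝ (fderiv ℝ B) y w (B y f) k) + g (fderiv ℝ B y (fderiv ℝ B y w f) k)
    + (k (fderiv ℝ (fderiv ℝ B) y w (B y g) f) + k (fderiv ℝ B y (fderiv ℝ B y w g) f))
    + (f (fderiv ℝ (fderiv ℝ B) y w (B y k) g) + f (fderiv ℝ B y (fderiv ℝ B y w k) g)) = 0 := by
  have key : ∀ f g k : E →L[ℝ] ℝ, ∃ T : E →L[ℝ] ℝ,
      HasFDerivAt (fun z => g (fderiv ℝ B z (B z f) k)) T y ∧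
      T w = g (fderiv ℝ (fderiv ℝ B) y w (B y f) k) + g (fderiv ℝ B y (fderiv ℝ B y w f) k) := by
    intro f g k
    refine ⟨_, g.hasFDerivAt.comp y ((h.hasFDerivAt_fderiv.clm_apply
      (h.hasFDerivAt.clm_apply (hasFDerivAt_const f y))).clm_apply (hasFDerivAt_const k y)), ?_⟩
    simp [add_comm]
  obtain ⟨T₁, h₁, e₁⟩ := key f g k
  obtain ⟨T₂, h₂, e₂⟩ := key g k f
  obtain ⟨T₃, h₃, e₃⟩ := key k f g
  have h₀ := ((h₁.add h₂).add h₃).unique ((hasFDerivAt_const (0 : ℝ) y).congr_of_eventuallyEq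
    (h.jacobi.mono fun z hz => hz f g k))
  rw [← e₁, ← e₂, ← e₃]
  simpa using congrArg (fun T => T w) h₀

/-- Along a curve with velocity `-B a`, the vector `B b` changes by `B (∇ b) - (∂_{B b} B) a`, where
`∇ b = b' + isoBracket a b`. In particular `∇` preserves the kernel of `B`. -/
theorem hasDerivAt_sharp {y : ℝ → E} {b : ℝ → (E →L[ℝ] ℝ)} {t : ℝ} (h : IsPoissonNear B (y t))
    {a b' : E →L[ℝ] ℝ} (hy : HasDerivAt y (- B (y t) a) t) (hb : HasDerivAt b b' t) :
    HasDerivAt (fun s => B (y s) (b s))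
      (B (y t) (b' + isoBracket B (y t) a (b t)) - fderiv ℝ B (y t) (B (y t) (b t)) a) t := by
  have h₁ := (h.hasFDerivAt.comp_hasDerivAt t hy).clm_apply hb
  refine h₁.congr_deriv ((SeparatingDual.eq_iff_forall_dual_eq (R := ℝ)).2 fun γ => ?_)
  have h₂ := h.jacobi_at a γ (b t)
  have h₃ := h.skew_at γ (isoBracket B (y t) a (b t))
  have h₄ := h.skew_fderiv (B (y t) γ) (b t) a
  have h₅ := h.skew_fderiv (B (y t) (b t)) γ a
  simp only [map_neg, neg_apply, map_add, map_sub, isoBracket_apply, Function.comp_apply] at *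
  linarith

/-- The covariant derivative `∇ b = b' + isoBracket a b` along a curve with velocity `-B a` is a
derivation of the bracket of the isotropy algebras. -/
theorem hasDerivAt_isoBracket {y : ℝ → E} {b c : ℝ → (E →L[ℝ] ℝ)} {t : ℝ}
    (h : IsPoissonNear B (y t)) {a b' c' : E →L[ℝ] ℝ} (hy : HasDerivAt y (- B (y t) a) t)
    (hb : HasDerivAt b b' t) (hc : HasDerivAt c c' t)
    (hb0 : B (y t) (b t) = 0) (hc0 : B (y t) (c t) = 0) :
    HasDerivAt (fun s => isoBracket B (y s) (b s) (c s))
      (isoBracket B (y t) (b' + isoBracket B (y t) a (b t)) (c t)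
        + isoBracket B (y t) (b t) (c' + isoBracket B (y t) a (c t))
        - isoBracket B (y t) a (isoBracket B (y t) (b t) (c t))) t := by
  have h₀ := h.hasFDerivAt_fderiv.comp_hasDerivAt t hy
  have h₁ : HasDerivAt (fun s => ContinuousLinearMap.apply ℝ E (c s))
      (ContinuousLinearMap.apply ℝ E c') t :=
    (ContinuousLinearMap.apply ℝ E (E := E →L[ℝ] ℝ)).hasFDerivAt.comp_hasDerivAt t hc
  have h₂ : HasDerivAt (fun s => isoBracket B (y s) (b s) (c s)) _ t :=
    hb.clm_comp (h₁.clm_comp h₀)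
  refine h₂.congr_deriv ?_
  ext w
  have j := h.jacobi_fderiv w (b t) a (c t)
  have s₁ := h.symm_second (B (y t) a) w
  have s₂ := h.skew_second w (B (y t) a) (c t) (b t)
  have s₃ := h.skew_fderiv (fderiv ℝ B (y t) w a) (c t) (b t)
  have s₄ := h.skew_fderiv w (isoBracket B (y t) (b t) (c t)) a
  have s₅ := h.skew_fderiv (fderiv ℝ B (y t) w (c t)) (b t) a
  have s₆ := h.skew_fderiv w (b t) (isoBracket B (y t) a (c t))
  -- the identity is `jacobi_fderiv` for `b, a, c`, with the terms reordered by skewness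
  simp [hb0, hc0, s₁] at *
  linarith

end IsPoissonNear

end LocalPoisson

/-! ### Linear differential equations with parameters -/

section Curry

universe a

variable {E F : Type a} [NormedAddCommGroup E] [NormedAddCommGroup F]

/-- The map `t ↦ f (x, t)` on the unit interval. -/
def curryUnit (f : C(E × ℝ, F)) (x : E) : C(unitInterval, F) :=
  ⟨fun t => f (x, (t : ℝ)), by fun_prop⟩

@[simp] theorem curryUnit_apply (f : C(E × ℝ, F)) (x : E) (t : unitInterval) :
    curryUnit f x t = f (x, (t : ℝ)) := rfl

theorem continuous_curryUnit (f : C(E × ℝ, F)) : Continuous (curryUnit f) :=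
  ContinuousMap.continuous_of_continuous_uncurry _
    (f.continuous.comp (continuous_fst.prodMk (continuous_subtype_val.comp continuous_snd)))

variable [NormedSpace ℝ E] [NormedSpace ℝ F]

variable (E F) in
/-- A continuous family of linear maps `E → F` over the unit interval, as a linear map from `E` to
the continuous families of elements of `F`. -/
def swapUnit : C(unitInterval, E →L[ℝ] F) →L[ℝ] (E →L[ℝ] C(unitInterval, F)) :=
  LinearMap.mkContinuous₂
    (LinearMap.mk₂ ℝ (fun (g : C(unitInterval, E →L[ℝ] F)) (v : E) =>
      (⟨fun t => g t v, by fun_prop⟩ : C(unitInterval, F)))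
      (by intros; ext; simp) (by intros; ext; simp) (by intros; ext; simp) (by intros; ext; simp))
    1 (by
      intro g v
      rw [ContinuousMap.norm_le _ (by positivity)]
      intro t
      calc ‖g t v‖ ≤ ‖g t‖ * ‖v‖ := (g t).le_opNorm v
        _ ≤ 1 * ‖g‖ * ‖v‖ := by
          rw [one_mul]
          exact mul_le_mul_of_nonneg_right (g.norm_coe_le_norm t) (norm_nonneg v))

@[simp] theorem swapUnit_apply (g : C(unitInterval, E →L[ℝ] F)) (v : E) (t : unitInterval) :
    swapUnit E F g v t = g t v := rfl

theorem hasFDerivAt_curryUnit (f : C(E × ℝ, F)) (f' : C(E × ℝ, E →L[ℝ] F))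
    (h : ∀ x t, HasFDerivAt (fun x => f (x, t)) (f' (x, t)) x) (x : E) :
    HasFDerivAt (curryUnit f) (swapUnit E F (curryUnit f' x)) x := by
  rw [hasFDerivAt_iff_isLittleO, Asymptotics.isLittleO_iff]
  intro ε hε
  have h₁ := Metric.continuousAt_iff.1 ((continuous_curryUnit f').continuousAt (x := x)) ε hε
  obtain ⟨δ, hδ, h₂⟩ := h₁
  filter_upwards [Metric.ball_mem_nhds x hδ] with y hy
  rw [ContinuousMap.norm_le _ (by positivity)]
  intro t
  refine (convex_ball x δ).norm_image_sub_le_of_norm_hasFDerivWithin_le'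
    (f := fun x => f (x, (t : ℝ))) (φ := f' (x, (t : ℝ)))
    (fun z _ => (h z t).hasFDerivWithinAt) (fun z hz => ?_) (Metric.mem_ball_self hδ) hy
  have h₃ := ((curryUnit f' z - curryUnit f' x).norm_coe_le_norm t).trans
    ((dist_eq_norm (curryUnit f' z) (curryUnit f' x)).symm.le.trans (h₂ hz).le)
  exact h₃

/-- By induction on the order of differentiability: the derivative of `curryUnit f` is, up to the
continuous linear map `swapUnit`, of the form `curryUnit f'`. The induction changes the space of
values `F`, which is why `E` and `F` live in the same universe. -/
theorem contDiff_curryUnit_nat (n : ℕ) : ∀ {F : Type a} [NormedAddCommGroup F] [NormedSpace ℝ F]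
    (f : C(E × ℝ, F)), ContDiff ℝ ∞ f → ContDiff ℝ n (curryUnit f) := by
  induction n with
  | zero => exact fun f _ => contDiff_zero.2 (continuous_curryUnit f)
  | succ n ih =>
    intro F _ _ f hf
    have h₁ : ContDiff ℝ ∞ (fun p => (fderiv ℝ f p).comp (ContinuousLinearMap.inl ℝ E ℝ)) :=
      (hf.fderiv_right (m := ∞) (by simp)).clm_comp contDiff_const
    let f' : C(E × ℝ, E →L[ℝ] F) := ⟨_, h₁.continuous⟩
    have h₂ : ∀ x t, HasFDerivAt (fun x => f (x, t)) (f' (x, t)) x := by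
      intro x t
      exact (hf.differentiable (by simp) (x, t)).hasFDerivAt.comp (f := fun x : E => (x, t)) x
        (hasFDerivAt_prodMk_left x t)
    refine contDiff_succ_iff_hasFDerivAt.2 ⟨fun x => swapUnit E F (curryUnit f' x), ?_,
      hasFDerivAt_curryUnit f f' h₂⟩
    exact (swapUnit E F).contDiff.comp (ih f' h₁)

/-- A smooth family of curves is a smooth map into the space of continuous curves. -/
theorem contDiff_curryUnit (f : C(E × ℝ, F)) (hf : ContDiff ℝ ∞ f) :
    ContDiff ℝ ∞ (curryUnit f) :=
  contDiff_infty.2 fun n => contDiff_curryUnit_nat n f hf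

end Curry

section Volterra

variable {A : Type*} [NormedRing A]

/-- The extension of a function on the unit interval to the line that is constant on either side. -/
def extendUnit (g : C(unitInterval, A)) : ℝ → A := Set.IccExtend zero_le_one g

theorem continuous_extendUnit (g : C(unitInterval, A)) : Continuous (extendUnit g) :=
  g.continuous.Icc_extend'

theorem extendUnit_of_mem (g : C(unitInterval, A)) {t : ℝ} (ht : t ∈ Set.Icc (0 : ℝ) 1) :
    extendUnit g t = g ⟨t, ht⟩ := Set.IccExtend_of_mem _ _ ht

variable [NormedAlgebra ℝ A]

variable (A) in
/-- The Volterra operator `g ↦ (t ↦ ∫₀ᵗ g)`. -/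
def volterra : C(unitInterval, A) →L[ℝ] C(unitInterval, A) :=
  LinearMap.mkContinuous
    { toFun := fun g => ⟨fun t => ∫ s in (0 : ℝ)..t, extendUnit g s,
        (intervalIntegral.continuous_primitive
          (fun _ _ => (continuous_extendUnit g).intervalIntegrable _ _) 0).comp
            continuous_subtype_val⟩
      map_add' := by
        intro g h
        ext t
        exact intervalIntegral.integral_add ((continuous_extendUnit g).intervalIntegrable _ _)
          ((continuous_extendUnit h).intervalIntegrable _ _)
      map_smul' := by
        intro c g
        ext t
        exact intervalIntegral.integral_smul c _ }
    1 (by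
      intro g
      rw [ContinuousMap.norm_le _ (by positivity)]
      intro t
      have h := intervalIntegral.norm_integral_le_of_norm_le_const (a := 0) (b := (t : ℝ))
        (f := extendUnit g) (C := ‖g‖) (fun s _ => g.norm_coe_le_norm _)
      refine h.trans ?_
      rw [one_mul, sub_zero, abs_of_nonneg t.2.1]
      exact mul_le_of_le_one_right (norm_nonneg g) t.2.2)

/-- The operator `g ↦ g - ∫ c g` of the integral form of the equation `g' = c g`. -/
def volterraOp (c : C(unitInterval, A)) : C(unitInterval, A) →L[ℝ] C(unitInterval, A) :=
  1 - (volterra A).comp (ContinuousLinearMap.mul ℝ _ c)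

theorem contDiff_volterraOp : ContDiff ℝ ∞ (volterraOp (A := A)) :=
  contDiff_const.sub (contDiff_const.clm_comp (ContinuousLinearMap.contDiff _))

variable (A) in
theorem volterraOp_zero : volterraOp (0 : C(unitInterval, A)) = 1 := by
  simp [volterraOp]

variable [CompleteSpace A] in
/-- A continuous solution of the integral equation solves the differential equation. -/
theorem exists_hasDerivAt_of_volterraOp (c g : C(unitInterval, A)) (h : volterraOp c g = 1) :
    ∃ f : ℝ → A, f 0 = 1 ∧ f 1 = g 1 ∧
      ∀ t (ht : t ∈ Set.Icc (0 : ℝ) 1), HasDerivAt f (c ⟨t, ht⟩ * f t) t := by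
  have h₀ : ∀ t : unitInterval, g t = 1 + ∫ s in (0 : ℝ)..t, extendUnit (c * g) s := by
    intro t
    have h₁ := congrArg (fun k : C(unitInterval, A) => k t) h
    have h₂ : g t - ∫ s in (0 : ℝ)..t, extendUnit (c * g) s = 1 := h₁
    rw [← h₂]
    abel
  refine ⟨fun t => 1 + ∫ s in (0 : ℝ)..t, extendUnit (c * g) s, by simp, ?_, ?_⟩
  · rw [h₀ 1]
    rfl
  · intro t ht
    have h₁ := (intervalIntegral.integral_hasDerivAt_right
      ((continuous_extendUnit (c * g)).intervalIntegrable 0 t)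
      (continuous_extendUnit (c * g)).stronglyMeasurable.stronglyMeasurableAtFilter
      (continuous_extendUnit (c * g)).continuousAt).const_add 1
    refine h₁.congr_deriv ?_
    rw [extendUnit_of_mem _ ht, ContinuousMap.mul_apply, h₀ ⟨t, ht⟩]

end Volterra

/-- The Volterra operator of the integral equation depends smoothly on the coefficients, and hence so
does its inverse near a point where it is the identity. Therefore the solutions at time `1` of the
equations `h' = - Γ_{t y}(y) h`, `h(0) = 1`, that is the parallel
transport of the connection form `Γ` along the rays from the origin, depend smoothly on `y`. -/
theorem exists_radial_transport {E A : Type} [NormedAddCommGroup E] [NormedSpace ℝ E]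
    [FiniteDimensional ℝ E] [NormedRing A] [NormedAlgebra ℝ A] [CompleteSpace A]
    (Γ : E → E →L[ℝ] A) (hΓ : ∀ᶠ y in 𝓝 0, ContDiffAt ℝ ∞ Γ y) :
    ∃ G : E → A, (∀ᶠ y in 𝓝 0, ContDiffAt ℝ ∞ G y) ∧ G 0 = 1 ∧
      ∀ᶠ y in 𝓝 (0 : E), ∃ f : ℝ → A, f 0 = 1 ∧ f 1 = G y ∧
        ∀ t ∈ Set.Icc (0 : ℝ) 1, HasDerivAt f (-(Γ (t • y) y) * f t) t := by
  obtain ⟨r, hr, hball⟩ := Metric.eventually_nhds_iff_ball.1 hΓ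
  -- A cut-off makes the connection form smooth on the whole space.
  let χ : ContDiffBump (0 : E) := ⟨r / 4, r / 2, by positivity, by linarith⟩
  have hχ : ContDiff ℝ ∞ (fun y => χ y • Γ y) := by
    rw [contDiff_iff_contDiffAt]
    intro y
    by_cases hy : y ∈ Metric.ball (0 : E) r
    · exact χ.contDiffAt.smul (hball y hy)
    · have h₀ : ∀ᶠ z in 𝓝 y, χ z • Γ z = 0 := by
        have h₁ : y ∉ tsupport χ := by
          rw [χ.tsupport_eq]
          intro h₂
          exact hy (Metric.closedBall_subset_ball (by change r / 2 < r; linarith) h₂)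
        filter_upwards [(isClosed_tsupport χ).isOpen_compl.mem_nhds h₁] with z hz
        rw [image_eq_zero_of_notMem_tsupport hz, zero_smul]
      exact contDiffAt_const.congr_of_eventuallyEq h₀
  have hf : ContDiff ℝ ∞ (fun p : E × ℝ => -(χ (p.2 • p.1) • Γ (p.2 • p.1)) p.1) :=
    ((hχ.comp (contDiff_snd.smul contDiff_fst)).clm_apply contDiff_fst).neg
  let c : C(E × ℝ, A) := ⟨_, hf.continuous⟩
  have hc : ContDiff ℝ ∞ (fun y => volterraOp (curryUnit c y)) :=
    contDiff_volterraOp.comp (contDiff_curryUnit c hf)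
  have hc0 : volterraOp (curryUnit c 0) = 1 := by
    have : curryUnit c 0 = 0 := by
      ext t
      simp [c]
    rw [this, volterraOp_zero]
  have hunit : ∀ᶠ y in 𝓝 (0 : E), IsUnit (volterraOp (curryUnit c y)) := by
    have h₁ : IsUnit (volterraOp (curryUnit c 0)) := hc0 ▸ isUnit_one
    exact hc.continuous.continuousAt.eventually (Units.isOpen.mem_nhds h₁)
  refine ⟨fun y => Ring.inverse (volterraOp (curryUnit c y)) 1 1, ?_, ?_, ?_⟩
  · filter_upwards [hunit] with y hy
    have h₁ : ContDiffAt ℝ ∞ (fun y => Ring.inverse (volterraOp (curryUnit c y))) y := by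
      obtain ⟨u, hu⟩ := hy
      have h₂ := contDiffAt_ringInverse ℝ u (n := ∞)
      rw [hu] at h₂
      exact h₂.comp y hc.contDiffAt
    have h₂ : ContDiffAt ℝ ∞ (fun y => Ring.inverse (volterraOp (curryUnit c y)) 1) y :=
      h₁.clm_apply contDiffAt_const
    exact (ContinuousMap.evalCLM ℝ (1 : unitInterval)).contDiff.contDiffAt.comp y h₂
  · simp [hc0]
  · filter_upwards [hunit, Metric.ball_mem_nhds (0 : E) (show 0 < r / 4 by positivity)] with y hy hyr
    have h₁ : volterraOp (curryUnit c y) (Ring.inverse (volterraOp (curryUnit c y)) 1) = 1 := by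
      have h₂ := Ring.mul_inverse_cancel _ hy
      exact congrArg (fun T => T 1) h₂
    obtain ⟨f, hf0, hf1, hf'⟩ := exists_hasDerivAt_of_volterraOp _ _ h₁
    refine ⟨f, hf0, hf1, fun t ht => (hf' t ht).congr_deriv ?_⟩
    have h₃ : χ (t • y) = 1 := by
      refine χ.one_of_mem_closedBall ?_
      rw [mem_closedBall_zero_iff, norm_smul, Real.norm_of_nonneg ht.1]
      rw [mem_ball_zero_iff] at hyr
      exact (mul_le_of_le_one_left (norm_nonneg y) ht.2).trans hyr.le
    simp [c, h₃]

/-- A solution of a homogeneous linear differential equation that vanishes at time `0` vanishes. -/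
theorem eq_zero_of_hasDerivAt_linear {F : Type*} [NormedAddCommGroup F] [NormedSpace ℝ F]
    {f : ℝ → F} {N : ℝ → F →L[ℝ] F} {K : ℝ}
    (hf : ∀ t ∈ Set.Icc (0 : ℝ) 1, HasDerivAt f (N t (f t)) t)
    (hN : ∀ t ∈ Set.Icc (0 : ℝ) 1, ‖N t‖ ≤ K) (h0 : f 0 = 0) :
    ∀ t ∈ Set.Icc (0 : ℝ) 1, f t = 0 := by
  intro t ht
  have h := norm_le_gronwallBound_of_norm_deriv_right_le (f := f) (δ := 0) (K := K) (ε := 0)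
    (f' := fun t => N t (f t)) (a := 0) (b := 1)
    (fun s hs => (hf s hs).continuousAt.continuousWithinAt)
    (fun s hs => (hf s (Set.Ico_subset_Icc_self hs)).hasDerivWithinAt) (by simp [h0])
    (fun s hs => by
      rw [add_zero]
      exact (N s).le_of_opNorm_le (hN s (Set.Ico_subset_Icc_self hs)) _) t ht
  rw [gronwallBound_ε0_δ0] at h
  simpa using h

/-! ### Smooth solutions of linear equations -/

section Solve

variable {E F : Type*} [NormedAddCommGroup E] [NormedSpace ℝ E]
  [NormedAddCommGroup F] [NormedSpace ℝ F] [FiniteDimensional ℝ F]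

theorem exists_clm_leftInverse (C : E →L[ℝ] F) (hC : Function.Injective C) :
    ∃ R : F →L[ℝ] E, R.comp C = 1 := by
  obtain ⟨R, hR⟩ := LinearMap.exists_leftInverse_of_injective C.toLinearMap
    (LinearMap.ker_eq_bot.2 hC)
  refine ⟨LinearMap.toContinuousLinearMap R, ?_⟩
  ext v
  exact congrArg (fun T => T v) hR

variable [FiniteDimensional ℝ E]

/-- The solution of a linear equation `C a = b` depends smoothly on the coefficients near a point
where `C` is injective. -/
theorem contMDiffAt_of_clm_apply_eq {H M : Type*} {V : Type*} [NormedAddCommGroup V]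
    [NormedSpace ℝ V] [TopologicalSpace H] {I : ModelWithCorners ℝ V H} [TopologicalSpace M]
    [ChartedSpace H M] {C : M → E →L[ℝ] F} {a : M → E} {b : M → F} {p : M}
    (hC : ContMDiffAt I 𝓘(ℝ, E →L[ℝ] F) ∞ C p) (hb : ContMDiffAt I 𝓘(ℝ, F) ∞ b p)
    (hinj : Function.Injective (C p)) (h : ∀ᶠ q in 𝓝 p, C q (a q) = b q) :
    ContMDiffAt I 𝓘(ℝ, E) ∞ a p := by
  obtain ⟨R, hR⟩ := exists_clm_leftInverse (C p) hinj
  have h₁ : ContMDiffAt I 𝓘(ℝ, E →L[ℝ] E) ∞ (fun q => R.comp (C q)) p :=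
    contMDiffAt_const.clm_comp hC
  have h₂ : ContMDiffAt I 𝓘(ℝ, E →L[ℝ] E) ∞ (fun q => Ring.inverse (R.comp (C q))) p := by
    have h₃ : ContDiffAt ℝ ∞ (Ring.inverse (M₀ := E →L[ℝ] E)) (R.comp (C p)) := by
      rw [hR]
      exact contDiffAt_ringInverse ℝ 1
    exact h₃.contMDiffAt.comp p h₁
  have hunit : ∀ᶠ q in 𝓝 p, IsUnit (R.comp (C q)) := by
    refine h₁.continuousAt.eventually (Units.isOpen.mem_nhds ?_)
    change IsUnit (R.comp (C p))
    rw [hR]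
    exact isUnit_one
  refine (h₂.clm_apply (contMDiffAt_const.clm_apply hb : ContMDiffAt I 𝓘(ℝ, E) ∞
    (fun q => R (b q)) p)).congr_of_eventuallyEq ?_
  filter_upwards [hunit, h] with q hq hab
  rw [← hab]
  exact (congrArg (fun T : E →L[ℝ] E => T (a q)) (Ring.inverse_mul_cancel _ hq)).symm

/-- A smooth family of maps `B` whose images are those of a smooth family of injective maps `ι` can be
inverted smoothly on these images. -/
theorem exists_smooth_splitting {K W : Type*} [NormedAddCommGroup K] [NormedSpace ℝ K]
    [FiniteDimensional ℝ K] [NormedAddCommGroup W] [NormedSpace ℝ W]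
    {ι : W → K →L[ℝ] F} {B : W → E →L[ℝ] F} {y : W}
    (hι : ∀ᶠ z in 𝓝 y, ContDiffAt ℝ ∞ ι z) (hB : ∀ᶠ z in 𝓝 y, ContDiffAt ℝ ∞ B z)
    (hinj : Function.Injective (ι y))
    (hrange : ∀ᶠ z in 𝓝 y, LinearMap.range (ι z).toLinearMap = LinearMap.range (B z).toLinearMap) :
    ∃ a : W → K →L[ℝ] E, (∀ᶠ z in 𝓝 y, ContDiffAt ℝ ∞ a z) ∧
      ∀ᶠ z in 𝓝 y, ∀ v, B z (a z v) = - ι z v := by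
  obtain ⟨R, hR⟩ := exists_clm_leftInverse (ι y) hinj
  obtain ⟨T, hT⟩ : ∃ T : K →L[ℝ] E, (B y).comp T = ι y := by
    obtain ⟨s, hs⟩ := (B y).toLinearMap.rangeRestrict.exists_rightInverse_of_surjective
      (LinearMap.range_rangeRestrict _)
    have hmem : ∀ v, ι y v ∈ LinearMap.range (B y).toLinearMap := fun v =>
      hrange.self_of_nhds ▸ ⟨v, rfl⟩
    refine ⟨LinearMap.toContinuousLinearMap (s ∘ₗ LinearMap.codRestrict _ (ι y).toLinearMap hmem),
      ?_⟩
    ext v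
    exact congrArg Subtype.val (congrArg (fun T => T (⟨ι y v, hmem v⟩ :
      LinearMap.range (B y).toLinearMap)) hs)
  -- `P z` inverts `ι z` up to the fixed map `R`, and `ι z ∘ Q z = B z ∘ T` with `Q y = 1`
  let P : W → K →L[ℝ] K := fun z => R.comp (ι z)
  let Q : W → K →L[ℝ] K := fun z => Ring.inverse (P z) * R.comp ((B z).comp T)
  have hP : ∀ᶠ z in 𝓝 y, ContDiffAt ℝ ∞ P z := hι.mono fun z hz => contDiffAt_const.clm_comp hz
  have inv_smooth : ∀ (P : W → K →L[ℝ] K) (z : W), ContDiffAt ℝ ∞ P z → IsUnit (P z) →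
      ContDiffAt ℝ ∞ (fun z => Ring.inverse (P z)) z := by
    rintro P z hP ⟨u, hu⟩
    have h := contDiffAt_ringInverse ℝ u (n := ∞)
    rw [hu] at h
    exact h.comp z hP
  have hPu : ∀ᶠ z in 𝓝 y, IsUnit (P z) := by
    refine hP.self_of_nhds.continuousAt.eventually (Units.isOpen.mem_nhds ?_)
    change IsUnit (R.comp (ι y))
    rw [hR]
    exact isUnit_one
  have hQ : ∀ᶠ z in 𝓝 y, ContDiffAt ℝ ∞ Q z := by
    filter_upwards [hP, hPu, hB] with z h₁ h₂ h₃
    exact (inv_smooth P z h₁ h₂).clm_comp (contDiffAt_const.clm_comp (h₃.clm_comp contDiffAt_const))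
  have hQu : ∀ᶠ z in 𝓝 y, IsUnit (Q z) := by
    refine hQ.self_of_nhds.continuousAt.eventually (Units.isOpen.mem_nhds ?_)
    change IsUnit (Ring.inverse (R.comp (ι y)) * R.comp ((B y).comp T))
    rw [hT, hR]
    simp
  refine ⟨fun z => - T.comp (Ring.inverse (Q z)), ?_, ?_⟩
  · filter_upwards [hQ, hQu] with z h₁ h₂
    exact (contDiffAt_const.clm_comp (inv_smooth Q z h₁ h₂)).neg
  · filter_upwards [hPu, hQu, hrange] with z h₁ h₂ h₃ v
    have key : ∀ v, B z (T v) = ι z (Q z v) := by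
      intro v
      obtain ⟨w, hw⟩ : B z (T v) ∈ LinearMap.range (ι z).toLinearMap := h₃ ▸ ⟨T v, rfl⟩
      have hw' : ι z w = B z (T v) := hw
      have h₄ : Q z v = w := by
        change Ring.inverse (P z) (R (B z (T v))) = w
        rw [← hw']
        exact congrArg (fun T : K →L[ℝ] K => T w) (Ring.inverse_mul_cancel _ h₁)
      rw [h₄, hw']
    change B z (-(T (Ring.inverse (Q z) v))) = _
    rw [map_neg, key]
    congr 2
    exact congrArg (fun T : K →L[ℝ] K => T v) (Ring.mul_inverse_cancel _ h₂)

end Solve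

/-! ### Parallel transport of the isotropy algebras -/

section Transport

variable {E K : Type} [NormedAddCommGroup E] [NormedSpace ℝ E]
  [NormedAddCommGroup K] [NormedSpace ℝ K] [FiniteDimensional ℝ K]
  {B : E → ((E →L[ℝ] ℝ) →L[ℝ] E)} {j : K → E} {y₀ : K}

/-- `isoBracket` as a bilinear map. -/
def isoBracketL (B : E → ((E →L[ℝ] ℝ) →L[ℝ] E)) (z : E) :
    (E →L[ℝ] ℝ) →L[ℝ] (E →L[ℝ] ℝ) →L[ℝ] (E →L[ℝ] ℝ) :=
  ((ContinuousLinearMap.compL ℝ (E →L[ℝ] ℝ) (E →L[ℝ] E) (E →L[ℝ] ℝ)).flip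
    (fderiv ℝ B z).flip).comp (ContinuousLinearMap.compL ℝ E E ℝ)

@[simp] theorem isoBracketL_apply (z : E) (a b : E →L[ℝ] ℝ) :
    isoBracketL B z a b = isoBracket B z a b := rfl

theorem IsPoissonNear.contDiffAt_isoBracketL {z : E} (h : IsPoissonNear B z) :
    ContDiffAt ℝ ∞ (isoBracketL B) z := by
  have h₁ : ContDiffAt ℝ ∞ (fderiv ℝ B) z := h.contDiffAt.fderiv_right (m := ∞) (by simp)
  have h₂ : ContDiffAt ℝ ∞ (fun z => (fderiv ℝ B z).flip) z :=
    (ContinuousLinearMap.flipₗᵢ ℝ E (E →L[ℝ] ℝ) E).contDiff.contDiffAt.comp z h₁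
  exact ContDiffAt.clm_comp (contDiffAt_const.clm_apply h₂) contDiffAt_const

/-- The parallel transport along a curve with velocity `-B a` preserves the kernels of the tensor `B`
and the brackets on them. -/
theorem transport_ker_and_bracket {z : ℝ → E} {a : ℝ → (E →L[ℝ] ℝ)}
    {f : ℝ → ((E →L[ℝ] ℝ) →L[ℝ] (E →L[ℝ] ℝ))}
    (hB : ∀ t ∈ Set.Icc (0 : ℝ) 1, IsPoissonNear B (z t))
    (hz : ∀ t ∈ Set.Icc (0 : ℝ) 1, HasDerivAt z (- B (z t) (a t)) t)
    (ha : ContinuousOn a (Set.Icc 0 1)) (hf0 : f 0 = 1)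
    (hf : ∀ t ∈ Set.Icc (0 : ℝ) 1, HasDerivAt f (-(isoBracketL B (z t) (a t)) * f t) t) :
    (∀ β, B (z 0) β = 0 → B (z 1) (f 1 β) = 0) ∧
    ∀ β γ, B (z 0) β = 0 → B (z 0) γ = 0 →
      isoBracket B (z 1) (f 1 β) (f 1 γ) = f 1 (isoBracket B (z 0) β γ) := by
  have h1 : (1 : ℝ) ∈ Set.Icc (0 : ℝ) 1 := ⟨zero_le_one, le_rfl⟩
  have hΓ : ContinuousOn (fun t => isoBracketL B (z t) (a t)) (Set.Icc 0 1) := fun t ht =>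
    (((hB t ht).contDiffAt_isoBracketL.continuousAt.comp
      (hz t ht).continuousAt).continuousWithinAt).clm_apply (ha t ht)
  have hb : ∀ β, ∀ t ∈ Set.Icc (0 : ℝ) 1, HasDerivAt (fun s => f s β)
      (- isoBracket B (z t) (a t) (f t β)) t := by
    intro β t ht
    simpa using (hf t ht).clm_apply (hasDerivAt_const t β)
  have hker : ∀ β, B (z 0) β = 0 → ∀ t ∈ Set.Icc (0 : ℝ) 1, B (z t) (f t β) = 0 := by
    intro β hβ
    -- the vector `B (f β)` solves a homogeneous linear equation
    let N : ℝ → E →L[ℝ] E := fun t => -((ContinuousLinearMap.apply ℝ E (a t)).comp (fderiv ℝ B (z t)))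
    have hN : ContinuousOn N (Set.Icc 0 1) := by
      intro t ht
      have h₁ : ContinuousAt (fderiv ℝ B) (z t) :=
        ((hB t ht).contDiffAt.fderiv_right (m := ∞) (by simp)).continuousAt
      exact (((ContinuousLinearMap.apply ℝ E).continuous.continuousAt.comp_continuousWithinAt
        (ha t ht)).clm_comp (h₁.comp (hz t ht).continuousAt).continuousWithinAt).neg
    obtain ⟨C, hC⟩ := isCompact_Icc.exists_bound_of_continuousOn hN
    refine eq_zero_of_hasDerivAt_linear (N := N) (fun t ht => ?_) hC (by simp [hf0, hβ])
    refine ((hB t ht).hasDerivAt_sharp (hz t ht) (hb β t ht)).congr_deriv ?_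
    simp [N]
  refine ⟨fun β hβ => hker β hβ 1 h1, fun β γ hβ hγ => ?_⟩
  obtain ⟨C, hC⟩ := isCompact_Icc.exists_bound_of_continuousOn hΓ.neg
  -- both sides are solutions of the transport equation with the same initial value
  have h := eq_zero_of_hasDerivAt_linear (K := C)
    (f := fun t => isoBracket B (z t) (f t β) (f t γ) - f t (isoBracket B (z 0) β γ))
    (N := fun t => - isoBracketL B (z t) (a t)) (fun t ht => ?_) hC (by simp [hf0]) 1 h1
  · exact sub_eq_zero.1 h
  · refine (((hB t ht).hasDerivAt_isoBracket (hz t ht) (hb β t ht) (hb γ t ht) (hker β hβ t ht)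
      (hker γ hγ t ht)).sub (hb _ t ht)).congr_deriv ?_
    ext w
    simp
    ring

variable [FiniteDimensional ℝ E] in
/-- Along an integral manifold `j` of a Poisson tensor, the isotropy algebras are trivialized locally by
parallel transport along rays, for the connection defined by a smooth splitting of `-B`. The transport
maps `G` act on all covectors, but only their restrictions to the kernels of `B` have a meaning. -/
theorem exists_local_trivialization (hB : IsPoissonNear B (j y₀))
    (hj : ∀ᶠ y in 𝓝 y₀, ContDiffAt ℝ ∞ j y)
    (hinj : ∀ᶠ y in 𝓝 y₀, Function.Injective (fderiv ℝ j y))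
    (hrange : ∀ᶠ y in 𝓝 y₀,
      LinearMap.range (fderiv ℝ j y).toLinearMap = LinearMap.range (B (j y)).toLinearMap) :
    ∃ G : K → ((E →L[ℝ] ℝ) →L[ℝ] (E →L[ℝ] ℝ)), (∀ᶠ y in 𝓝 y₀, ContDiffAt ℝ ∞ G y) ∧ G y₀ = 1 ∧
      ∀ᶠ y in 𝓝 y₀, Function.Injective (G y) ∧ (∀ β, B (j y₀) β = 0 → B (j y) (G y β) = 0) ∧
        (∀ γ, B (j y) γ = 0 → ∃ β, B (j y₀) β = 0 ∧ G y β = γ) ∧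
        ∀ β γ, B (j y₀) β = 0 → B (j y₀) γ = 0 →
          isoBracket B (j y) (G y β) (G y γ) = G y (isoBracket B (j y₀) β γ) := by
  have hjc : ContinuousAt j y₀ := hj.self_of_nhds.continuousAt
  have hBj : ∀ᶠ y in 𝓝 y₀, IsPoissonNear B (j y) := hjc.eventually hB.eventually
  obtain ⟨a, ha, hsplit⟩ := exists_smooth_splitting (ι := fderiv ℝ j) (B := fun y => B (j y))
    (hj.mono fun y hy => hy.fderiv_right (m := ∞) (by simp))
    ((hj.and hBj).mono fun y hy => hy.2.contDiffAt.comp y hy.1) hinj.self_of_nhds hrange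
  let Γ : K → K →L[ℝ] ((E →L[ℝ] ℝ) →L[ℝ] (E →L[ℝ] ℝ)) := fun y =>
    (isoBracketL B (j (y₀ + y))).comp (a (y₀ + y))
  have hadd : Tendsto (fun y => y₀ + y) (𝓝 0) (𝓝 y₀) := by
    simpa using (continuous_const_add y₀).tendsto 0
  have hΓ : ∀ᶠ y in 𝓝 0, ContDiffAt ℝ ∞ Γ y := by
    filter_upwards [hadd.eventually hj, hadd.eventually hBj, hadd.eventually ha] with y h₁ h₂ h₃
    have h₀ : ContDiffAt ℝ ∞ (fun y => y₀ + y) y := contDiffAt_const.add contDiffAt_id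
    exact ContDiffAt.clm_comp ((h₂.contDiffAt_isoBracketL.comp _ h₁).comp y h₀) (h₃.comp y h₀)
  obtain ⟨G, hG, hG0, hsol⟩ := exists_radial_transport Γ hΓ
  have hsub : Tendsto (fun y => y - y₀) (𝓝 y₀) (𝓝 0) := by
    simpa using (continuous_sub_right y₀).tendsto y₀
  refine ⟨fun y => G (y - y₀), ?_, by simpa using hG0, ?_⟩
  · filter_upwards [hsub.eventually hG] with y hy
    exact hy.comp y (contDiffAt_id.sub contDiffAt_const)
  have hunit : ∀ᶠ y in 𝓝 y₀, IsUnit (G (y - y₀)) := by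
    refine hsub.eventually (p := fun x => IsUnit (G x)) ?_
    refine hG.self_of_nhds.continuousAt.eventually (Units.isOpen.mem_nhds ?_)
    change IsUnit (G 0)
    rw [hG0]
    exact isUnit_one
  obtain ⟨r, hr, hball⟩ := Metric.eventually_nhds_iff_ball.1
    (hj.and (hBj.and (ha.and (hsplit.and (hinj.and (hrange.and
      (hsub.eventually hsol)))))))
  filter_upwards [hunit, Metric.ball_mem_nhds y₀ hr] with y hu hy
  have hGinj : Function.Injective (G (y - y₀)) := by
    intro β γ h
    have h₁ := Ring.inverse_mul_cancel _ hu
    calc β = Ring.inverse (G (y - y₀)) (G (y - y₀) β) :=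
          (congrArg (fun T : (E →L[ℝ] ℝ) →L[ℝ] (E →L[ℝ] ℝ) => T β) h₁).symm
      _ = Ring.inverse (G (y - y₀)) (G (y - y₀) γ) := by rw [h]
      _ = γ := congrArg (fun T : (E →L[ℝ] ℝ) →L[ℝ] (E →L[ℝ] ℝ) => T γ) h₁
  obtain ⟨f, hf0, hf1, hf⟩ := (hball y hy).2.2.2.2.2.2
  have hray : ∀ t ∈ Set.Icc (0 : ℝ) 1, y₀ + t • (y - y₀) ∈ Metric.ball y₀ r := by
    intro t ht
    rw [mem_ball_iff_norm, add_sub_cancel_left, norm_smul, Real.norm_of_nonneg ht.1]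
    exact (mul_le_of_le_one_left (norm_nonneg _) ht.2).trans_lt (mem_ball_iff_norm.1 hy)
  have hline : ∀ t : ℝ, HasDerivAt (fun t : ℝ => y₀ + t • (y - y₀)) (y - y₀) t := fun t => by
    simpa using ((hasDerivAt_id t).smul_const (y - y₀)).const_add y₀
  have htr := transport_ker_and_bracket (B := B) (z := fun t => j (y₀ + t • (y - y₀)))
    (a := fun t => a (y₀ + t • (y - y₀)) (y - y₀)) (f := f)
    (fun t ht => (hball _ (hray t ht)).2.1)
    (fun t ht => by
      have h₁ := ((hball _ (hray t ht)).1.differentiableAt (by simp)).hasFDerivAt.comp_hasDerivAt t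
        (hline t)
      refine h₁.congr_deriv ?_
      rw [(hball _ (hray t ht)).2.2.2.1, neg_neg])
    (fun t ht => by
      have h₁ : ContinuousAt (fun t : ℝ => a (y₀ + t • (y - y₀))) t :=
        ContinuousAt.comp (f := fun t : ℝ => y₀ + t • (y - y₀))
          (hball _ (hray t ht)).2.2.1.continuousAt (hline t).continuousAt
      exact (h₁.clm_apply continuousAt_const).continuousWithinAt) hf0 hf
  simp only [zero_smul, add_zero, one_smul, add_sub_cancel, hf1] at htr
  refine ⟨hGinj, htr.1, ?_, htr.2⟩
  -- The kernels have the same dimension, the codimension of the integral manifold.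
  have hdim : ∀ y ∈ Metric.ball y₀ r, Module.finrank ℝ (LinearMap.ker (B (j y)).toLinearMap)
      + Module.finrank ℝ K = Module.finrank ℝ (E →L[ℝ] ℝ) := by
    intro y hy
    rw [← LinearMap.finrank_range_add_finrank_ker (B (j y)).toLinearMap,
      ← (hball y hy).2.2.2.2.2.1, LinearMap.finrank_range_of_inj (hball y hy).2.2.2.2.1, add_comm]
  have hd := hdim y hy
  rw [← hdim y₀ (Metric.mem_ball_self hr), add_left_inj] at hd
  let g : LinearMap.ker (B (j y₀)).toLinearMap →ₗ[ℝ] LinearMap.ker (B (j y)).toLinearMap :=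
    (G (y - y₀)).toLinearMap.restrict htr.1
  have hg : Function.Injective g := fun β γ h =>
    Subtype.ext (hGinj (congrArg Subtype.val h))
  intro γ hγ
  obtain ⟨β, hβ⟩ := ((LinearMap.injective_iff_surjective_of_finrank_eq_finrank hd.symm).1 hg) ⟨γ, hγ⟩
  exact ⟨β, β.2, congrArg Subtype.val hβ⟩

end Transport

/-! ### Coordinates on the tangent and cotangent bundles -/

section Coordinates

variable {n : ℕ} {Z : Type u} [TopologicalSpace Z] [ChartedSpace (Model n) Z]
  [IsManifold (𝓡 n) ∞ Z]

/-- The coordinate frame of the chart at `z₀`: the map sending the coordinates of a tangent vector at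
`z` to this vector. It is zero away from the domain of this chart, as is `co`. -/
def fr (z₀ z : Z) : Model n →L[ℝ] TangentSpace (𝓡 n) z :=
  (trivializationAt (Model n) (TangentSpace (𝓡 n) : Z → Type) z₀).symmL ℝ z

/-- The coordinates of a tangent vector at `z` in the chart at `z₀`. -/
def co (z₀ z : Z) : TangentSpace (𝓡 n) z →L[ℝ] Model n :=
  (trivializationAt (Model n) (TangentSpace (𝓡 n) : Z → Type) z₀).continuousLinearMapAt ℝ z

/-- The coordinates of a covector at `z` in the chart at `z₀`. -/
def hat (z₀ : Z) {z : Z} (β : Cot n z) : Model n →L[ℝ] ℝ := β.comp (fr z₀ z)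

@[simp] theorem hat_apply (z₀ : Z) {z : Z} (β : Cot n z) (w : Model n) :
    hat z₀ β w = β (fr z₀ z w) := rfl

theorem co_fr {z₀ z : Z} (hz : z ∈ (chartAt (Model n) z₀).source) (w : Model n) :
    co z₀ z (fr z₀ z w) = w :=
  Trivialization.continuousLinearMapAt_symmL _ (by simpa using hz) w

theorem fr_co {z₀ z : Z} (hz : z ∈ (chartAt (Model n) z₀).source) (w : TangentSpace (𝓡 n) z) :
    fr z₀ z (co z₀ z w) = w :=
  Trivialization.symmL_continuousLinearMapAt _ (by simpa using hz) w

theorem hat_comp_co {z₀ z : Z} (hz : z ∈ (chartAt (Model n) z₀).source) (β : Cot n z) :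
    (hat z₀ β).comp (co z₀ z) = β := by
  ext w
  exact congrArg β (fr_co hz w)

theorem hat_co {z₀ z : Z} (hz : z ∈ (chartAt (Model n) z₀).source) (β : Cot n z)
    (w : TangentSpace (𝓡 n) z) : hat z₀ β (co z₀ z w) = β w :=
  congrArg β (fr_co hz w)

theorem hat_of_comp_co {z₀ z : Z} (hz : z ∈ (chartAt (Model n) z₀).source) (b : Model n →L[ℝ] ℝ) :
    hat z₀ (b.comp (co z₀ z) : Cot n z) = b := by
  ext w
  exact congrArg b (co_fr hz w)

theorem hat_injective {z₀ z : Z} (hz : z ∈ (chartAt (Model n) z₀).source) :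
    Function.Injective (hat z₀ : Cot n z → (Model n →L[ℝ] ℝ)) := fun β γ h => by
  rw [← hat_comp_co hz β, h, hat_comp_co hz γ]

theorem hat_add (z₀ : Z) {z : Z} (β γ : Cot n z) : hat z₀ (β + γ) = hat z₀ β + hat z₀ γ := rfl

theorem hat_smul (z₀ : Z) {z : Z} (c : ℝ) (β : Cot n z) : hat z₀ (c • β) = c • hat z₀ β := rfl

@[simp] theorem hat_zero (z₀ z : Z) : hat z₀ (0 : Cot n z) = 0 := rfl

theorem co_eq_mfderiv {z₀ z : Z} (hz : z ∈ (chartAt (Model n) z₀).source) :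
    co z₀ z = mfderiv (𝓡 n) 𝓘(ℝ, Model n) (extChartAt (𝓡 n) z₀) z :=
  TangentBundle.continuousLinearMapAt_trivializationAt hz

theorem fr_eq_mfderiv {z₀ z : Z} (hz : z ∈ (chartAt (Model n) z₀).source) :
    fr z₀ z = mfderivWithin 𝓘(ℝ, Model n) (𝓡 n) (extChartAt (𝓡 n) z₀).symm (Set.range (𝓡 n))
      (extChartAt (𝓡 n) z₀ z) :=
  TangentBundle.symmL_trivializationAt hz

@[simp] theorem co_self (z : Z) (w : TangentSpace (𝓡 n) z) : co z z w = (w : Model n) := by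
  rw [co_eq_mfderiv (mem_chart_source _ z), mfderiv_extChartAt_self]
  rfl

@[simp] theorem fr_self (z : Z) (w : Model n) : fr z z w = (w : TangentSpace (𝓡 n) z) := by
  exact (congrArg (fr z z) (co_self z w)).symm.trans (fr_co (mem_chart_source _ z) w)

@[simp] theorem hat_self (z : Z) (β : Cot n z) : hat z β = (β : Model n →L[ℝ] ℝ) := by
  ext w
  exact congrArg β (fr_self z w)

theorem trivializationAt_cot_snd (z₀ : Z) (β : CotBundle n Z) :
    (trivializationAt (Model n →L[ℝ] ℝ) (fun z : Z => TangentSpace (𝓡 n) z →L[ℝ] ℝ) z₀ β).2 =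
      hat z₀ β.2 := by
  rw [hom_trivializationAt_apply]
  ext w
  simp [ContinuousLinearMap.inCoordinates, fr]

section Maps

variable {H M V : Type*} [NormedAddCommGroup V] [NormedSpace ℝ V] [TopologicalSpace H]
  {I : ModelWithCorners ℝ V H} [TopologicalSpace M] [ChartedSpace H M]

theorem contMDiffAt_cot_iff (z₀ : Z) {f : M → CotBundle n Z} {p : M}
    (hp : (f p).1 ∈ (chartAt (Model n) z₀).source) :
    ContMDiffAt I (cotModel n) ∞ f p ↔ ContMDiffAt I (𝓡 n) ∞ (fun q => (f q).1) p ∧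
      ContMDiffAt I 𝓘(ℝ, Model n →L[ℝ] ℝ) ∞ (fun q => hat z₀ (f q).2) p := by
  have h := (trivializationAt (Model n →L[ℝ] ℝ)
    (fun z : Z => TangentSpace (𝓡 n) z →L[ℝ] ℝ) z₀).contMDiffAt_iff (IM := I) (IB := 𝓡 n) (n := ∞)
    (f := f) (x₀ := p) (by
      rw [Trivialization.mem_source, hom_trivializationAt_baseSet]
      exact ⟨by simpa using hp, by simp⟩)
  rw [h]
  refine and_congr_right fun _ => Eq.to_iff (congrArg (fun g => ContMDiffAt I _ ∞ g p) ?_)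
  exact funext fun q => trivializationAt_cot_snd z₀ (f q)

theorem contMDiffAt_tangent_iff (z₀ : Z) {f : M → TangentBundle (𝓡 n) Z} {p : M}
    (hp : (f p).1 ∈ (chartAt (Model n) z₀).source) :
    ContMDiffAt I (𝓡 n).tangent ∞ f p ↔ ContMDiffAt I (𝓡 n) ∞ (fun q => (f q).1) p ∧
      ContMDiffAt I 𝓘(ℝ, Model n) ∞ (fun q => co z₀ (f q).1 (f q).2) p := by
  have h := (trivializationAt (Model n) (TangentSpace (𝓡 n) : Z → Type) z₀).contMDiffAt_iff
    (IM := I) (IB := 𝓡 n) (n := ∞) (f := f) (x₀ := p) (by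
      rw [Trivialization.mem_source]
      simpa using hp)
  rw [h]
  refine and_congr_right fun h₁ => ?_
  refine Filter.EventuallyEq.contMDiffAt_iff ?_
  filter_upwards [h₁.continuousAt.eventually
    ((chartAt (Model n) z₀).open_source.mem_nhds hp)] with q hq
  rw [co, Trivialization.continuousLinearMapAt_apply, Trivialization.coe_linearMapAt_of_mem]
  rw [TangentBundle.trivializationAt_baseSet]
  exact hq

/-- The horizontal and vertical components of the derivative of a map into `T*Z`, in the chart of
`T*Z` at the value of the map. -/
theorem mfderiv_cot {f : M → CotBundle n Z} {p : M} (hf : MDifferentiableAt I (cotModel n) f p)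
    (v : TangentSpace I p) :
    (mfderiv I (cotModel n) f p v : Model n × (Model n →L[ℝ] ℝ)) =
      ((mfderiv I (𝓡 n) (fun q => (f q).1) p v : Model n),
        (mfderiv I 𝓘(ℝ, Model n →L[ℝ] ℝ) (fun q => hat (f p).1 (f q).2) p v :
          Model n →L[ℝ] ℝ)) := by
  have h₁ : MDifferentiableAt (cotModel n) 𝓘(ℝ, Model n × (Model n →L[ℝ] ℝ))
    (extChartAt (cotModel n) (f p)) (f p) := mdifferentiableAt_extChartAt (mem_chart_source _ _)
  have h₂ := mfderiv_comp p h₁ hf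
  have h₃ : (mfderiv I 𝓘(ℝ, Model n × (Model n →L[ℝ] ℝ)) (extChartAt (cotModel n) (f p) ∘ f) p v :
      Model n × (Model n →L[ℝ] ℝ)) = mfderiv I (cotModel n) f p v := by
    rw [h₂, mfderiv_extChartAt_self]
    rfl
  have h₄ : ∀ q, extChartAt (cotModel n) (f p) (f q) =
      (extChartAt (𝓡 n) (f p).1 (f q).1, hat (f p).1 (f q).2) := by
    intro q
    rw [← trivializationAt_cot_snd, FiberBundle.extChartAt]
    rfl
  have h₅ : HasMFDerivAt I 𝓘(ℝ, Model n × (Model n →L[ℝ] ℝ)) (extChartAt (cotModel n) (f p) ∘ f) p _ :=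
    (h₁.comp p hf).hasMFDerivAt
  have h₆ : MDifferentiableAt (𝓡 n) 𝓘(ℝ, Model n) (extChartAt (𝓡 n) (f p).1) (f p).1 :=
    mdifferentiableAt_extChartAt (mem_chart_source _ _)
  have h₇ := mfderiv_comp p h₆ ((mdifferentiableAt_totalSpace _ _).1 hf).1
  have h₈ := ((ContinuousLinearMap.fst ℝ (Model n) (Model n →L[ℝ] ℝ)).hasMFDerivAt.comp p h₅).mfderiv
  have h₉ := ((ContinuousLinearMap.snd ℝ (Model n) (Model n →L[ℝ] ℝ)).hasMFDerivAt.comp p h₅).mfderiv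
  have e₈ : (ContinuousLinearMap.fst ℝ (Model n) (Model n →L[ℝ] ℝ)) ∘
      (extChartAt (cotModel n) (f p) ∘ f) = extChartAt (𝓡 n) (f p).1 ∘ fun q => (f q).1 :=
    funext fun q => congrArg Prod.fst (h₄ q)
  have e₉ : (ContinuousLinearMap.snd ℝ (Model n) (Model n →L[ℝ] ℝ)) ∘
      (extChartAt (cotModel n) (f p) ∘ f) = fun q => hat (f p).1 (f q).2 :=
    funext fun q => congrArg Prod.snd (h₄ q)
  rw [e₈, h₇, mfderiv_extChartAt_self] at h₈
  rw [e₉] at h₉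
  rw [← h₃]
  exact Prod.ext (congrArg (fun T => T v) h₈).symm (congrArg (fun T => T v) h₉).symm

end Maps

end Coordinates

/-! ### Derivatives, vector fields and the Poisson tensor in coordinates -/

section Coordinates

variable {n : ℕ} {Z : Type u} [TopologicalSpace Z] [ChartedSpace (Model n) Z]

theorem extChartAt_target_mem_nhds_of_mem {z₀ : Z} {y : Model n}
    (hy : y ∈ (extChartAt (𝓡 n) z₀).target) : (extChartAt (𝓡 n) z₀).target ∈ 𝓝 y :=
  (isOpen_extChartAt_target z₀).mem_nhds hy

theorem extChartAt_mem_target {z₀ z : Z} (hz : z ∈ (chartAt (Model n) z₀).source) :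
    extChartAt (𝓡 n) z₀ z ∈ (extChartAt (𝓡 n) z₀).target :=
  (extChartAt (𝓡 n) z₀).map_source (by rwa [extChartAt_source])

theorem extChartAt_symm_mem {z₀ : Z} {y : Model n} (hy : y ∈ (extChartAt (𝓡 n) z₀).target) :
    (extChartAt (𝓡 n) z₀).symm y ∈ (chartAt (Model n) z₀).source := by
  have h := (extChartAt (𝓡 n) z₀).map_target hy
  rwa [extChartAt_source] at h

theorem extChartAt_left_inv {z₀ z : Z} (hz : z ∈ (chartAt (Model n) z₀).source) :
    (extChartAt (𝓡 n) z₀).symm (extChartAt (𝓡 n) z₀ z) = z :=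
  (extChartAt (𝓡 n) z₀).left_inv (by rwa [extChartAt_source])

variable [IsManifold (𝓡 n) ∞ Z]

theorem contMDiffAt_extChartAt_symm' {z₀ : Z} {y : Model n}
    (hy : y ∈ (extChartAt (𝓡 n) z₀).target) :
    ContMDiffAt 𝓘(ℝ, Model n) (𝓡 n) ∞ (extChartAt (𝓡 n) z₀).symm y :=
  (contMDiffOn_extChartAt_symm z₀).contMDiffAt (extChartAt_target_mem_nhds_of_mem hy)

theorem contDiffAt_comp_extChartAt_symm {F : Type*} [NormedAddCommGroup F] [NormedSpace ℝ F]
    {f : Z → F} {z₀ z : Z} (hz : z ∈ (chartAt (Model n) z₀).source)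
    (hf : ContMDiffAt (𝓡 n) 𝓘(ℝ, F) ∞ f z) :
    ContDiffAt ℝ ∞ (f ∘ (extChartAt (𝓡 n) z₀).symm) (extChartAt (𝓡 n) z₀ z) := by
  rw [← contMDiffAt_iff_contDiffAt]
  refine ContMDiffAt.comp_of_eq (y := z) hf
    (contMDiffAt_extChartAt_symm' (extChartAt_mem_target hz)) (extChartAt_left_inv hz)

theorem contMDiffAt_of_contDiffAt_chart {F : Type*} [NormedAddCommGroup F] [NormedSpace ℝ F]
    {f : Model n → F} {z₀ z : Z} (hz : z ∈ (chartAt (Model n) z₀).source)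
    (hf : ContDiffAt ℝ ∞ f (extChartAt (𝓡 n) z₀ z)) :
    ContMDiffAt (𝓡 n) 𝓘(ℝ, F) ∞ (fun z => f (extChartAt (𝓡 n) z₀ z)) z :=
  hf.contMDiffAt.comp z (contMDiffAt_extChartAt' hz)

/-- The derivative of a function on a manifold, computed in a chart. -/
theorem mfderiv_eq_fderiv_co {F : Type*} [NormedAddCommGroup F] [NormedSpace ℝ F]
    {f : Z → F} {z₀ z : Z} (hz : z ∈ (chartAt (Model n) z₀).source)
    (hf : MDifferentiableAt (𝓡 n) 𝓘(ℝ, F) f z) (v : TangentSpace (𝓡 n) z) :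
    (mfderiv (𝓡 n) 𝓘(ℝ, F) f z v : F) =
      fderiv ℝ (f ∘ (extChartAt (𝓡 n) z₀).symm) (extChartAt (𝓡 n) z₀ z) (co z₀ z v) := by
  have h₁ : MDifferentiableAt 𝓘(ℝ, Model n) (𝓡 n) (extChartAt (𝓡 n) z₀).symm
      (extChartAt (𝓡 n) z₀ z) :=
    (contMDiffAt_extChartAt_symm' (extChartAt_mem_target hz)).mdifferentiableAt (by simp)
  have h₂ : MDifferentiableAt 𝓘(ℝ, Model n) 𝓘(ℝ, F) (f ∘ (extChartAt (𝓡 n) z₀).symm)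
      (extChartAt (𝓡 n) z₀ z) :=
    MDifferentiableAt.comp _ (by rw [extChartAt_left_inv hz]; exact hf) h₁
  have h₃ := mfderiv_comp z h₂ (mdifferentiableAt_extChartAt hz)
  have h₄ : (f ∘ (extChartAt (𝓡 n) z₀).symm) ∘ extChartAt (𝓡 n) z₀ =ᶠ[𝓝 z] f := by
    filter_upwards [(chartAt (Model n) z₀).open_source.mem_nhds hz] with q hq
    exact congrArg f (extChartAt_left_inv hq)
  rw [h₄.mfderiv_eq, ← co_eq_mfderiv hz, mfderiv_eq_fderiv] at h₃
  exact congrArg (fun T => T v) h₃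

theorem hat_diff {f : Z → ℝ} {z₀ z : Z} (hz : z ∈ (chartAt (Model n) z₀).source)
    (hf : MDifferentiableAt (𝓡 n) 𝓘(ℝ, ℝ) f z) :
    hat z₀ (diff n f z) =
      fderiv ℝ (f ∘ (extChartAt (𝓡 n) z₀).symm) (extChartAt (𝓡 n) z₀ z) := by
  ext w
  have h := mfderiv_eq_fderiv_co hz hf (fr z₀ z w)
  rwa [co_fr hz] at h

theorem hat_diff_of_eventuallyEq {F : Z → ℝ} {g : Model n → ℝ} {z₀ z : Z}
    (hz : z ∈ (chartAt (Model n) z₀).source) (hF : F =ᶠ[𝓝 z] fun q => g (extChartAt (𝓡 n) z₀ q))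
    (hg : ContDiffAt ℝ ∞ g (extChartAt (𝓡 n) z₀ z)) :
    hat z₀ (diff n F z) = fderiv ℝ g (extChartAt (𝓡 n) z₀ z) := by
  rw [hat_diff hz (((contMDiffAt_of_contDiffAt_chart hz hg).congr_of_eventuallyEq
    hF).mdifferentiableAt (by simp))]
  have h := (contMDiffAt_extChartAt_symm' (extChartAt_mem_target hz)).continuousAt
  rw [ContinuousAt, extChartAt_left_inv hz] at h
  refine Filter.EventuallyEq.fderiv_eq ?_
  filter_upwards [h.eventually hF, extChartAt_target_mem_nhds_of_mem (extChartAt_mem_target hz)]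
    with y hy hy'
  rw [Function.comp_apply, hy, (extChartAt (𝓡 n) z₀).right_inv hy']

/-- The coordinates of the image of a tangent vector under a map. -/
theorem co_mfderiv {H M V : Type*} [NormedAddCommGroup V] [NormedSpace ℝ V] [TopologicalSpace H]
    {I : ModelWithCorners ℝ V H} [TopologicalSpace M] [ChartedSpace H M] {g : M → Z} {p : M} {z₀ : Z}
    (hz : g p ∈ (chartAt (Model n) z₀).source) (hg : MDifferentiableAt I (𝓡 n) g p)
    (v : TangentSpace I p) :
    co z₀ (g p) (mfderiv I (𝓡 n) g p v) =
      mfderiv I 𝓘(ℝ, Model n) (fun q => extChartAt (𝓡 n) z₀ (g q)) p v := by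
  have h := mfderiv_comp p (mdifferentiableAt_extChartAt hz) hg
  rw [← co_eq_mfderiv hz] at h
  exact (congrArg (fun T => T v) h).symm

/-- A vector field in coordinates. -/
def vhat (z₀ : Z) (U : ∀ z : Z, TangentSpace (𝓡 n) z) (y : Model n) : Model n :=
  co z₀ ((extChartAt (𝓡 n) z₀).symm y) (U ((extChartAt (𝓡 n) z₀).symm y))

/-- A one-form in coordinates. -/
def fhat (z₀ : Z) (α : ∀ z : Z, Cot n z) (y : Model n) : Model n →L[ℝ] ℝ :=
  hat z₀ (α ((extChartAt (𝓡 n) z₀).symm y))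

theorem vhat_chart {z₀ z : Z} (hz : z ∈ (chartAt (Model n) z₀).source)
    (U : ∀ z : Z, TangentSpace (𝓡 n) z) :
    vhat z₀ U (extChartAt (𝓡 n) z₀ z) = co z₀ z (U z) := by
  rw [vhat, extChartAt_left_inv hz]

theorem fhat_chart {z₀ z : Z} (hz : z ∈ (chartAt (Model n) z₀).source) (α : ∀ z : Z, Cot n z) :
    fhat z₀ α (extChartAt (𝓡 n) z₀ z) = hat z₀ (α z) := by
  rw [fhat, extChartAt_left_inv hz]

theorem contDiffAt_vhat {z₀ z : Z} (hz : z ∈ (chartAt (Model n) z₀).source)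
    {U : ∀ z : Z, TangentSpace (𝓡 n) z}
    (hU : ContMDiffAt (𝓡 n) (𝓡 n).tangent ∞ (fun z => (⟨z, U z⟩ : TangentBundle (𝓡 n) Z)) z) :
    ContDiffAt ℝ ∞ (vhat z₀ U) (extChartAt (𝓡 n) z₀ z) :=
  contDiffAt_comp_extChartAt_symm hz ((contMDiffAt_tangent_iff z₀ hz).1 hU).2

theorem contDiffAt_fhat {z₀ z : Z} (hz : z ∈ (chartAt (Model n) z₀).source)
    {α : ∀ z : Z, Cot n z}
    (hα : ContMDiffAt (𝓡 n) (cotModel n) ∞ (fun z => cot n z (α z)) z) :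
    ContDiffAt ℝ ∞ (fhat z₀ α) (extChartAt (𝓡 n) z₀ z) :=
  contDiffAt_comp_extChartAt_symm hz ((contMDiffAt_cot_iff z₀ hz).1 hα).2

theorem mfderiv_extChartAt_symm_eq_fr {z₀ : Z} {y : Model n}
    (hy : y ∈ (extChartAt (𝓡 n) z₀).target) :
    mfderiv 𝓘(ℝ, Model n) (𝓡 n) (extChartAt (𝓡 n) z₀).symm y =
      fr z₀ ((extChartAt (𝓡 n) z₀).symm y) := by
  rw [fr_eq_mfderiv (extChartAt_symm_mem hy), (extChartAt (𝓡 n) z₀).right_inv hy]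
  rw [ModelWithCorners.range_eq_univ]
  exact (congrFun mfderivWithin_univ y).symm

theorem mpullback_extChartAt_symm {z₀ : Z} {y : Model n} (hy : y ∈ (extChartAt (𝓡 n) z₀).target)
    (U : ∀ z : Z, TangentSpace (𝓡 n) z) :
    VectorField.mpullback 𝓘(ℝ, Model n) (𝓡 n) (extChartAt (𝓡 n) z₀).symm U y = vhat z₀ U y := by
  have h : (fr z₀ ((extChartAt (𝓡 n) z₀).symm y)).inverse = co z₀ ((extChartAt (𝓡 n) z₀).symm y) :=
    ContinuousLinearMap.inverse_eq
      (by ext1 w; exact fr_co (extChartAt_symm_mem hy) w)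
      (by ext1 w; exact co_fr (extChartAt_symm_mem hy) w)
  rw [VectorField.mpullback_apply, mfderiv_extChartAt_symm_eq_fr hy]
  exact congrArg (fun T => T (U ((extChartAt (𝓡 n) z₀).symm y))) h

theorem mlieBracket_apply_of_model (U W : ∀ y : Model n, TangentSpace 𝓘(ℝ, Model n) y)
    (y : Model n) : VectorField.mlieBracket 𝓘(ℝ, Model n) U W y =
      VectorField.lieBracket ℝ (E := Model n) U W y := by
  rw [← VectorField.mlieBracketWithin_univ, VectorField.mlieBracketWithin_eq_lieBracketWithin]
  exact congrFun VectorField.lieBracketWithin_univ y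

/-- The Lie bracket of vector fields in coordinates. -/
theorem co_mlieBracket {z₀ z : Z} (hz : z ∈ (chartAt (Model n) z₀).source)
    {U W : ∀ z : Z, TangentSpace (𝓡 n) z}
    (hU : ContMDiffAt (𝓡 n) (𝓡 n).tangent ∞ (fun z => (⟨z, U z⟩ : TangentBundle (𝓡 n) Z)) z)
    (hW : ContMDiffAt (𝓡 n) (𝓡 n).tangent ∞ (fun z => (⟨z, W z⟩ : TangentBundle (𝓡 n) Z)) z) :
    co z₀ z (VectorField.mlieBracket (𝓡 n) U W z) =
      fderiv ℝ (vhat z₀ W) (extChartAt (𝓡 n) z₀ z) (co z₀ z (U z))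
      - fderiv ℝ (vhat z₀ U) (extChartAt (𝓡 n) z₀ z) (co z₀ z (W z)) := by
  have hy := extChartAt_mem_target hz
  have hzz := extChartAt_left_inv hz
  have h2 : (2 : WithTop ℕ∞) ≤ ∞ := WithTop.coe_le_coe.2 (le_top : (2 : ℕ∞) ≤ ⊤)
  have : IsManifold (𝓡 n) (minSmoothness ℝ 2) Z := IsManifold.of_le (n := ∞) (by simpa using h2)
  have h := VectorField.mpullback_mlieBracket (I := 𝓘(ℝ, Model n)) (I' := 𝓡 n)
    (f := (extChartAt (𝓡 n) z₀).symm) (V := U) (W := W) (x₀ := extChartAt (𝓡 n) z₀ z) (n := ∞)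
    (by rw [hzz]; exact hU.mdifferentiableAt (by simp))
    (by rw [hzz]; exact hW.mdifferentiableAt (by simp))
    (contMDiffAt_extChartAt_symm' hy) (by simpa using h2)
  rw [mpullback_extChartAt_symm hy, vhat_chart hz] at h
  rw [h, ← vhat_chart hz U, ← vhat_chart hz W]
  have h₁ : ∀ U : ∀ z : Z, TangentSpace (𝓡 n) z,
      VectorField.mpullback 𝓘(ℝ, Model n) (𝓡 n) (extChartAt (𝓡 n) z₀).symm U
        =ᶠ[𝓝 (extChartAt (𝓡 n) z₀ z)] vhat z₀ U := fun U => by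
    filter_upwards [extChartAt_target_mem_nhds_of_mem hy] with y hy
    exact mpullback_extChartAt_symm hy U
  rw [(h₁ U).mlieBracket_vectorField_eq (h₁ W)]
  exact mlieBracket_apply_of_model _ _ _

end Coordinates

section Sharp

variable {n : ℕ} {Z : Type u} [TopologicalSpace Z] [ChartedSpace (Model n) Z]
  [IsManifold (𝓡 n) ∞ Z]

/-- The Poisson tensor in the chart at `z₀`. It is meaningful on the target of the chart only. -/
def PoissonStructure.coord (P : PoissonStructure n Z) (z₀ : Z) (y : Model n) :
    (Model n →L[ℝ] ℝ) →L[ℝ] Model n :=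
  LinearMap.toContinuousLinearMap
    { toFun := fun b => co z₀ ((extChartAt (𝓡 n) z₀).symm y)
        (P.sharp _ (b.comp (co z₀ ((extChartAt (𝓡 n) z₀).symm y)) : Cot n _))
      map_add' := fun b c => by
        rw [← map_add (co z₀ _), ← map_add (P.sharp _)]
        rfl
      map_smul' := fun r b => by
        rw [RingHom.id_apply, ← map_smul (co z₀ _), ← map_smul (P.sharp _)]
        rfl }

theorem PoissonStructure.coord_hat (P : PoissonStructure n Z) {z₀ z : Z}
    (hz : z ∈ (chartAt (Model n) z₀).source) (β : Cot n z) :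
    P.coord z₀ (extChartAt (𝓡 n) z₀ z) (hat z₀ β) = co z₀ z (P.sharp z β) := by
  change co z₀ ((extChartAt (𝓡 n) z₀).symm (extChartAt (𝓡 n) z₀ z)) (P.sharp _
    ((hat z₀ β).comp (co z₀ ((extChartAt (𝓡 n) z₀).symm (extChartAt (𝓡 n) z₀ z))) : Cot n _)) = _
  rw [extChartAt_left_inv hz]
  exact congrArg (fun β => co z₀ z (P.sharp z β)) (hat_comp_co hz β)

theorem PoissonStructure.coord_eq_zero_iff (P : PoissonStructure n Z) {z₀ z : Z}
    (hz : z ∈ (chartAt (Model n) z₀).source) (β : Cot n z) :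
    P.coord z₀ (extChartAt (𝓡 n) z₀ z) (hat z₀ β) = 0 ↔ P.sharp z β = 0 := by
  rw [P.coord_hat hz]
  refine ⟨fun h => ?_, fun h => by rw [h, map_zero]⟩
  rw [← fr_co hz (P.sharp z β), h, map_zero]

theorem PoissonStructure.coord_skew (P : PoissonStructure n Z) (z₀ : Z) (y : Model n)
    (a b : Model n →L[ℝ] ℝ) :
    a (P.coord z₀ y b) = - b (P.coord z₀ y a) :=
  P.skew _ (a.comp (co z₀ ((extChartAt (𝓡 n) z₀).symm y)))
    (b.comp (co z₀ ((extChartAt (𝓡 n) z₀).symm y)))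

theorem PoissonStructure.contDiffAt_coord (P : PoissonStructure n Z) {z₀ : Z} {y : Model n}
    (hy : y ∈ (extChartAt (𝓡 n) z₀).target) : ContDiffAt ℝ ∞ (P.coord z₀) y := by
  have hd : ContDiffOn ℝ ∞ (P.coord z₀) (extChartAt (𝓡 n) z₀).target := by
    rw [contDiffOn_clm_apply]
    intro b y hyt
    refine ContDiffAt.contDiffWithinAt ?_
    have h₁ : ContMDiffAt 𝓘(ℝ, Model n) (cotModel n) ∞
        (fun y => cot n ((extChartAt (𝓡 n) z₀).symm y)
          (b.comp (co z₀ ((extChartAt (𝓡 n) z₀).symm y)))) y := by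
      rw [contMDiffAt_cot_iff z₀ (extChartAt_symm_mem hyt)]
      refine ⟨contMDiffAt_extChartAt_symm' hyt,
        (contMDiffAt_const (c := b)).congr_of_eventuallyEq ?_⟩
      filter_upwards [extChartAt_target_mem_nhds_of_mem hyt] with q hq
      exact hat_of_comp_co (extChartAt_symm_mem hq) b
    have h₂ := P.smooth.contMDiffAt.comp y h₁
    exact ((contMDiffAt_tangent_iff z₀ (extChartAt_symm_mem hyt)).1 h₂).2.contDiffAt
  exact hd.contDiffAt (extChartAt_target_mem_nhds_of_mem hy)

end Sharp

/-! ### Extension of germs and local retractions -/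

section Extension

variable {n : ℕ} {Z : Type u} [TopologicalSpace Z] [T2Space Z] [ChartedSpace (Model n) Z]
  [IsManifold (𝓡 n) ∞ Z]

theorem exists_smooth_cutoff {z₀ : Z} {s : Set Z} (hs : s ∈ 𝓝 z₀) :
    ∃ χ : Z → ℝ, ContMDiff (𝓡 n) 𝓘(ℝ, ℝ) ∞ χ ∧ χ =ᶠ[𝓝 z₀] 1 ∧ tsupport χ ⊆ s := by
  obtain ⟨f, -, hf⟩ := (SmoothBumpFunction.nhds_basis_tsupport (I := 𝓡 n) z₀).mem_iff.1 hs
  exact ⟨f, f.contMDiff, f.eventuallyEq_one, hf⟩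

/-- Every germ of a smooth function is the germ of a globally defined smooth function. -/
theorem exists_contMDiff_extension {F : Type*} [NormedAddCommGroup F] [NormedSpace ℝ F] {z₀ : Z}
    {f : Z → F} (hf : ∀ᶠ z in 𝓝 z₀, ContMDiffAt (𝓡 n) 𝓘(ℝ, F) ∞ f z) :
    ∃ g : Z → F, ContMDiff (𝓡 n) 𝓘(ℝ, F) ∞ g ∧ g =ᶠ[𝓝 z₀] f := by
  obtain ⟨χ, hχ, h₁, hs⟩ := exists_smooth_cutoff (n := n) hf
  refine ⟨fun z => χ z • f z, fun z => ?_, ?_⟩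
  · by_cases hz : z ∈ tsupport χ
    · exact hχ.contMDiffAt.smul (hs hz)
    · refine (contMDiffAt_const (c := (0 : F))).congr_of_eventuallyEq ?_
      filter_upwards [(isClosed_tsupport χ).isOpen_compl.mem_nhds hz] with y hy
      rw [image_eq_zero_of_notMem_tsupport hy, zero_smul]
  · filter_upwards [h₁] with z hz
    rw [hz, Pi.one_apply, one_smul]

/-- There is a one-form with prescribed coordinates near a given point. -/
theorem exists_oneForm {z₀ : Z} {b : Z → (Model n →L[ℝ] ℝ)}
    (hb : ∀ᶠ z in 𝓝 z₀, ContMDiffAt (𝓡 n) 𝓘(ℝ, Model n →L[ℝ] ℝ) ∞ b z) :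
    ∃ e : OneForm n Z, ∀ᶠ z in 𝓝 z₀, hat z₀ (e.val z) = b z := by
  have hsrc := chart_source_mem_nhds (Model n) z₀
  obtain ⟨χ, hχ, h₁, hs⟩ := exists_smooth_cutoff (n := n) (inter_mem hb hsrc)
  refine ⟨⟨fun z => ((χ z • b z).comp (co z₀ z) : Cot n z), fun z => ?_⟩, ?_⟩
  · by_cases hz : z ∈ tsupport χ
    · refine (contMDiffAt_cot_iff z₀ (hs hz).2).2 ⟨contMDiffAt_id,
        (hχ.contMDiffAt.smul (hs hz).1).congr_of_eventuallyEq ?_⟩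
      filter_upwards [(chartAt (Model n) z₀).open_source.mem_nhds (hs hz).2] with y hy
      exact hat_of_comp_co hy _
    · refine (contMDiffAt_cot_iff z (mem_chart_source _ z)).2 ⟨contMDiffAt_id,
        (contMDiffAt_const (c := (0 : Model n →L[ℝ] ℝ))).congr_of_eventuallyEq ?_⟩
      filter_upwards [(isClosed_tsupport χ).isOpen_compl.mem_nhds hz] with y hy
      change hat z ((χ y • b y).comp (co z₀ y) : Cot n y) = 0
      rw [image_eq_zero_of_notMem_tsupport hy, zero_smul, ContinuousLinearMap.zero_comp]
      rfl
  · filter_upwards [h₁, hsrc] with z hz hz'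
    rw [hat_of_comp_co hz', hz, Pi.one_apply, one_smul]

/-- There is a vector field with prescribed constant coordinates near a given point. -/
theorem exists_vField (z₀ : Z) (w : Model n) :
    ∃ W : VField n Z, ∀ᶠ z in 𝓝 z₀, W.val z = fr z₀ z w := by
  have hsrc := chart_source_mem_nhds (Model n) z₀
  obtain ⟨χ, hχ, h₁, hs⟩ := exists_smooth_cutoff (n := n) hsrc
  refine ⟨⟨fun z => χ z • fr z₀ z w, fun z => ?_⟩, ?_⟩
  · by_cases hz : z ∈ tsupport χ
    · refine (contMDiffAt_tangent_iff z₀ (hs hz)).2 ⟨contMDiffAt_id,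
        (hχ.contMDiffAt.smul (contMDiffAt_const (c := w))).congr_of_eventuallyEq ?_⟩
      filter_upwards [(chartAt (Model n) z₀).open_source.mem_nhds (hs hz)] with y hy
      exact ((co z₀ y).map_smul _ _).trans (congrArg (χ y • ·) (co_fr hy w))
    · refine (contMDiffAt_tangent_iff z (mem_chart_source _ z)).2 ⟨contMDiffAt_id,
        (contMDiffAt_const (c := (0 : Model n))).congr_of_eventuallyEq ?_⟩
      filter_upwards [(isClosed_tsupport χ).isOpen_compl.mem_nhds hz] with y hy
      exact ((co z y).map_smul _ _).trans (by
        rw [image_eq_zero_of_notMem_tsupport hy, zero_smul])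
  · filter_upwards [h₁] with z hz
    rw [hz, Pi.one_apply, one_smul]

theorem exists_vField_eq {z : Z} (v : TangentSpace (𝓡 n) z) : ∃ W : VField n Z, W.val z = v := by
  obtain ⟨W, hW⟩ := exists_vField z (v : Model n)
  exact ⟨W, hW.self_of_nhds.trans (fr_self z _)⟩

/-- Linear functions of the coordinates extend to smooth functions. -/
theorem exists_contMDiff_coord {z₀ z : Z} (hz : z ∈ (chartAt (Model n) z₀).source)
    (f : Model n →L[ℝ] ℝ) : ∃ F : Z → ℝ, ContMDiff (𝓡 n) 𝓘(ℝ, ℝ) ∞ F ∧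
      F =ᶠ[𝓝 z] fun q => f (extChartAt (𝓡 n) z₀ q) := by
  refine exists_contMDiff_extension ?_
  filter_upwards [(chartAt (Model n) z₀).open_source.mem_nhds hz] with q hq
  exact contMDiffAt_of_contDiffAt_chart hq f.contDiff.contDiffAt

/-- A covector is the differential of a smooth function. -/
theorem exists_diff_eq {z : Z} (β : Cot n z) :
    ∃ F : Z → ℝ, ContMDiff (𝓡 n) 𝓘(ℝ, ℝ) ∞ F ∧ diff n F z = β := by
  have hz := mem_chart_source (Model n) z
  obtain ⟨F, hF, hF'⟩ := exists_contMDiff_coord hz (hat z β)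
  refine ⟨F, hF, hat_injective hz ?_⟩
  rw [hat_diff_of_eventuallyEq hz hF' (hat z β).contDiff.contDiffAt, ContinuousLinearMap.fderiv]

end Extension

section Retraction

variable {n : ℕ} {Z : Type u} [TopologicalSpace Z] [ChartedSpace (Model n) Z]
  {k : ℕ} {N : Type v} [TopologicalSpace N] [ChartedSpace (Model k) N]

/-- An immersion has a smooth local left inverse. -/
theorem exists_local_retraction {κ : N → Z} {x : N}
    (h : Manifold.IsImmersionAt (𝓡 k) (𝓡 n) ∞ κ x) :
    ∃ ρ : Z → N, (∀ᶠ z in 𝓝 (κ x), ContMDiffAt (𝓡 n) (𝓡 k) ∞ ρ z) ∧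
      ∀ᶠ y in 𝓝 x, ρ (κ y) = y := by
  set q : Z → Model k := fun z => (h.equiv.symm (h.codChart.extend (𝓡 n) z)).1 with hq
  have hqκ : ∀ y ∈ h.domChart.source, q (κ y) = h.domChart.extend (𝓡 k) y := fun y hy => by
    have hy' : y ∈ (h.domChart.extend (𝓡 k)).source := by
      rwa [OpenPartialHomeomorph.extend_source]
    have h₁ := h.writtenInCharts ((h.domChart.extend (𝓡 k)).map_source hy')
    simp only [Function.comp_apply] at h₁
    rw [(h.domChart.extend (𝓡 k)).left_inv hy'] at h₁
    rw [hq]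
    dsimp only
    rw [h₁, ContinuousLinearEquiv.symm_apply_apply]
  have hqs : ∀ z ∈ h.codChart.source, ContMDiffAt (𝓡 n) 𝓘(ℝ, Model k) ∞ q z := fun z hz =>
    ((ContinuousLinearMap.fst ℝ _ _).comp
      (h.equiv.symm : Model n →L[ℝ] Model k × h.complement)).contMDiff.contMDiffAt.comp z
      (h.codChart.contMDiffAt_extend h.codChart_mem_maximalAtlas hz)
  refine ⟨fun z => (h.domChart.extend (𝓡 k)).symm (q z), ?_, ?_⟩
  · have ht : IsOpen (h.domChart.extend (𝓡 k)).target := h.domChart.isOpen_extend_target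
    have hx : q (κ x) ∈ (h.domChart.extend (𝓡 k)).target := by
      rw [hqκ x h.mem_domChart_source]
      exact (h.domChart.extend (𝓡 k)).map_source
        (by rw [OpenPartialHomeomorph.extend_source]; exact h.mem_domChart_source)
    filter_upwards [h.codChart.open_source.mem_nhds h.mem_codChart_source,
      (hqs _ h.mem_codChart_source).continuousAt.eventually (ht.mem_nhds hx)] with z hz hz'
    have := contMDiffOn_extend_symm h.domChart_mem_maximalAtlas
    rw [← OpenPartialHomeomorph.extend_target'] at this
    exact (this.contMDiffAt (ht.mem_nhds hz')).comp z (hqs z hz)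
  · filter_upwards [h.domChart.open_source.mem_nhds h.mem_domChart_source] with y hy
    rw [hqκ y hy, (h.domChart.extend (𝓡 k)).left_inv
      (by rwa [OpenPartialHomeomorph.extend_source])]

theorem mfderiv_injective_of_isImmersionAt {κ : N → Z} {x : N}
    (h : Manifold.IsImmersionAt (𝓡 k) (𝓡 n) ∞ κ x) :
    Function.Injective (mfderiv (𝓡 k) (𝓡 n) κ x) := by
  obtain ⟨ρ, hρ, hid⟩ := exists_local_retraction h
  have h₁ := mfderiv_comp x (hρ.self_of_nhds.mdifferentiableAt (by simp))
    (h.contMDiffAt.mdifferentiableAt (by simp))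
  have h₂ : ρ ∘ κ =ᶠ[𝓝 x] id := hid
  rw [h₂.mfderiv_eq, mfderiv_id] at h₁
  intro v w hvw
  have h₃ : ∀ v, v = mfderiv (𝓡 n) (𝓡 k) ρ (κ x) (mfderiv (𝓡 k) (𝓡 n) κ x v) := fun v =>
    congrArg (fun T => T v) h₁
  exact (h₃ v).trans ((congrArg _ hvw).trans (h₃ w).symm)

end Retraction

/-! ### The Poisson bracket and the bracket of one-forms in coordinates -/

section PoissonCoord

theorem fderiv_pairing {E : Type*} [NormedAddCommGroup E] [NormedSpace ℝ E]
    {b : E → (E →L[ℝ] ℝ)} {v : E → E} {y : E} (hb : ContDiffAt ℝ ∞ b y) (hv : ContDiffAt ℝ ∞ v y)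
    (w : E) : fderiv ℝ (fun y => b y (v y)) y w = fderiv ℝ b y w (v y) + b y (fderiv ℝ v y w) := by
  rw [fderiv_clm_apply (hb.differentiableAt (by simp)) (hv.differentiableAt (by simp))]
  simp [add_comm]

variable {n : ℕ} {Z : Type u} [TopologicalSpace Z] [ChartedSpace (Model n) Z]
  [IsManifold (𝓡 n) ∞ Z]

theorem PoissonStructure.apply_sharp (P : PoissonStructure n Z) {z₀ z : Z}
    (hz : z ∈ (chartAt (Model n) z₀).source) (α β : Cot n z) :
    α (P.sharp z β) = hat z₀ α (P.coord z₀ (extChartAt (𝓡 n) z₀ z) (hat z₀ β)) := by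
  rw [P.coord_hat hz, hat_co hz]

theorem PoissonStructure.vhat_sharp (P : PoissonStructure n Z) {z₀ : Z} {y : Model n}
    (hy : y ∈ (extChartAt (𝓡 n) z₀).target) (α : ∀ z : Z, Cot n z) :
    vhat z₀ (fun z => P.sharp z (α z)) y = P.coord z₀ y (fhat z₀ α y) := by
  have h := P.coord_hat (extChartAt_symm_mem hy) (α ((extChartAt (𝓡 n) z₀).symm y))
  rw [(extChartAt (𝓡 n) z₀).right_inv hy] at h
  exact h.symm

/-- The Leibniz rule for the pairing of a one-form and a vector field, in coordinates. -/
theorem dirDeriv_pairing {z₀ z : Z} (hz : z ∈ (chartAt (Model n) z₀).source)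
    {α : ∀ z : Z, Cot n z} {V : ∀ z : Z, TangentSpace (𝓡 n) z}
    (hα : ContDiffAt ℝ ∞ (fhat z₀ α) (extChartAt (𝓡 n) z₀ z))
    (hV : ContDiffAt ℝ ∞ (vhat z₀ V) (extChartAt (𝓡 n) z₀ z))
    (U : ∀ z : Z, TangentSpace (𝓡 n) z) :
    dirDeriv U (fun y => α y (V y)) z =
      fderiv ℝ (fhat z₀ α) (extChartAt (𝓡 n) z₀ z) (co z₀ z (U z)) (co z₀ z (V z))
      + hat z₀ (α z) (fderiv ℝ (vhat z₀ V) (extChartAt (𝓡 n) z₀ z) (co z₀ z (U z))) := by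
  have h₁ : (fun q => α q (V q)) =ᶠ[𝓝 z] fun q =>
      fhat z₀ α (extChartAt (𝓡 n) z₀ q) (vhat z₀ V (extChartAt (𝓡 n) z₀ q)) := by
    filter_upwards [(chartAt (Model n) z₀).open_source.mem_nhds hz] with q hq
    rw [fhat_chart hq, vhat_chart hq, hat_co hq]
  have h₂ := hat_diff_of_eventuallyEq (g := fun y => fhat z₀ α y (vhat z₀ V y)) hz h₁
    (hα.clm_apply hV)
  rw [dirDeriv, ← hat_co hz, h₂, fderiv_pairing hα hV, vhat_chart hz, fhat_chart hz]

/-- In a chart, a Poisson structure is a Poisson tensor on the model space. Its Jacobi identity is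
that of `P` for coordinate functions, cut off away from a point. -/
theorem PoissonStructure.isPoissonNear_coord [T2Space Z] (P : PoissonStructure n Z) {z₀ z : Z}
    (hz : z ∈ (chartAt (Model n) z₀).source) :
    IsPoissonNear (P.coord z₀) (extChartAt (𝓡 n) z₀ z) := by
  have ht := extChartAt_target_mem_nhds_of_mem (extChartAt_mem_target hz)
  refine ⟨?_, Eventually.of_forall fun y => P.coord_skew z₀ y, ?_⟩
  · filter_upwards [ht] with y hy using P.contDiffAt_coord hy
  -- the Jacobi identity for functions that are linear in the coordinates
  filter_upwards [ht] with y hy f g h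
  obtain ⟨q, hq, rfl⟩ : ∃ q ∈ (chartAt (Model n) z₀).source, y = extChartAt (𝓡 n) z₀ q :=
    ⟨_, extChartAt_symm_mem hy, ((extChartAt (𝓡 n) z₀).right_inv hy).symm⟩
  have hB := (P.contDiffAt_coord hy)
  have key : ∀ f g h : Model n →L[ℝ] ℝ, ∀ F G H : Z → ℝ,
      (F =ᶠ[𝓝 q] fun p => f (extChartAt (𝓡 n) z₀ p)) →
      (G =ᶠ[𝓝 q] fun p => g (extChartAt (𝓡 n) z₀ p)) →
      (H =ᶠ[𝓝 q] fun p => h (extChartAt (𝓡 n) z₀ p)) →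
      diff n F q (P.sharp q (diff n (fun y => diff n G y (P.sharp y (diff n H y))) q)) =
        - g (fderiv ℝ (P.coord z₀) (extChartAt (𝓡 n) z₀ q)
          (P.coord z₀ (extChartAt (𝓡 n) z₀ q) f) h) := by
    intro f g h F G H hF hG hH
    have h₁ : (fun p => diff n G p (P.sharp p (diff n H p))) =ᶠ[𝓝 q] fun p =>
        g (P.coord z₀ (extChartAt (𝓡 n) z₀ p) h) := by
      filter_upwards [(chartAt (Model n) z₀).open_source.mem_nhds hq, hG.eventually_nhds,
        hH.eventually_nhds] with p hp hGp hHp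
      rw [P.apply_sharp hp, hat_diff_of_eventuallyEq hp hGp g.contDiff.contDiffAt,
        hat_diff_of_eventuallyEq hp hHp h.contDiff.contDiffAt, ContinuousLinearMap.fderiv,
        ContinuousLinearMap.fderiv]
    have hd : ContDiffAt ℝ ∞ (fun y => g (P.coord z₀ y h)) (extChartAt (𝓡 n) z₀ q) :=
      g.contDiff.contDiffAt.comp _ (hB.clm_apply contDiffAt_const)
    rw [P.apply_sharp hq, hat_diff_of_eventuallyEq hq hF f.contDiff.contDiffAt,
      hat_diff_of_eventuallyEq (g := fun y => g (P.coord z₀ y h)) hq h₁ hd,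
      ContinuousLinearMap.fderiv, P.coord_skew]
    have h₂ : HasFDerivAt (fun y => g (P.coord z₀ y h)) (g.comp ((fderiv ℝ (P.coord z₀)
        (extChartAt (𝓡 n) z₀ q)).flip h)) (extChartAt (𝓡 n) z₀ q) :=
      g.hasFDerivAt.comp _ (((hB.differentiableAt (by simp)).hasFDerivAt.clm_apply
        (hasFDerivAt_const h _)).congr_fderiv (by ext; simp))
    rw [h₂.fderiv]
    rfl
  obtain ⟨F, hF, hF'⟩ := exists_contMDiff_coord hq f
  obtain ⟨G, hG, hG'⟩ := exists_contMDiff_coord hq g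
  obtain ⟨H, hH, hH'⟩ := exists_contMDiff_coord hq h
  have := P.jacobi F G H hF hG hH q
  rw [key f g h F G H hF' hG' hH', key g h f G H F hG' hH' hF', key h f g H F G hH' hF' hG'] at this
  linarith

/-- The bracket of the isotropy Lie algebra in coordinates. -/
theorem PoissonStructure.hat_diff_bracket (P : PoissonStructure n Z) {z₀ z : Z}
    (hz : z ∈ (chartAt (Model n) z₀).source) {F G : Z → ℝ}
    (hF : ContMDiff (𝓡 n) 𝓘(ℝ, ℝ) ∞ F) (hG : ContMDiff (𝓡 n) 𝓘(ℝ, ℝ) ∞ G)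
    (hF₀ : P.sharp z (diff n F z) = 0) (hG₀ : P.sharp z (diff n G z) = 0) :
    hat z₀ (diff n (P.bracket F G) z) =
      isoBracket (P.coord z₀) (extChartAt (𝓡 n) z₀ z) (hat z₀ (diff n F z))
        (hat z₀ (diff n G z)) := by
  have hB := P.contDiffAt_coord (extChartAt_mem_target hz)
  have hd : ∀ F : Z → ℝ, ContMDiff (𝓡 n) 𝓘(ℝ, ℝ) ∞ F →
      ContDiffAt ℝ ∞ (fderiv ℝ (F ∘ (extChartAt (𝓡 n) z₀).symm)) (extChartAt (𝓡 n) z₀ z) :=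
    fun F hF => (contDiffAt_comp_extChartAt_symm hz (hF z)).fderiv_right (by simp)
  have h₁ : P.bracket F G =ᶠ[𝓝 z] fun q =>
      fderiv ℝ (F ∘ (extChartAt (𝓡 n) z₀).symm) (extChartAt (𝓡 n) z₀ q)
        (P.coord z₀ (extChartAt (𝓡 n) z₀ q)
          (fderiv ℝ (G ∘ (extChartAt (𝓡 n) z₀).symm) (extChartAt (𝓡 n) z₀ q))) := by
    filter_upwards [(chartAt (Model n) z₀).open_source.mem_nhds hz] with q hq
    rw [PoissonStructure.bracket, P.apply_sharp hq, hat_diff hq (hF.mdifferentiable (by simp) q),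
      hat_diff hq (hG.mdifferentiable (by simp) q)]
  ext w
  rw [hat_diff_of_eventuallyEq (g := fun y => fderiv ℝ (F ∘ (extChartAt (𝓡 n) z₀).symm) y
        (P.coord z₀ y (fderiv ℝ (G ∘ (extChartAt (𝓡 n) z₀).symm) y))) hz h₁
      ((hd F hF).clm_apply (hB.clm_apply (hd G hG))),
    fderiv_pairing (hd F hF) (hB.clm_apply (hd G hG)),
    ← hat_diff hz (hF.mdifferentiable (by simp) z), ← hat_diff hz (hG.mdifferentiable (by simp) z),
    (P.coord_eq_zero_iff hz _).2 hG₀, map_zero, zero_add,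
    fderiv_clm_apply (hB.differentiableAt (by simp)) ((hd G hG).differentiableAt (by simp))]
  rw [add_apply, map_add, ContinuousLinearMap.comp_apply, P.coord_skew,
    (P.coord_eq_zero_iff hz _).2 hF₀, map_zero, neg_zero, zero_add,
    ← hat_diff hz (hG.mdifferentiable (by simp) z)]
  rfl

/-- The bracket `{a, e}` of one-forms in coordinates, at a point where `ϖ♯ e = 0`. -/
theorem PoissonStructure.formBracket_eq (P : PoissonStructure n Z) {z₀ z : Z}
    (hz : z ∈ (chartAt (Model n) z₀).source) (a e : OneForm n Z) (W : VField n Z)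
    (he : P.sharp z (e.val z) = 0) :
    P.formBracket a.val e.val W.val z =
      isoBracket (P.coord z₀) (extChartAt (𝓡 n) z₀ z) (hat z₀ (a.val z)) (hat z₀ (e.val z))
        (co z₀ z (W.val z))
      - fderiv ℝ (fhat z₀ e.val) (extChartAt (𝓡 n) z₀ z)
        (P.coord z₀ (extChartAt (𝓡 n) z₀ z) (hat z₀ (a.val z))) (co z₀ z (W.val z)) := by
  have hB := P.contDiffAt_coord (extChartAt_mem_target hz)
  have ht := extChartAt_target_mem_nhds_of_mem (extChartAt_mem_target hz)
  have hs : ∀ a : OneForm n Z, ContMDiffAt (𝓡 n) (𝓡 n).tangent ∞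
      (fun z => (⟨z, P.sharp z (a.val z)⟩ : TangentBundle (𝓡 n) Z)) z := fun a =>
    P.smooth.contMDiffAt.comp z (a.smooth z)
  have ha' := contDiffAt_fhat hz (a.smooth z)
  have he' := contDiffAt_fhat hz (e.smooth z)
  have hW' := contDiffAt_vhat hz (W.smooth z)
  have hsa := contDiffAt_vhat hz (hs a)
  have hse := contDiffAt_vhat hz (hs e)
  have hds : ∀ a : OneForm n Z, ∀ w, fderiv ℝ (vhat z₀ fun z => P.sharp z (a.val z))
      (extChartAt (𝓡 n) z₀ z) w = fderiv ℝ (P.coord z₀) (extChartAt (𝓡 n) z₀ z) w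
        (hat z₀ (a.val z)) + P.coord z₀ (extChartAt (𝓡 n) z₀ z)
          (fderiv ℝ (fhat z₀ a.val) (extChartAt (𝓡 n) z₀ z) w) := by
    intro a w
    have h : (vhat z₀ fun z => P.sharp z (a.val z)) =ᶠ[𝓝 (extChartAt (𝓡 n) z₀ z)]
        fun y => P.coord z₀ y (fhat z₀ a.val y) := by
      filter_upwards [ht] with y hy using P.vhat_sharp hy a.val
    rw [h.fderiv_eq, fderiv_clm_apply (hB.differentiableAt (by simp))
      ((contDiffAt_fhat hz (a.smooth z)).differentiableAt (by simp)), fhat_chart hz]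
    simp [add_comm]
  have hbr : ∀ (a : ∀ z : Z, Cot n z) (U V : ∀ z : Z, TangentSpace (𝓡 n) z),
      a z (VectorField.mlieBracket (𝓡 n) U V z) =
        hat z₀ (a z) (co z₀ z (VectorField.mlieBracket (𝓡 n) U V z)) := fun a U V =>
    (hat_co hz _ _).symm
  rw [PoissonStructure.formBracket, extDer, extDer, hbr, hbr, co_mlieBracket hz (hs e) (W.smooth z),
    co_mlieBracket hz (hs a) (W.smooth z), dirDeriv_pairing hz ha' hW', dirDeriv_pairing hz ha' hse,
    dirDeriv_pairing hz he' hW', dirDeriv_pairing hz he' hsa, hds, hds, ← P.coord_hat hz,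
    (P.coord_eq_zero_iff hz _).2 he, ← P.coord_hat hz, isoBracket_apply]
  have h := P.coord_skew z₀ (extChartAt (𝓡 n) z₀ z) (hat z₀ (a.val z))
    (fderiv ℝ (fhat z₀ e.val) (extChartAt (𝓡 n) z₀ z) (co z₀ z (W.val z)))
  simp only [map_zero, map_sub, map_add, zero_apply, h]
  ring

end PoissonCoord

/-! ### The isotropy Lie algebras of a leaf -/

section Leaf

variable {n : ℕ} {Z : Type u} [TopologicalSpace Z] [ChartedSpace (Model n) Z]
  [IsManifold (𝓡 n) ∞ Z] {P : PoissonStructure n Z} {k : ℕ} {S : Type v} [TopologicalSpace S]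
  [ChartedSpace (Model k) S] [IsManifold (𝓡 k) ∞ S]

omit [IsManifold (𝓡 n) ∞ Z] in
theorem cot_separation {z : Z} {w : TangentSpace (𝓡 n) z} (h : ∀ β : Cot n z, β w = 0) : w = 0 := by
  have h' : ∀ (w : Model n), (∀ β : Model n →L[ℝ] ℝ, β w = 0) → w = 0 := fun w h => by
    by_contra hw
    obtain ⟨f, hf⟩ := SeparatingDual.exists_ne_zero (R := ℝ) hw
    exact hf (h f)
  exact h' w h

/-- The annihilator of `TS` is the kernel of `ϖ♯`, since `TS` is the image of the skew map `ϖ♯`. -/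
theorem SymplecticLeaf.mem_isotropy_iff (L : SymplecticLeaf P k S) {s : S}
    {β : Cot n (L.incl s)} : β ∈ L.isotropy s ↔ P.sharp (L.incl s) β = 0 := by
  refine ⟨fun h => cot_separation fun γ => ?_, fun h v => ?_⟩
  · obtain ⟨v, hv⟩ := L.sharp_mem s γ
    rw [P.skew, ← hv, h v, neg_zero]
  · obtain ⟨γ, hγ⟩ := L.exists_sharp s v
    rw [← hγ, P.skew, h, map_zero, neg_zero]

/-- The Lie bracket of the isotropy algebra is `isoBracket` in every chart. -/
theorem SymplecticLeaf.isLieIso_iff [T2Space Z] (L : SymplecticLeaf P k S) {𝔤 : Type*} [LieRing 𝔤]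
    [LieAlgebra ℝ 𝔤] {s : S} {z₀ : Z} (hz : L.incl s ∈ (chartAt (Model n) z₀).source)
    (f : 𝔤 ≃ₗ[ℝ] L.isotropy s) :
    L.IsLieIso s f ↔ ∀ ξ η : 𝔤, isoBracket (P.coord z₀) (extChartAt (𝓡 n) z₀ (L.incl s))
      (hat z₀ (f ξ : Cot n (L.incl s))) (hat z₀ (f η : Cot n (L.incl s))) =
        hat z₀ (f ⁅ξ, η⁆ : Cot n (L.incl s)) := by
  have h₀ : ∀ ξ, P.sharp (L.incl s) (f ξ) = 0 := fun ξ => L.mem_isotropy_iff.1 (f ξ).2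
  constructor
  · intro h ξ η
    obtain ⟨F, hF, hF'⟩ := exists_diff_eq (f ξ : Cot n (L.incl s))
    obtain ⟨G, hG, hG'⟩ := exists_diff_eq (f η : Cot n (L.incl s))
    rw [← h ξ η F G hF hG hF' hG', P.hat_diff_bracket hz hF hG (by rw [hF', h₀])
      (by rw [hG', h₀]), hF', hG']
  · intro h ξ η F G hF hG hF' hG'
    refine hat_injective hz ?_
    rw [P.hat_diff_bracket hz hF hG (by rw [hF', h₀]) (by rw [hG', h₀]), hF', hG', h]

end Leaf

/-! ### Maps in coordinates, and the inclusions of the leaf and of the Lagrangian submanifold -/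

section CoordMap

variable {n : ℕ} {Z : Type u} [TopologicalSpace Z] [ChartedSpace (Model n) Z]
  [IsManifold (𝓡 n) ∞ Z] {k : ℕ} {S : Type v} [TopologicalSpace S] [ChartedSpace (Model k) S]
  [IsManifold (𝓡 k) ∞ S]

/-- A map between manifolds in the charts at `s₀` and `z₀`. -/
def coordMap (f : S → Z) (s₀ : S) (z₀ : Z) (y : Model k) : Model n :=
  extChartAt (𝓡 n) z₀ (f ((extChartAt (𝓡 k) s₀).symm y))

omit [IsManifold (𝓡 n) ∞ Z] [IsManifold (𝓡 k) ∞ S] in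
theorem coordMap_chart (f : S → Z) {s₀ s : S} (z₀ : Z) (hs : s ∈ (chartAt (Model k) s₀).source) :
    coordMap f s₀ z₀ (extChartAt (𝓡 k) s₀ s) = extChartAt (𝓡 n) z₀ (f s) := by
  rw [coordMap, extChartAt_left_inv hs]

theorem contDiffAt_coordMap {f : S → Z} {s₀ s : S} {z₀ : Z}
    (hs : s ∈ (chartAt (Model k) s₀).source) (hz : f s ∈ (chartAt (Model n) z₀).source)
    (hf : ContMDiffAt (𝓡 k) (𝓡 n) ∞ f s) :
    ContDiffAt ℝ ∞ (coordMap (n := n) (k := k) f s₀ z₀) (extChartAt (𝓡 k) s₀ s) :=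
  contDiffAt_comp_extChartAt_symm (f := fun s => extChartAt (𝓡 n) z₀ (f s)) hs
    ((contMDiffAt_extChartAt' (I := 𝓡 n) hz).comp s hf)

theorem co_mfderiv_eq {f : S → Z} {s₀ s : S} {z₀ : Z}
    (hs : s ∈ (chartAt (Model k) s₀).source) (hz : f s ∈ (chartAt (Model n) z₀).source)
    (hf : ContMDiffAt (𝓡 k) (𝓡 n) ∞ f s) (v : TangentSpace (𝓡 k) s) :
    co z₀ (f s) (mfderiv (𝓡 k) (𝓡 n) f s v) =
      fderiv ℝ (coordMap f s₀ z₀) (extChartAt (𝓡 k) s₀ s) (co s₀ s v) := by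
  rw [co_mfderiv hz (hf.mdifferentiableAt (by simp))]
  exact mfderiv_eq_fderiv_co (f := fun s => extChartAt (𝓡 n) z₀ (f s)) hs
    (((contMDiffAt_extChartAt' (I := 𝓡 n) hz).comp s hf).mdifferentiableAt (by simp)) v

end CoordMap

section Leaf

variable {n : ℕ} {Z : Type u} [TopologicalSpace Z] [ChartedSpace (Model n) Z]
  [IsManifold (𝓡 n) ∞ Z] {P : PoissonStructure n Z} {k : ℕ} {S : Type v} [TopologicalSpace S]
  [ChartedSpace (Model k) S] [IsManifold (𝓡 k) ∞ S]

namespace SymplecticLeaf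

theorem contMDiff_incl (L : SymplecticLeaf P k S) : ContMDiff (𝓡 k) (𝓡 n) ∞ L.incl :=
  L.embedding.isImmersion.contMDiff

theorem tmap_injective (L : SymplecticLeaf P k S) (s : S) : Function.Injective (L.tmap s) :=
  mfderiv_injective_of_isImmersionAt (L.embedding.isImmersion.isImmersionAt s)

/-- The inclusion of the leaf, in the charts at `s₀` and at its image. -/
def jmap (L : SymplecticLeaf P k S) (s₀ : S) : Model k → Model n := coordMap L.incl s₀ (L.incl s₀)

variable (L : SymplecticLeaf P k S) {s₀ s : S}

theorem co_tmap (hs : s ∈ (chartAt (Model k) s₀).source)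
    (hz : L.incl s ∈ (chartAt (Model n) (L.incl s₀)).source) (v : TangentSpace (𝓡 k) s) :
    co (L.incl s₀) (L.incl s) (L.tmap s v) =
      fderiv ℝ (L.jmap s₀) (extChartAt (𝓡 k) s₀ s) (co s₀ s v) :=
  co_mfderiv_eq hs hz (L.contMDiff_incl s) v

theorem contDiffAt_jmap (hs : s ∈ (chartAt (Model k) s₀).source)
    (hz : L.incl s ∈ (chartAt (Model n) (L.incl s₀)).source) :
    ContDiffAt ℝ ∞ (L.jmap s₀) (extChartAt (𝓡 k) s₀ s) :=
  contDiffAt_coordMap hs hz (L.contMDiff_incl s)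

theorem fderiv_jmap_injective (hs : s ∈ (chartAt (Model k) s₀).source)
    (hz : L.incl s ∈ (chartAt (Model n) (L.incl s₀)).source) :
    Function.Injective (fderiv ℝ (L.jmap s₀) (extChartAt (𝓡 k) s₀ s)) := by
  intro v w h
  rw [← co_fr hs v, ← co_fr hs w, ← L.co_tmap hs hz, ← L.co_tmap hs hz] at h
  rw [← co_fr hs v, ← co_fr hs w, L.tmap_injective s (Function.LeftInverse.injective
    (fr_co hz) h)]

/-- In coordinates, the leaf is an integral manifold of the Poisson tensor. -/
theorem range_fderiv_jmap (hs : s ∈ (chartAt (Model k) s₀).source)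
    (hz : L.incl s ∈ (chartAt (Model n) (L.incl s₀)).source) :
    LinearMap.range (fderiv ℝ (L.jmap s₀) (extChartAt (𝓡 k) s₀ s)).toLinearMap =
      LinearMap.range (P.coord (L.incl s₀) (L.jmap s₀ (extChartAt (𝓡 k) s₀ s))).toLinearMap := by
  rw [jmap, coordMap_chart _ _ hs]
  ext w
  constructor
  · rintro ⟨v, rfl⟩
    obtain ⟨β, hβ⟩ := L.exists_sharp s (fr s₀ s v)
    refine ⟨hat (L.incl s₀) β, ?_⟩
    have h := L.co_tmap hs hz (fr s₀ s v)
    rw [co_fr hs, ← hβ, ← P.coord_hat hz] at h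
    exact h
  · rintro ⟨b, rfl⟩
    obtain ⟨v, hv⟩ := L.sharp_mem s (b.comp (co (L.incl s₀) (L.incl s)) : Cot n _)
    refine ⟨co s₀ s v, ?_⟩
    have h := L.co_tmap hs hz v
    rw [hv, ← P.coord_hat hz, hat_of_comp_co hz] at h
    exact h.symm

/-- Points near `s₀` lie in the charts at `s₀` and at its image. -/
theorem eventually_mem_charts (s₀ : S) : ∀ᶠ s in 𝓝 s₀, s ∈ (chartAt (Model k) s₀).source ∧
    L.incl s ∈ (chartAt (Model n) (L.incl s₀)).source :=
  Eventually.and (chart_source_mem_nhds (Model k) s₀) (L.contMDiff_incl.continuous.continuousAt.eventually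
    (chart_source_mem_nhds (Model n) (L.incl s₀)))

theorem eventually_chart (s₀ : S) : ∀ᶠ y in 𝓝 (extChartAt (𝓡 k) s₀ s₀),
    ∃ s ∈ (chartAt (Model k) s₀).source, L.incl s ∈ (chartAt (Model n) (L.incl s₀)).source ∧
      y = extChartAt (𝓡 k) s₀ s := by
  have hs₀ := mem_chart_source (Model k) s₀
  have h := (contMDiffAt_extChartAt_symm' (extChartAt_mem_target hs₀)).continuousAt
  rw [ContinuousAt, extChartAt_left_inv hs₀] at h
  filter_upwards [h.eventually (L.eventually_mem_charts s₀),
    extChartAt_target_mem_nhds_of_mem (extChartAt_mem_target hs₀)] with y hy hy'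
  exact ⟨_, hy.1, hy.2, ((extChartAt (𝓡 k) s₀).right_inv hy').symm⟩

theorem omegaFlat_skew (s : S) (v w : TangentSpace (𝓡 k) s) :
    L.omegaFlat s v w = - L.omegaFlat s w v := by
  obtain ⟨β, hβ⟩ := L.exists_sharp s v
  obtain ⟨γ, hγ⟩ := L.exists_sharp s w
  rw [L.omegaFlat_apply s v w β hβ, L.omegaFlat_apply s w v γ hγ, ← hβ, ← hγ, P.skew]

/-- The form of the leaf is nondegenerate. -/
theorem omegaFlat_eq_zero (s : S) {v : TangentSpace (𝓡 k) s} (h : ∀ w, L.omegaFlat s v w = 0) :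
    v = 0 := by
  obtain ⟨β, hβ⟩ := L.exists_sharp s v
  have hm : β ∈ L.isotropy s := fun w => by rw [← L.omegaFlat_apply s v w β hβ, h w]
  refine L.tmap_injective s ?_
  rw [← hβ, L.mem_isotropy_iff.1 hm, map_zero]

/-- The symplectic form of the leaf in coordinates. -/
theorem exists_coord_omegaFlat (s₀ : S) :
    ∃ w : Model k → Model k →L[ℝ] Model k →L[ℝ] ℝ,
      ContDiffAt ℝ ∞ w (extChartAt (𝓡 k) s₀ s₀) ∧
      ∀ᶠ s in 𝓝 s₀, ∀ v v' : TangentSpace (𝓡 k) s,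
        L.omegaFlat s v v' = w (extChartAt (𝓡 k) s₀ s) (co s₀ s v) (co s₀ s v') := by
  have hs₀ := mem_chart_source (Model k) s₀
  have hz₀ := mem_chart_source (Model n) (L.incl s₀)
  have hj : ∀ᶠ y in 𝓝 (extChartAt (𝓡 k) s₀ s₀), ContDiffAt ℝ ∞ (fderiv ℝ (L.jmap s₀)) y := by
    filter_upwards [L.eventually_chart s₀]
    rintro _ ⟨s, hs, hz, rfl⟩
    exact (L.contDiffAt_jmap hs hz).fderiv_right (by simp)
  obtain ⟨a, ha, hsplit⟩ := exists_smooth_splitting (ι := fderiv ℝ (L.jmap s₀))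
    (B := fun y => P.coord (L.incl s₀) (L.jmap s₀ y)) (y := extChartAt (𝓡 k) s₀ s₀) hj
    (by
      filter_upwards [L.eventually_chart s₀]
      rintro _ ⟨s, hs, hz, rfl⟩
      refine ContDiffAt.comp (g := P.coord (L.incl s₀)) _ (P.contDiffAt_coord ?_)
        (L.contDiffAt_jmap hs hz)
      rw [jmap, coordMap_chart _ _ hs]
      exact extChartAt_mem_target hz)
    (L.fderiv_jmap_injective hs₀ hz₀)
    (by
      filter_upwards [L.eventually_chart s₀]
      rintro _ ⟨s, hs, hz, rfl⟩
      exact L.range_fderiv_jmap hs hz)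
  refine ⟨fun y => -((ContinuousLinearMap.compL ℝ (Model k) (Model n) ℝ).flip
    (fderiv ℝ (L.jmap s₀) y)).comp (a y), ?_, ?_⟩
  · exact (ContDiffAt.clm_comp (contDiffAt_const.clm_apply hj.self_of_nhds) ha.self_of_nhds).neg
  · filter_upwards [L.eventually_mem_charts s₀,
      (continuousAt_extChartAt (I := 𝓡 k) s₀).eventually hsplit] with s hs hsp v v'
    have h := hsp (co s₀ s v)
    rw [jmap, coordMap_chart _ _ hs.1, ← jmap, ← L.co_tmap hs.1 hs.2] at h
    set b := a (extChartAt (𝓡 k) s₀ s) (co s₀ s v)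
    have h₁ : P.sharp (L.incl s) (-(b.comp (co (L.incl s₀) (L.incl s)) : Cot n _)) =
        L.tmap s v := by
      have h₂ := P.coord_hat hs.2 (b.comp (co (L.incl s₀) (L.incl s)) : Cot n _)
      rw [hat_of_comp_co hs.2, h] at h₂
      rw [map_neg, ← fr_co hs.2 (P.sharp _ _), ← h₂, map_neg, fr_co hs.2, neg_neg]
    rw [L.omegaFlat_apply s v v' _ h₁]
    have h₃ := L.co_tmap hs.1 hs.2 v'
    change -(b (co (L.incl s₀) (L.incl s) (L.tmap s v'))) = _
    rw [h₃]
    rfl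

end SymplecticLeaf

end Leaf

section Lagrangian

variable {n : ℕ} {Z : Type u} [TopologicalSpace Z] [ChartedSpace (Model n) Z]
  [IsManifold (𝓡 n) ∞ Z] {P : PoissonStructure n Z} {k : ℕ} {S : Type v} [TopologicalSpace S]
  [ChartedSpace (Model k) S] [IsManifold (𝓡 k) ∞ S] {L : SymplecticLeaf P k S}
  {m : ℕ} {X : Type w} [TopologicalSpace X] [ChartedSpace (Model m) X] [IsManifold (𝓡 m) ∞ X]

namespace LagrangianSubmanifold

variable (Λ : LagrangianSubmanifold L m X)

theorem contMDiff_toZ : ContMDiff (𝓡 m) (𝓡 n) ∞ Λ.toZ :=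
  L.contMDiff_incl.comp Λ.incl.contMDiff

theorem tmap_injective (x : X) : Function.Injective (Λ.tmap x) :=
  mfderiv_injective_of_isImmersionAt (Λ.embedding.isImmersion.isImmersionAt x)

theorem mfderiv_toZ (x : X) (u : TangentSpace (𝓡 m) x) :
    mfderiv (𝓡 m) (𝓡 n) Λ.toZ x u = L.tmap (Λ.incl x) (Λ.tmap x u) :=
  congrArg (fun T => T u) (mfderiv_comp x (L.contMDiff_incl.mdifferentiable (by simp) _)
    (Λ.incl.contMDiff.mdifferentiable (by simp) x))

/-- The inclusion of `X` in the leaf has a smooth local left inverse, defined on `Z`. -/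
theorem exists_retraction (x : X) : ∃ ρ : Z → X,
    (∀ᶠ z in 𝓝 (Λ.toZ x), ContMDiffAt (𝓡 n) (𝓡 m) ∞ ρ z) ∧ ∀ᶠ y in 𝓝 x, ρ (Λ.toZ y) = y := by
  obtain ⟨ρ₁, h₁, h₁'⟩ := exists_local_retraction
    (L.embedding.isImmersion.isImmersionAt (Λ.incl x))
  obtain ⟨ρ₂, h₂, h₂'⟩ := exists_local_retraction (Λ.embedding.isImmersion.isImmersionAt x)
  have hc := h₁.self_of_nhds.continuousAt
  rw [ContinuousAt, h₁'.self_of_nhds] at hc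
  refine ⟨fun z => ρ₂ (ρ₁ z), ?_, ?_⟩
  · filter_upwards [h₁, hc.eventually h₂] with z hz hz' using hz'.comp z hz
  · filter_upwards [Λ.incl.contMDiff.continuous.continuousAt.eventually h₁', h₂'] with y hy hy'
    rw [toZ, hy, hy']

end LagrangianSubmanifold

end Lagrangian

/-! ### The Hessian at critical points and the transverse derivative -/

section Hessian

variable {n : ℕ} {Z : Type u} [TopologicalSpace Z] [ChartedSpace (Model n) Z]
  [IsManifold (𝓡 n) ∞ Z]

/-- The second derivative of `H` in the chart at `z₀`. -/
def hess (z₀ : Z) (H : Z → ℝ) (y : Model n) : Model n →L[ℝ] Model n →L[ℝ] ℝ :=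
  fderiv ℝ (fderiv ℝ (H ∘ (extChartAt (𝓡 n) z₀).symm)) y

variable {H : Z → ℝ} (hH : ContMDiff (𝓡 n) 𝓘(ℝ, ℝ) ∞ H) {z₀ z : Z}
  (hz : z ∈ (chartAt (Model n) z₀).source)

include hH hz

theorem contDiffAt_fderiv_chart :
    ContDiffAt ℝ ∞ (fderiv ℝ (H ∘ (extChartAt (𝓡 n) z₀).symm)) (extChartAt (𝓡 n) z₀ z) :=
  (contDiffAt_comp_extChartAt_symm hz (hH z)).fderiv_right (by simp)

theorem contDiffAt_hess : ContDiffAt ℝ ∞ (hess z₀ H) (extChartAt (𝓡 n) z₀ z) :=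
  (contDiffAt_fderiv_chart hH hz).fderiv_right (by simp)

theorem hess_symm (v w : Model n) :
    hess z₀ H (extChartAt (𝓡 n) z₀ z) v w = hess z₀ H (extChartAt (𝓡 n) z₀ z) w v :=
  (contDiffAt_comp_extChartAt_symm hz (hH z)).isSymmSndFDerivAt
    (by rw [minSmoothness_of_isRCLikeNormedField]; exact WithTop.coe_le_coe.2 (le_top : (2 : ℕ∞) ≤ ⊤))
    v w

theorem hat_diff_eventuallyEq : (fun q => hat z₀ (diff n H q)) =ᶠ[𝓝 z]
    fun q => fderiv ℝ (H ∘ (extChartAt (𝓡 n) z₀).symm) (extChartAt (𝓡 n) z₀ q) := by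
  filter_upwards [(chartAt (Model n) z₀).open_source.mem_nhds hz] with q hq
  exact hat_diff hq (hH.mdifferentiable (by simp) q)

omit hH in
theorem contMDiffAt_dSection (hH : ContMDiff (𝓡 n) 𝓘(ℝ, ℝ) ∞ H) :
    ContMDiffAt (𝓡 n) (cotModel n) ∞ (LagrangianSubmanifold.dSection (n := n) H) z :=
  (contMDiffAt_cot_iff z₀ hz).2 ⟨contMDiffAt_id, (contMDiffAt_of_contDiffAt_chart hz
    (contDiffAt_fderiv_chart hH hz)).congr_of_eventuallyEq (hat_diff_eventuallyEq hH hz)⟩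

/-- The derivative of `dH` in coordinates is the Hessian. -/
theorem mfderiv_hat_diff (v : TangentSpace (𝓡 n) z) :
    (mfderiv (𝓡 n) 𝓘(ℝ, Model n →L[ℝ] ℝ) (fun q => hat z₀ (diff n H q)) z v : Model n →L[ℝ] ℝ) =
      hess z₀ H (extChartAt (𝓡 n) z₀ z) (co z₀ z v) := by
  have h₁ := contDiffAt_fderiv_chart hH hz
  have h₂ := (contMDiffAt_of_contDiffAt_chart hz h₁).congr_of_eventuallyEq
    (hat_diff_eventuallyEq hH hz)
  have h₃ := mfderiv_eq_fderiv_co hz (h₂.mdifferentiableAt (by simp)) v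
  refine h₃.trans (congrArg
    (fun T : Model n →L[ℝ] Model n →L[ℝ] ℝ => T (co z₀ z v)) (Filter.EventuallyEq.fderiv_eq ?_))
  filter_upwards [extChartAt_target_mem_nhds_of_mem (extChartAt_mem_target hz)] with y hy
  have h := hat_diff (extChartAt_symm_mem hy) (hH.mdifferentiable (by simp) _)
  rwa [(extChartAt (𝓡 n) z₀).right_inv hy] at h

/-- At a critical point, the Hessian does not depend on the chart: on vector fields it is the second
derivative `v · (W · H)`. -/
theorem hess_eq_dirDeriv (hd : diff n H z = 0) (U : ∀ z : Z, TangentSpace (𝓡 n) z) (W : VField n Z) :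
    hess z₀ H (extChartAt (𝓡 n) z₀ z) (co z₀ z (U z)) (co z₀ z (W.val z)) =
      dirDeriv U (fun q => diff n H q (W.val q)) z := by
  have h₁ : ContDiffAt ℝ ∞ (fhat z₀ (diff n H)) (extChartAt (𝓡 n) z₀ z) :=
    contDiffAt_fhat hz (contMDiffAt_dSection hz hH)
  have h₂ : fhat z₀ (diff n H) =ᶠ[𝓝 (extChartAt (𝓡 n) z₀ z)]
      fderiv ℝ (H ∘ (extChartAt (𝓡 n) z₀).symm) := by
    filter_upwards [extChartAt_target_mem_nhds_of_mem (extChartAt_mem_target hz)] with y hy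
    have h := hat_diff (extChartAt_symm_mem hy) (hH.mdifferentiable (by simp) _)
    rwa [(extChartAt (𝓡 n) z₀).right_inv hy] at h
  rw [dirDeriv_pairing hz h₁ (contDiffAt_vhat hz (W.smooth z)), hd, h₂.fderiv_eq, hat_zero,
    zero_apply, add_zero]
  rfl

theorem hess_chart [T2Space Z] {z₁ : Z} (hz₁ : z ∈ (chartAt (Model n) z₁).source)
    (hd : diff n H z = 0) (v w : TangentSpace (𝓡 n) z) :
    hess z₀ H (extChartAt (𝓡 n) z₀ z) (co z₀ z v) (co z₀ z w) =
      hess z₁ H (extChartAt (𝓡 n) z₁ z) (co z₁ z v) (co z₁ z w) := by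
  obtain ⟨U, rfl⟩ := exists_vField_eq v
  obtain ⟨W, rfl⟩ := exists_vField_eq w
  rw [hess_eq_dirDeriv hH hz hd U.val W, hess_eq_dirDeriv hH hz₁ hd U.val W]

end Hessian

/-- In the splitting of `T(T*Z)` by the chart, vertical vectors have no horizontal component. -/
theorem LagrangianSubmanifold.vertical_eq {n : ℕ} {Z : Type u} [TopologicalSpace Z]
    [ChartedSpace (Model n) Z] [IsManifold (𝓡 n) ∞ Z] (z : Z) (α β : Cot n z) :
    (LagrangianSubmanifold.vertical z α β : Model n × (Model n →L[ℝ] ℝ)) =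
      ((0 : Model n), (β : Model n →L[ℝ] ℝ)) := by
  have h₁ : HasDerivAt (fun t : ℝ => hat z (α + t • β)) (hat z β) 0 := by
    have h := ((hasDerivAt_id (0 : ℝ)).smul_const (hat z β)).const_add (hat z α)
    rw [one_smul] at h
    exact h
  have h₂ : ContMDiffAt 𝓘(ℝ, ℝ) (cotModel n) ∞ (fun t : ℝ => cot n z (α + t • β)) 0 := by
    refine (contMDiffAt_cot_iff z (mem_chart_source _ z)).2 ⟨contMDiffAt_const, ?_⟩
    have : ContDiff ℝ ∞ (fun t : ℝ => hat z α + t • hat z β) := by fun_prop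
    exact this.contMDiff.contMDiffAt
  have h := mfderiv_cot (h₂.mdifferentiableAt (by simp)) (1 : ℝ)
  refine h.trans (Prod.ext ?_ ?_)
  · exact congrArg (fun T => T (1 : ℝ)) (mfderiv_const (c := z) (x := (0 : ℝ)) (I := 𝓘(ℝ, ℝ))
      (I' := 𝓡 n))
  · refine (congrArg (fun T => T (1 : ℝ)) h₁.hasFDerivAt.hasMFDerivAt.mfderiv).trans ?_
    exact (one_smul ℝ (hat z β)).trans (hat_self z β)

section Transverse

variable {n : ℕ} {Z : Type u} [TopologicalSpace Z] [T2Space Z] [ChartedSpace (Model n) Z]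
  [IsManifold (𝓡 n) ∞ Z] {P : PoissonStructure n Z} {k : ℕ} {S : Type v} [TopologicalSpace S]
  [ChartedSpace (Model k) S] [IsManifold (𝓡 k) ∞ S] {L : SymplecticLeaf P k S}
  {m : ℕ} {X : Type w} [TopologicalSpace X] [ChartedSpace (Model m) X] [IsManifold (𝓡 m) ∞ X]

namespace LagrangianSubmanifold

variable (Λ : LagrangianSubmanifold L m X) {H : Z → ℝ} (hH : ContMDiff (𝓡 n) 𝓘(ℝ, ℝ) ∞ H)
  (hcrit : ∀ x : X, diff n H (Λ.toZ x) = 0)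

/-- The covector `D²H(v, ·)` at a point of `X`, computed in the chart at this point. Any other chart
gives the same covector if `dH` vanishes there, see `hat_hessCov`. -/
def hessCov (H : Z → ℝ) (x : X) (v : TangentSpace (𝓡 k) (Λ.incl x)) : Cot n (Λ.toZ x) :=
  (((hess (Λ.toZ x) H (extChartAt (𝓡 n) (Λ.toZ x) (Λ.toZ x))).comp
    ((co (Λ.toZ x) (Λ.toZ x)).comp (L.tmap (Λ.incl x)))) v).comp (co (Λ.toZ x) (Λ.toZ x))

include hH hcrit in
theorem hat_hessCov {z₀ : Z} {x : X} (hz : Λ.toZ x ∈ (chartAt (Model n) z₀).source)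
    (v : TangentSpace (𝓡 k) (Λ.incl x)) :
    hat z₀ (Λ.hessCov H x v) =
      hess z₀ H (extChartAt (𝓡 n) z₀ (Λ.toZ x)) (co z₀ (Λ.toZ x) (L.tmap (Λ.incl x) v)) := by
  ext w
  have h := hess_chart hH hz (mem_chart_source (Model n) (Λ.toZ x)) (hcrit x)
    (L.tmap (Λ.incl x) v) (fr z₀ (Λ.toZ x) w)
  rw [co_fr hz] at h
  exact h.symm

omit [T2Space Z] in
include hH in
theorem hessCov_symm (x : X) (v w : TangentSpace (𝓡 k) (Λ.incl x)) :
    Λ.hessCov H x v (L.tmap (Λ.incl x) w) = Λ.hessCov H x w (L.tmap (Λ.incl x) v) :=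
  hess_symm hH (mem_chart_source (Model n) (Λ.toZ x)) _ _

omit [T2Space Z] in
include hH hcrit in
/-- Since `dH` vanishes along `X`, so does its derivative in the directions of `TX`. -/
theorem hessCov_tmap (x : X) (u : TangentSpace (𝓡 m) x) : Λ.hessCov H x (Λ.tmap x u) = 0 := by
  set z := Λ.toZ x with hz
  have hm := mem_chart_source (Model n) z
  have h₁ : MDifferentiableAt (𝓡 n) 𝓘(ℝ, Model n →L[ℝ] ℝ) (fun q => hat z (diff n H q)) z :=
    ((contMDiffAt_of_contDiffAt_chart hm (contDiffAt_fderiv_chart hH hm)).congr_of_eventuallyEq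
      (hat_diff_eventuallyEq hH hm)).mdifferentiableAt (by simp)
  have h₂ := mfderiv_comp x h₁ (Λ.contMDiff_toZ.mdifferentiable (by simp) x)
  have h₃ : (fun q => hat z (diff n H q)) ∘ Λ.toZ = fun _ => 0 := by
    funext y
    rw [Function.comp_apply, hcrit y, hat_zero]
  rw [h₃, mfderiv_const] at h₂
  have h₄ := mfderiv_hat_diff hH hm (mfderiv (𝓡 m) (𝓡 n) Λ.toZ x u)
  rw [Λ.mfderiv_toZ] at h₄
  have h₅ : hess z H (extChartAt (𝓡 n) z z) (co z z (L.tmap (Λ.incl x) (Λ.tmap x u))) = 0 := by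
    rw [← h₄, ← Λ.mfderiv_toZ]
    exact (congrArg (fun T => T u) h₂).symm
  ext w
  exact congrArg (fun T : Model n →L[ℝ] ℝ => T (co z z w)) h₅

omit [T2Space Z] in
theorem hessCov_add (x : X) (v w : TangentSpace (𝓡 k) (Λ.incl x)) :
    Λ.hessCov H x (v + w) = Λ.hessCov H x v + Λ.hessCov H x w := by
  rw [hessCov, map_add]
  rfl

omit [T2Space Z] in
theorem hessCov_smul (x : X) (c : ℝ) (v : TangentSpace (𝓡 k) (Λ.incl x)) :
    Λ.hessCov H x (c • v) = c • Λ.hessCov H x v := by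
  rw [hessCov, map_smul]
  rfl

/-- The transverse part `t^V H` of `T(dH)`: the map `[v] ↦ D²H(v, ·)`. -/
def transverse (x : X) : Λ.Normal x →ₗ[ℝ] Λ.EX x :=
  (Λ.tangent x).liftQ
    { toFun := fun v => ⟨Λ.hessCov H x v, fun u => by
        rw [Λ.hessCov_symm hH, Λ.hessCov_tmap hH hcrit]
        rfl⟩
      map_add' := fun v w => Subtype.ext (Λ.hessCov_add x v w)
      map_smul' := fun c v => Subtype.ext (Λ.hessCov_smul x c v) }
    (by
      rintro _ ⟨u, rfl⟩
      exact Subtype.ext (Λ.hessCov_tmap hH hcrit x u))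

omit [T2Space Z] in
theorem transverse_mk (x : X) (v : TangentSpace (𝓡 k) (Λ.incl x)) :
    (Λ.transverse hH hcrit x (Submodule.Quotient.mk v) : Cot n (Λ.toZ x)) = Λ.hessCov H x v := rfl

theorem isTransverseDerivative_transverse :
    Λ.IsTransverseDerivative H (Λ.transverse hH hcrit) := by
  intro x v
  set z := Λ.toZ x with hz
  have hm := mem_chart_source (Model n) z
  have h₀ : ContMDiffAt (𝓡 n) (cotModel n) ∞ (fun z : Z => cot n z 0) z :=
    (contMDiffAt_cot_iff z hm).2 ⟨contMDiffAt_id, contMDiffAt_const (c := 0)⟩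
  have h₁ := mfderiv_cot ((contMDiffAt_dSection hm hH).mdifferentiableAt (by simp))
    (L.tmap (Λ.incl x) v)
  have h₂ := mfderiv_cot (h₀.mdifferentiableAt (by simp)) (L.tmap (Λ.incl x) v)
  have h₃ := vertical_eq z 0 (Λ.transverse hH hcrit x (Submodule.Quotient.mk v) : Cot n z)
  refine h₁.trans ((Prod.ext ?_ ?_).trans (congrArg₂ (· + ·) h₂ h₃).symm)
  · exact (add_zero _).symm
  · refine (mfderiv_hat_diff hH hm (L.tmap (Λ.incl x) v)).trans ?_
    have h₄ : (mfderiv (𝓡 n) 𝓘(ℝ, Model n →L[ℝ] ℝ) (fun q : Z => hat z (0 : Cot n q)) z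
        (L.tmap (Λ.incl x) v) : Model n →L[ℝ] ℝ) = 0 := by
      have h : HasMFDerivAt (𝓡 n) 𝓘(ℝ, Model n →L[ℝ] ℝ) (fun q : Z => hat z (0 : Cot n q)) z 0 :=
        hasMFDerivAt_const (0 : Model n →L[ℝ] ℝ) z
      rw [h.mfderiv]
      rfl
    let b : Model n →L[ℝ] ℝ := Λ.hessCov H x v
    have h₅ : hess z H (extChartAt (𝓡 n) z z) (co z z (L.tmap (Λ.incl x) v)) = b :=
      (Λ.hat_hessCov hH hcrit hm v).symm.trans (hat_self z _)
    exact h₅.trans ((zero_add b).symm.trans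
      (congrArg (fun T : Model n →L[ℝ] ℝ => T + b) h₄.symm))

omit [T2Space Z] in
theorem transverse_unique {t t' : ∀ x : X, Λ.Normal x →ₗ[ℝ] Λ.EX x}
    (h : Λ.IsTransverseDerivative H t) (h' : Λ.IsTransverseDerivative H t') : t' = t := by
  funext x
  refine LinearMap.ext fun ν => ?_
  obtain ⟨v, rfl⟩ := Submodule.Quotient.mk_surjective _ ν
  have h₁ := add_left_cancel (G := Model n × (Model n →L[ℝ] ℝ)) ((h' x v).symm.trans (h x v))
  rw [vertical_eq, vertical_eq] at h₁
  exact Subtype.ext (congrArg Prod.snd h₁)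

theorem isBundleMorphism_transverse : Λ.IsBundleMorphism (Λ.transverse hH hcrit) := by
  intro p₀
  have hs₀ := mem_chart_source (Model k) (Λ.incl p₀.1)
  have hm := mem_chart_source (Model n) (Λ.toZ p₀.1)
  have hπ : ContMDiffAt ((𝓡 m).prod 𝓘(ℝ, Model k)) (𝓡 m) ∞
      (fun p : Bundle.TotalSpace (Model k) (Λ.incl *ᵖ (TangentSpace (𝓡 k) : S → Type)) => p.1) p₀ :=
    (Bundle.contMDiff_proj _).contMDiffAt
  have hbase := Λ.contMDiff_toZ.contMDiffAt.comp p₀ hπ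
  refine (contMDiffAt_cot_iff (Λ.toZ p₀.1) hm).2 ⟨hbase, ?_⟩
  have hev := hπ.continuousAt.eventually
    (Λ.incl.contMDiff.continuous.continuousAt.eventually (L.eventually_mem_charts (Λ.incl p₀.1)))
  have hco : ContMDiffAt ((𝓡 m).prod 𝓘(ℝ, Model k)) 𝓘(ℝ, Model k) ∞
      (fun p : Bundle.TotalSpace (Model k) (Λ.incl *ᵖ (TangentSpace (𝓡 k) : S → Type)) =>
        co (Λ.incl p₀.1) (Λ.incl p.1) p.2) p₀ := by
    have h := ((Bundle.contMDiffAt_totalSpace (IB := 𝓡 m) (n := ∞)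
      (F := Model k) (E := Λ.incl *ᵖ (TangentSpace (𝓡 k) : S → Type)) (f := fun p => p)
      (x₀ := p₀)).1 contMDiffAt_id).2
    refine h.congr_of_eventuallyEq ?_
    filter_upwards [hev] with p hp
    rw [co, Trivialization.continuousLinearMapAt_apply, Trivialization.coe_linearMapAt_of_mem]
    · rfl
    · rw [TangentBundle.trivializationAt_baseSet]
      exact hp.1
  have h₁ : ContMDiffAt ((𝓡 m).prod 𝓘(ℝ, Model k)) 𝓘(ℝ, Model n →L[ℝ] ℝ) ∞
      (fun p : Bundle.TotalSpace (Model k) (Λ.incl *ᵖ (TangentSpace (𝓡 k) : S → Type)) =>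
        hess (Λ.toZ p₀.1) H (extChartAt (𝓡 n) (Λ.toZ p₀.1) (Λ.toZ p.1))
          (fderiv ℝ (L.jmap (Λ.incl p₀.1)) (extChartAt (𝓡 k) (Λ.incl p₀.1) (Λ.incl p.1))
            (co (Λ.incl p₀.1) (Λ.incl p.1) p.2))) p₀ := by
    have hA := contMDiffAt_of_contDiffAt_chart hm (contDiffAt_hess hH hm)
    have hB := contMDiffAt_of_contDiffAt_chart hs₀ ((L.contDiffAt_jmap hs₀ hm).fderiv_right
      (m := ∞) (by simp))
    exact (hA.comp p₀ hbase).clm_apply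
      ((hB.comp p₀ (Λ.incl.contMDiff.contMDiffAt.comp p₀ hπ)).clm_apply hco)
  refine h₁.congr_of_eventuallyEq ?_
  filter_upwards [hev] with p hp
  exact (Λ.hat_hessCov hH hcrit hp.2 p.2).trans (congrArg _ (L.co_tmap hp.1 hp.2 p.2))

end LagrangianSubmanifold

end Transverse

/-! ### The metric and the connection form -/

section Metric

variable {n : ℕ} {Z : Type u} [TopologicalSpace Z] [T2Space Z] [ChartedSpace (Model n) Z]
  [IsManifold (𝓡 n) ∞ Z] {P : PoissonStructure n Z} {k : ℕ} {S : Type v} [TopologicalSpace S]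
  [ChartedSpace (Model k) S] [IsManifold (𝓡 k) ∞ S] {L : SymplecticLeaf P k S}
  {m : ℕ} {X : Type w} [TopologicalSpace X] [ChartedSpace (Model m) X] [IsManifold (𝓡 m) ∞ X]

namespace LagrangianSubmanifold

variable (Λ : LagrangianSubmanifold L m X)

/-- The inclusion `X → S` in the charts at `x₀` and at its image. -/
def kmap (x₀ : X) : Model m → Model k := coordMap Λ.incl x₀ (Λ.incl x₀)

omit [T2Space Z] in
theorem co_tmap {x₀ x : X} (hx : x ∈ (chartAt (Model m) x₀).source)
    (hs : Λ.incl x ∈ (chartAt (Model k) (Λ.incl x₀)).source) (u : TangentSpace (𝓡 m) x) :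
    co (Λ.incl x₀) (Λ.incl x) (Λ.tmap x u) =
      fderiv ℝ (Λ.kmap x₀) (extChartAt (𝓡 m) x₀ x) (co x₀ x u) :=
  co_mfderiv_eq hx hs Λ.incl.contMDiff.contMDiffAt u

omit [T2Space Z] in
theorem contDiffAt_fderiv_kmap (x₀ : X) :
    ContDiffAt ℝ ∞ (fderiv ℝ (Λ.kmap x₀)) (extChartAt (𝓡 m) x₀ x₀) :=
  (contDiffAt_coordMap (mem_chart_source _ x₀) (mem_chart_source _ _)
    Λ.incl.contMDiff.contMDiffAt).fderiv_right (by simp)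

omit [T2Space Z] in
theorem eventually_mem_charts (x₀ : X) : ∀ᶠ x in 𝓝 x₀, x ∈ (chartAt (Model m) x₀).source ∧
    Λ.incl x ∈ (chartAt (Model k) (Λ.incl x₀)).source ∧
    Λ.toZ x ∈ (chartAt (Model n) (Λ.toZ x₀)).source :=
  Eventually.and (chart_source_mem_nhds (Model m) x₀)
    (Λ.incl.contMDiff.continuous.continuousAt.eventually (L.eventually_mem_charts (Λ.incl x₀)))

omit [T2Space Z] in
theorem negOmegaX_injective (x : X) : Function.Injective (Λ.negOmegaX x) := by
  rw [injective_iff_map_eq_zero]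
  intro u hu
  have h : Λ.tmap x u = 0 := L.omegaFlat_eq_zero _ fun w => by
    have := congrArg (fun β : Λ.annS x => (β : Cot k (Λ.incl x)) w) hu
    exact neg_eq_zero.1 this
  exact Λ.tmap_injective x (h.trans (map_zero _).symm)

variable {H : Z → ℝ} (hH : ContMDiff (𝓡 n) 𝓘(ℝ, ℝ) ∞ H) (hcrit : ∀ x : X, diff n H (Λ.toZ x) = 0)
  (hinv : ∀ x : X, Function.Bijective (Λ.compose (Λ.transverse hH hcrit) x))

/-- The normal vector `t₀⁻¹(-ω_X u)`. -/
def normalVec (x : X) (u : TangentSpace (𝓡 m) x) : Λ.Normal x :=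
  (LinearEquiv.ofBijective _ (hinv x)).symm (Λ.negOmegaX x u)

omit [T2Space Z] in
theorem compose_normalVec (x : X) (u : TangentSpace (𝓡 m) x) :
    Λ.compose (Λ.transverse hH hcrit) x (Λ.normalVec hH hcrit hinv x u) = Λ.negOmegaX x u :=
  (LinearEquiv.ofBijective _ (hinv x)).apply_symm_apply _

omit [T2Space Z] in
/-- The normal vector of `u` is the solution `[v]` of `D²H(v, ·) = -ω(u, ·)` on `TS`. -/
theorem hessCov_apply_of_mk_eq {x : X} {u : TangentSpace (𝓡 m) x}
    {v : TangentSpace (𝓡 k) (Λ.incl x)}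
    (hv : Submodule.Quotient.mk v = Λ.normalVec hH hcrit hinv x u)
    (w : TangentSpace (𝓡 k) (Λ.incl x)) :
    Λ.hessCov H x v (L.tmap (Λ.incl x) w) = - L.omegaFlat (Λ.incl x) (Λ.tmap x u) w := by
  have h := Λ.compose_normalVec hH hcrit hinv x u
  rw [← hv] at h
  exact congrArg (fun β : Λ.annS x => (β : Cot k (Λ.incl x)) w) h

omit [T2Space Z] in
theorem gammaFlat_of_mk_eq {x : X} {u : TangentSpace (𝓡 m) x} {v : TangentSpace (𝓡 k) (Λ.incl x)}
    (hv : Submodule.Quotient.mk v = Λ.normalVec hH hcrit hinv x u) (u' : TangentSpace (𝓡 m) x) :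
    Λ.gammaFlat (Λ.transverse hH hcrit) hinv x u u' =
      - L.omegaFlat (Λ.incl x) (Λ.tmap x u') v := by
  change Λ.negOmegaXDual x (Λ.normalVec hH hcrit hinv x u) u' = _
  rw [← hv]
  rfl

omit [T2Space Z] in
/-- The symmetry of `γ` is that of the Hessian: if `v`, `v'` represent the normal vectors of `u`, `u'`,
then `γ(u, u') = D²H(v', v)`. -/
theorem gammaFlat_symm (x : X) (u u' : TangentSpace (𝓡 m) x) :
    Λ.gammaFlat (Λ.transverse hH hcrit) hinv x u u' =
      Λ.gammaFlat (Λ.transverse hH hcrit) hinv x u' u := by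
  obtain ⟨v, hv⟩ := Submodule.Quotient.mk_surjective _ (Λ.normalVec hH hcrit hinv x u)
  obtain ⟨v', hv'⟩ := Submodule.Quotient.mk_surjective _ (Λ.normalVec hH hcrit hinv x u')
  rw [Λ.gammaFlat_of_mk_eq hH hcrit hinv hv, Λ.gammaFlat_of_mk_eq hH hcrit hinv hv',
    ← Λ.hessCov_apply_of_mk_eq hH hcrit hinv hv, ← Λ.hessCov_apply_of_mk_eq hH hcrit hinv hv',
    Λ.hessCov_symm hH]

omit [T2Space Z] in
/-- The metric is nondegenerate since `X` is Lagrangian: a vector that is `ω`-orthogonal to `TX` is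
zero in the normal bundle. -/
theorem gammaFlat_nondegenerate (x : X) (u : TangentSpace (𝓡 m) x)
    (h : ∀ u', Λ.gammaFlat (Λ.transverse hH hcrit) hinv x u u' = 0) : u = 0 := by
  obtain ⟨v, hv⟩ := Submodule.Quotient.mk_surjective _ (Λ.normalVec hH hcrit hinv x u)
  have h₁ : v ∈ Λ.tangent x := (Λ.lagrangian x v).2 fun u' => by
    have h₂ := h u'
    rw [Λ.gammaFlat_of_mk_eq hH hcrit hinv hv, ← L.omegaFlat_skew] at h₂
    exact h₂
  have h₃ : Λ.normalVec hH hcrit hinv x u = 0 := by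
    rw [← hv]
    exact (Submodule.Quotient.mk_eq_zero _).2 h₁
  refine Λ.negOmegaX_injective x ?_
  rw [← Λ.compose_normalVec hH hcrit hinv, h₃, map_zero, map_zero]

omit [T2Space Z] in
/-- If `ϖ♯ β = u`, then `D²H(v, ·) + β` vanishes on `TS` for a representative `v` of the normal vector
of `u`, and so lies in the kernel of `ϖ♯`. -/
theorem alphaFlat_split (x : X) (u : TangentSpace (𝓡 m) x) :
    - P.sharp (Λ.toZ x) (Λ.alphaFlat (Λ.transverse hH hcrit) hinv x u) =
      L.tmap (Λ.incl x) (Λ.tmap x u) := by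
  obtain ⟨v, hv⟩ := Submodule.Quotient.mk_surjective _ (Λ.normalVec hH hcrit hinv x u)
  have hα : (Λ.alphaFlat (Λ.transverse hH hcrit) hinv x u : Cot n (Λ.toZ x)) =
      Λ.hessCov H x v := by
    change ((Λ.transverse hH hcrit x (Λ.normalVec hH hcrit hinv x u) : Λ.EX x) :
      Cot n (Λ.toZ x)) = _
    rw [← hv]
    rfl
  obtain ⟨β, hβ⟩ := L.exists_sharp (Λ.incl x) (Λ.tmap x u)
  let b : Cot n (L.incl (Λ.incl x)) := Λ.hessCov H x v
  have h₁ : b + β ∈ L.isotropy (Λ.incl x) := fun w => by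
    have h₂ := Λ.hessCov_apply_of_mk_eq hH hcrit hinv hv w
    rw [L.omegaFlat_apply _ _ _ β hβ] at h₂
    exact (congrArg (· + β (L.tmap (Λ.incl x) w)) h₂).trans (neg_add_cancel _)
  have h₃ := L.mem_isotropy_iff.1 h₁
  rw [map_add, hβ] at h₃
  rw [hα]
  exact neg_eq_of_add_eq_zero_right h₃

/-- The class `t₀⁻¹(-ω_X u)` has a representative that depends smoothly on `u`: the one which, in
coordinates, is orthogonal to `TX`. -/
theorem exists_smooth_representative (p₀ : TangentBundle (𝓡 m) X) :
    ∃ a : TangentBundle (𝓡 m) X → Model k,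
      ContMDiffAt (𝓡 m).tangent 𝓘(ℝ, Model k) ∞ a p₀ ∧
      ∀ᶠ p in 𝓝 p₀, Submodule.Quotient.mk (fr (Λ.incl p₀.1) (Λ.incl p.1) (a p)) =
        Λ.normalVec hH hcrit hinv p.1 p.2 := by
  set x₀ := p₀.1 with hx₀
  have hx := mem_chart_source (Model m) x₀
  have hs := mem_chart_source (Model k) (Λ.incl x₀)
  have hm := mem_chart_source (Model n) (Λ.toZ x₀)
  have hπ : ContMDiffAt (𝓡 m).tangent (𝓡 m) ∞ (fun p : TangentBundle (𝓡 m) X => p.1) p₀ :=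
    (Bundle.contMDiff_proj _).contMDiffAt
  have hev := hπ.continuousAt.eventually (Λ.eventually_mem_charts x₀)
  have hbase := Λ.contMDiff_toZ.contMDiffAt.comp p₀ hπ
  have hbaseS := Λ.incl.contMDiff.contMDiffAt.comp p₀ hπ
  have hco : ContMDiffAt (𝓡 m).tangent 𝓘(ℝ, Model m) ∞
      (fun p : TangentBundle (𝓡 m) X => co x₀ p.1 p.2) p₀ :=
    ((contMDiffAt_tangent_iff x₀ hx).1 contMDiffAt_id).2
  -- the coordinate expressions of `TX → TS` and `TS → TZ`
  let κ : X → Model m →L[ℝ] Model k := fun x => fderiv ℝ (Λ.kmap x₀) (extChartAt (𝓡 m) x₀ x)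
  let ι : X → Model k →L[ℝ] Model n := fun x =>
    fderiv ℝ (L.jmap (Λ.incl x₀)) (extChartAt (𝓡 k) (Λ.incl x₀) (Λ.incl x))
  have hκx := contMDiffAt_of_contDiffAt_chart hx (Λ.contDiffAt_fderiv_kmap x₀)
  have hκ : ContMDiffAt (𝓡 m).tangent 𝓘(ℝ, Model m →L[ℝ] Model k) ∞
      (fun p : TangentBundle (𝓡 m) X => κ p.1) p₀ :=
    ContMDiffAt.comp (g := κ) p₀ hκx hπ
  have hιx := contMDiffAt_of_contDiffAt_chart hs ((L.contDiffAt_jmap hs hm).fderiv_right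
    (m := ∞) (by simp))
  have hι : ContMDiffAt (𝓡 m).tangent 𝓘(ℝ, Model k →L[ℝ] Model n) ∞
      (fun p : TangentBundle (𝓡 m) X => ι p.1) p₀ :=
    ContMDiffAt.comp (g := fun s => fderiv ℝ (L.jmap (Λ.incl x₀)) (extChartAt (𝓡 k) (Λ.incl x₀) s))
      p₀ hιx hbaseS
  have hhx := contMDiffAt_of_contDiffAt_chart hm (contDiffAt_hess hH hm)
  have hhess : ContMDiffAt (𝓡 m).tangent 𝓘(ℝ, Model n →L[ℝ] Model n →L[ℝ] ℝ) ∞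
      (fun p : TangentBundle (𝓡 m) X => hess (Λ.toZ x₀) H
        (extChartAt (𝓡 n) (Λ.toZ x₀) (Λ.toZ p.1))) p₀ :=
    ContMDiffAt.comp (g := fun z => hess (Λ.toZ x₀) H (extChartAt (𝓡 n) (Λ.toZ x₀) z)) p₀ hhx hbase
  obtain ⟨om, hom, hom'⟩ := L.exists_coord_omegaFlat (Λ.incl x₀)
  have homx := contMDiffAt_of_contDiffAt_chart hs hom
  have homp : ContMDiffAt (𝓡 m).tangent 𝓘(ℝ, Model k →L[ℝ] Model k →L[ℝ] ℝ) ∞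
      (fun p : TangentBundle (𝓡 m) X => om (extChartAt (𝓡 k) (Λ.incl x₀) (Λ.incl p.1))) p₀ :=
    ContMDiffAt.comp (g := fun s => om (extChartAt (𝓡 k) (Λ.incl x₀) s)) p₀ homx hbaseS
  have hevω : ∀ᶠ p in 𝓝 p₀, ∀ v v' : TangentSpace (𝓡 k) (Λ.incl p.1), L.omegaFlat (Λ.incl p.1) v v' =
      om (extChartAt (𝓡 k) (Λ.incl x₀) (Λ.incl p.1)) (co (Λ.incl x₀) (Λ.incl p.1) v)
        (co (Λ.incl x₀) (Λ.incl p.1) v') := hbaseS.continuousAt.eventually hom'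
  -- the linear system for the representative: `D²H(v, ·) = -ω(u, ·)` on `TS`, and `v ⊥ TX`
  let J : Model k →L[ℝ] Model k →L[ℝ] ℝ := innerSL ℝ
  let C : TangentBundle (𝓡 m) X → Model k →L[ℝ] (Model k →L[ℝ] ℝ) × (Model m →L[ℝ] ℝ) := fun p =>
    (ContinuousLinearMap.inl ℝ (Model k →L[ℝ] ℝ) (Model m →L[ℝ] ℝ)).comp
      (((ContinuousLinearMap.compL ℝ (Model k) (Model n) ℝ).flip (ι p.1)).comp
        ((hess (Λ.toZ x₀) H (extChartAt (𝓡 n) (Λ.toZ x₀) (Λ.toZ p.1))).comp (ι p.1)))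
    + (ContinuousLinearMap.inr ℝ (Model k →L[ℝ] ℝ) (Model m →L[ℝ] ℝ)).comp
      (((ContinuousLinearMap.compL ℝ (Model m) (Model k) ℝ).flip (κ p.1)).comp J)
  have hC : ContMDiffAt (𝓡 m).tangent
      𝓘(ℝ, Model k →L[ℝ] (Model k →L[ℝ] ℝ) × (Model m →L[ℝ] ℝ)) ∞ C p₀ := by
    refine ContMDiffAt.add (contMDiffAt_const.clm_comp (ContMDiffAt.clm_comp
      (contMDiffAt_const.clm_apply hι) (hhess.clm_comp hι)))
      (contMDiffAt_const.clm_comp (ContMDiffAt.clm_comp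
        (contMDiffAt_const.clm_apply hκ) contMDiffAt_const))
  have hCapply : ∀ p v, C p v = ((hess (Λ.toZ x₀) H (extChartAt (𝓡 n) (Λ.toZ x₀) (Λ.toZ p.1))
      (ι p.1 v)).comp (ι p.1), (J v).comp (κ p.1)) := fun p v =>
    Prod.ext (add_zero _) (zero_add _)
  -- the first component of the system, intrinsically
  have hfst : ∀ x, x ∈ (chartAt (Model m) x₀).source ∧
      Λ.incl x ∈ (chartAt (Model k) (Λ.incl x₀)).source ∧
      Λ.toZ x ∈ (chartAt (Model n) (Λ.toZ x₀)).source → ∀ v w : TangentSpace (𝓡 k) (Λ.incl x),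
      hess (Λ.toZ x₀) H (extChartAt (𝓡 n) (Λ.toZ x₀) (Λ.toZ x))
        (ι x (co (Λ.incl x₀) (Λ.incl x) v)) (ι x (co (Λ.incl x₀) (Λ.incl x) w)) =
      Λ.hessCov H x v (L.tmap (Λ.incl x) w) := by
    intro x hx v w
    have h₁ := congrArg (fun T => T (co (Λ.toZ x₀) (Λ.toZ x) (L.tmap (Λ.incl x) w)))
      (Λ.hat_hessCov hH hcrit hx.2.2 v)
    have h₂ := L.co_tmap hx.2.1 hx.2.2
    refine Eq.trans ?_ (h₁.symm.trans (hat_co hx.2.2 _ _))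
    exact congrArg₂ (fun a b => hess (Λ.toZ x₀) H (extChartAt (𝓡 n) (Λ.toZ x₀) (Λ.toZ x)) a b)
      (h₂ v).symm (h₂ w).symm
  -- the orthogonal representative
  have hrep : ∀ p : TangentBundle (𝓡 m) X, p.1 ∈ (chartAt (Model m) x₀).source ∧
      Λ.incl p.1 ∈ (chartAt (Model k) (Λ.incl x₀)).source ∧
      Λ.toZ p.1 ∈ (chartAt (Model n) (Λ.toZ x₀)).source →
      ∃ a : Model k, Submodule.Quotient.mk (fr (Λ.incl x₀) (Λ.incl p.1) a) =
        Λ.normalVec hH hcrit hinv p.1 p.2 ∧ (J a).comp (κ p.1) = 0 := by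
    intro p hp
    obtain ⟨v, hv⟩ := Submodule.Quotient.mk_surjective _ (Λ.normalVec hH hcrit hinv p.1 p.2)
    obtain ⟨y, hy, q, hq, hvq⟩ := (LinearMap.range (κ p.1).toLinearMap).exists_add_mem_mem_orthogonal
      (co (Λ.incl x₀) (Λ.incl p.1) v)
    obtain ⟨u, rfl⟩ := hy
    refine ⟨q, ?_, ?_⟩
    · rw [← hv]
      refine (Submodule.Quotient.eq _).2 ?_
      refine ⟨- fr x₀ p.1 u, ?_⟩
      have h₁ := Λ.co_tmap hp.1 hp.2.1 (fr x₀ p.1 u)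
      rw [co_fr hp.1] at h₁
      have h₂ : q = co (Λ.incl x₀) (Λ.incl p.1) (v - Λ.tmap p.1 (fr x₀ p.1 u)) := by
        rw [map_sub, h₁]
        exact eq_sub_of_add_eq' hvq.symm
      rw [h₂, fr_co hp.2.1]
      change Λ.tmap p.1 _ = _
      rw [map_neg]
      abel
    · ext u'
      exact (real_inner_comm _ _).trans (hq _ ⟨u', rfl⟩)
  choose! a ha ha' using hrep
  refine ⟨a, ?_, hev.mono fun p hp => ha p hp⟩
  have hb : ContMDiffAt (𝓡 m).tangent 𝓘(ℝ, (Model k →L[ℝ] ℝ) × (Model m →L[ℝ] ℝ)) ∞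
      (fun p : TangentBundle (𝓡 m) X => ContinuousLinearMap.inl ℝ (Model k →L[ℝ] ℝ) (Model m →L[ℝ] ℝ)
        (-(om (extChartAt (𝓡 k) (Λ.incl x₀) (Λ.incl p.1)) (κ p.1 (co x₀ p.1 p.2))))) p₀ :=
    contMDiffAt_const.clm_apply (homp.clm_apply (hκ.clm_apply hco)).neg
  refine contMDiffAt_of_clm_apply_eq hC hb ?_ ?_
  · rw [injective_iff_map_eq_zero]
    intro v hv
    rw [hCapply] at hv
    have h₁ := congrArg Prod.fst hv
    have h₂ := congrArg Prod.snd hv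
    have h₃ : Submodule.Quotient.mk (fr (Λ.incl x₀) (Λ.incl x₀) v) = (0 : Λ.Normal x₀) := by
      refine (hinv x₀).1 ?_
      rw [map_zero]
      refine Subtype.ext ?_
      ext w
      have h₄ := hfst x₀ ⟨hx, hs, hm⟩ (fr (Λ.incl x₀) (Λ.incl x₀) v) w
      rw [co_fr hs] at h₄
      exact h₄.symm.trans (congrArg (fun T => T (co (Λ.incl x₀) (Λ.incl x₀) w)) h₁)
    obtain ⟨u, hu⟩ := (Submodule.Quotient.mk_eq_zero _).1 h₃
    have h₅ : v = κ x₀ (co x₀ x₀ u) := by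
      have h₆ := Λ.co_tmap hx hs u
      rw [← co_fr hs v, ← hu]
      exact h₆
    have h₇ := congrArg (fun T => T (co x₀ x₀ u)) h₂
    have h₈ : inner ℝ v (κ x₀ (co x₀ x₀ u)) = 0 := h₇
    rw [← h₅] at h₈
    exact inner_self_eq_zero.1 h₈
  · filter_upwards [hev, hevω] with p hp hω
    rw [hCapply]
    refine Prod.ext ?_ (ha' p hp)
    ext w
    have h₁ := hfst p.1 hp (fr (Λ.incl x₀) (Λ.incl p.1) (a p)) (fr (Λ.incl x₀) (Λ.incl p.1) w)
    rw [co_fr hp.2.1, co_fr hp.2.1, Λ.hessCov_apply_of_mk_eq hH hcrit hinv (ha p hp)] at h₁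
    refine h₁.trans ?_
    have h₂ := hω (Λ.tmap p.1 p.2) (fr (Λ.incl x₀) (Λ.incl p.1) w)
    rw [Λ.co_tmap hp.1 hp.2.1, co_fr hp.2.1] at h₂
    exact congrArg Neg.neg h₂

theorem isConnectionForm_alphaFlat :
    Λ.IsConnectionForm (Λ.alphaFlat (Λ.transverse hH hcrit) hinv) := by
  refine ⟨Λ.alphaFlat_split hH hcrit hinv, fun p₀ => ?_⟩
  set x₀ := p₀.1 with hx₀
  have hs := mem_chart_source (Model k) (Λ.incl x₀)
  have hm := mem_chart_source (Model n) (Λ.toZ x₀)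
  have hπ : ContMDiffAt (𝓡 m).tangent (𝓡 m) ∞ (fun p : TangentBundle (𝓡 m) X => p.1) p₀ :=
    (Bundle.contMDiff_proj _).contMDiffAt
  have hbase := Λ.contMDiff_toZ.contMDiffAt.comp p₀ hπ
  obtain ⟨a, ha, ha'⟩ := Λ.exists_smooth_representative hH hcrit hinv p₀
  refine (contMDiffAt_cot_iff (Λ.toZ x₀) hm).2 ⟨hbase, ?_⟩
  have h₁ := (contMDiffAt_of_contDiffAt_chart hm (contDiffAt_hess hH hm)).comp p₀ hbase
  have h₂ := (contMDiffAt_of_contDiffAt_chart hs ((L.contDiffAt_jmap hs hm).fderiv_right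
      (m := ∞) (by simp))).comp p₀ (Λ.incl.contMDiff.contMDiffAt.comp p₀ hπ)
  refine (h₁.clm_apply (h₂.clm_apply ha)).congr_of_eventuallyEq ?_
  filter_upwards [ha', hπ.continuousAt.eventually (Λ.eventually_mem_charts x₀)] with p hp hc
  change hat _ ((Λ.transverse hH hcrit p.1 (Λ.normalVec hH hcrit hinv p.1 p.2) : Λ.EX p.1) :
    Cot n (Λ.toZ p.1)) = _
  rw [← hp, transverse_mk, Λ.hat_hessCov hH hcrit hc.2.2]
  refine congrArg _ ((L.co_tmap hc.2.1 hc.2.2 _).trans ?_)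
  rw [co_fr hc.2.1]
  rfl

theorem isMetric_gammaFlat : IsMetric m (Λ.gammaFlat (Λ.transverse hH hcrit) hinv) := by
  refine ⟨Λ.gammaFlat_symm hH hcrit hinv, Λ.gammaFlat_nondegenerate hH hcrit hinv, fun p₀ => ?_⟩
  set x₀ := p₀.1 with hx₀
  have hx := mem_chart_source (Model m) x₀
  have hs := mem_chart_source (Model k) (Λ.incl x₀)
  have hπ : ContMDiffAt (𝓡 m).tangent (𝓡 m) ∞ (fun p : TangentBundle (𝓡 m) X => p.1) p₀ :=
    (Bundle.contMDiff_proj _).contMDiffAt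
  have hbaseS := Λ.incl.contMDiff.contMDiffAt.comp p₀ hπ
  obtain ⟨a, ha, ha'⟩ := Λ.exists_smooth_representative hH hcrit hinv p₀
  obtain ⟨om, hom, hom'⟩ := L.exists_coord_omegaFlat (Λ.incl x₀)
  refine (contMDiffAt_cot_iff x₀ hx).2 ⟨hπ, ?_⟩
  have h₁ := (contMDiffAt_of_contDiffAt_chart hs hom).comp p₀ hbaseS
  have h₂ := (contMDiffAt_of_contDiffAt_chart hx (Λ.contDiffAt_fderiv_kmap x₀)).comp p₀ hπ
  have h₃ : ContMDiffAt (𝓡 m).tangent 𝓘(ℝ, Model m →L[ℝ] ℝ) ∞ (fun p : TangentBundle (𝓡 m) X =>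
      -(((om (extChartAt (𝓡 k) (Λ.incl x₀) (Λ.incl p.1))).flip (a p)).comp
        (fderiv ℝ (Λ.kmap x₀) (extChartAt (𝓡 m) x₀ p.1)))) p₀ := by
    refine (ContMDiffAt.clm_comp (ContMDiffAt.clm_apply ?_ ha) h₂).neg
    exact (ContinuousLinearMap.flipₗᵢ ℝ (Model k) (Model k) ℝ).contDiff.contMDiff.contMDiffAt.comp
      p₀ h₁
  have hevω : ∀ᶠ p in 𝓝 p₀, ∀ v v' : TangentSpace (𝓡 k) (Λ.incl p.1), L.omegaFlat (Λ.incl p.1) v v' =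
      om (extChartAt (𝓡 k) (Λ.incl x₀) (Λ.incl p.1)) (co (Λ.incl x₀) (Λ.incl p.1) v)
        (co (Λ.incl x₀) (Λ.incl p.1) v') := hbaseS.continuousAt.eventually hom'
  refine h₃.congr_of_eventuallyEq ?_
  filter_upwards [ha', hπ.continuousAt.eventually (Λ.eventually_mem_charts x₀), hevω] with p hp hc hω
  ext w
  refine (Λ.gammaFlat_of_mk_eq hH hcrit hinv hp (fr x₀ p.1 w)).trans ?_
  have h := hω (Λ.tmap p.1 (fr x₀ p.1 w)) (fr (Λ.incl x₀) (Λ.incl p.1) (a p))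
  rw [Λ.co_tmap hc.1 hc.2.1, co_fr hc.1, co_fr hc.2.1] at h
  exact congrArg Neg.neg h

end LagrangianSubmanifold

end Metric

/-! ### The covariant derivative along curves of Lie frames -/

section Frames

variable {n : ℕ} {Z : Type u} [TopologicalSpace Z] [T2Space Z] [ChartedSpace (Model n) Z]
  [IsManifold (𝓡 n) ∞ Z] {P : PoissonStructure n Z} {k : ℕ} {S : Type v} [TopologicalSpace S]
  [ChartedSpace (Model k) S] [IsManifold (𝓡 k) ∞ S] {L : SymplecticLeaf P k S}
  {m : ℕ} {X : Type w} [TopologicalSpace X] [ChartedSpace (Model m) X] [IsManifold (𝓡 m) ∞ X]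
  {Λ : LagrangianSubmanifold L m X} {𝔤 : Type*} [LieRing 𝔤] [LieAlgebra ℝ 𝔤]

namespace LieFrame

omit [T2Space Z] in
theorem sharp_iso (r : LieFrame Λ 𝔤) (ξ : 𝔤) : P.sharp (Λ.toZ r.base) (r.iso ξ) = 0 :=
  L.mem_isotropy_iff.1 (r.iso ξ).2

/-- The map `ξ ↦ r ξ` in the chart at `z₀`. -/
def hatIso (z₀ : Z) (r : LieFrame Λ 𝔤) (ξ : 𝔤) : Model n →L[ℝ] ℝ :=
  hat z₀ (r.iso ξ : Cot n (Λ.toZ r.base))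

omit [T2Space Z] in
theorem hatIso_add (z₀ : Z) (r : LieFrame Λ 𝔤) (ξ η : 𝔤) :
    hatIso z₀ r (ξ + η) = hatIso z₀ r ξ + hatIso z₀ r η := by
  rw [hatIso, map_add]
  rfl

omit [T2Space Z] in
theorem hatIso_smul (z₀ : Z) (r : LieFrame Λ 𝔤) (s : ℝ) (ξ : 𝔤) :
    hatIso z₀ r (s • ξ) = s • hatIso z₀ r ξ := by
  rw [hatIso, map_smul]
  rfl

omit [T2Space Z] in
theorem hatIso_injective {z₀ : Z} (r : LieFrame Λ 𝔤)
    (hz : Λ.toZ r.base ∈ (chartAt (Model n) z₀).source) : Function.Injective (hatIso z₀ r) :=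
  fun _ _ h => r.iso.injective (Subtype.ext (hat_injective hz h))

omit [T2Space Z] in
theorem coord_hatIso {z₀ : Z} (r : LieFrame Λ 𝔤)
    (hz : Λ.toZ r.base ∈ (chartAt (Model n) z₀).source) (ξ : 𝔤) :
    P.coord z₀ (extChartAt (𝓡 n) z₀ (Λ.toZ r.base)) (hatIso z₀ r ξ) = 0 :=
  (P.coord_eq_zero_iff hz _).2 (r.sharp_iso ξ)

theorem isoBracket_hatIso {z₀ : Z} (r : LieFrame Λ 𝔤)
    (hz : Λ.toZ r.base ∈ (chartAt (Model n) z₀).source) (ξ η : 𝔤) :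
    isoBracket (P.coord z₀) (extChartAt (𝓡 n) z₀ (Λ.toZ r.base)) (hatIso z₀ r ξ)
      (hatIso z₀ r η) = hatIso z₀ r ⁅ξ, η⁆ :=
  (L.isLieIso_iff hz r.iso).1 r.isLie ξ η

omit [T2Space Z] in
/-- Covectors in the kernel of the Poisson tensor are in the range of every frame. -/
theorem exists_hatIso_eq {z₀ : Z} (r : LieFrame Λ 𝔤)
    (hz : Λ.toZ r.base ∈ (chartAt (Model n) z₀).source) {b : Model n →L[ℝ] ℝ}
    (hb : P.coord z₀ (extChartAt (𝓡 n) z₀ (Λ.toZ r.base)) b = 0) : ∃ ξ, hatIso z₀ r ξ = b := by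
  let β : Cot n (Λ.toZ r.base) := b.comp (co z₀ (Λ.toZ r.base))
  have hβ : hat z₀ β = b := hat_of_comp_co hz b
  have h : β ∈ Λ.LX r.base := L.mem_isotropy_iff.2 ((P.coord_eq_zero_iff hz β).1 (by rw [hβ, hb]))
  obtain ⟨ξ, hξ⟩ := r.iso.surjective ⟨β, h⟩
  refine ⟨ξ, ?_⟩
  rw [hatIso, hξ, hβ]

namespace Curve

variable (c : Curve Λ 𝔤) (α : ∀ x : X, TangentSpace (𝓡 m) x →ₗ[ℝ] Λ.EX x)
  (hα : Λ.IsConnectionForm α) {z₀ : Z}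

omit [T2Space Z] in
theorem contMDiff_toZ : ContMDiff 𝓘(ℝ, ℝ) (𝓡 n) ∞ (fun t => Λ.toZ (c.val t).base) :=
  Λ.contMDiff_toZ.comp c.base

omit [T2Space Z] in
theorem mfderiv_toZ : (mfderiv 𝓘(ℝ, ℝ) (𝓡 n) (fun t => Λ.toZ (c.val t).base) 0 (1 : ℝ)) =
    L.tmap (Λ.incl (c.val 0).base) (Λ.tmap (c.val 0).base c.baseVel) := by
  rw [← Λ.mfderiv_toZ]
  exact congrArg (fun T => T (1 : ℝ)) (mfderiv_comp (0 : ℝ)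
    (Λ.contMDiff_toZ.mdifferentiable (by simp) _) (c.base.mdifferentiable (by simp) (0 : ℝ)))

omit [T2Space Z] in
theorem eventually_mem_source (hz : Λ.toZ (c.val 0).base ∈ (chartAt (Model n) z₀).source) :
    ∀ᶠ t in 𝓝 0, Λ.toZ (c.val t).base ∈ (chartAt (Model n) z₀).source :=
  c.contMDiff_toZ.continuous.continuousAt.eventually
    ((chartAt (Model n) z₀).open_source.mem_nhds hz)

omit [T2Space Z] in
include hα in
/-- In coordinates the base curve has the velocity `-ϖ♯ α`, by the splitting property of `α`. -/
theorem hasDerivAt_chart (hz : Λ.toZ (c.val 0).base ∈ (chartAt (Model n) z₀).source) :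
    HasDerivAt (fun t => extChartAt (𝓡 n) z₀ (Λ.toZ (c.val t).base))
      (-(P.coord z₀ (extChartAt (𝓡 n) z₀ (Λ.toZ (c.val 0).base))
        (hat z₀ (α _ c.baseVel : Cot n (Λ.toZ (c.val 0).base))))) 0 := by
  have h₁ : MDifferentiableAt 𝓘(ℝ, ℝ) 𝓘(ℝ, Model n)
      (fun t => extChartAt (𝓡 n) z₀ (Λ.toZ (c.val t).base)) 0 :=
    ((contMDiffAt_extChartAt' (I := 𝓡 n) hz).comp (0 : ℝ)
      c.contMDiff_toZ.contMDiffAt).mdifferentiableAt (by simp)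
  have h₂ := h₁.differentiableAt.hasDerivAt
  have h₃ := co_mfderiv (g := fun t => Λ.toZ (c.val t).base) hz
    (c.contMDiff_toZ.mdifferentiable (by simp) (0 : ℝ)) (1 : ℝ)
  rw [c.mfderiv_toZ, mfderiv_eq_fderiv] at h₃
  rw [← fderiv_apply_one_eq_deriv] at h₂
  refine h₂.congr_deriv (h₃.symm.trans ?_)
  rw [P.coord_hat hz, ← map_neg, hα.split]

omit [T2Space Z] in
theorem contDiffAt_hatIso (hz : Λ.toZ (c.val 0).base ∈ (chartAt (Model n) z₀).source) (ξ : 𝔤) :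
    ContDiffAt ℝ ∞ (fun t => hatIso z₀ (c.val t) ξ) 0 :=
  ((contMDiffAt_cot_iff (f := fun t => (c.val t).cov ξ) z₀ hz).1
    (c.cov ξ).contMDiffAt).2.contDiffAt

omit [T2Space Z] in
theorem hasDerivAt_hatIso (hz : Λ.toZ (c.val 0).base ∈ (chartAt (Model n) z₀).source) (ξ : 𝔤) :
    HasDerivAt (fun t => hatIso z₀ (c.val t) ξ) (deriv (fun t => hatIso z₀ (c.val t) ξ) 0) 0 :=
  ((c.contDiffAt_hatIso hz ξ).differentiableAt (by simp)).hasDerivAt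

omit [T2Space Z] in
/-- The horizontal and vertical components of the velocity of a curve of frames. -/
theorem vel_eq (ξ : 𝔤) : (c.vel ξ : Model n × (Model n →L[ℝ] ℝ)) =
    ((L.tmap (Λ.incl (c.val 0).base) (Λ.tmap (c.val 0).base c.baseVel) : Model n),
      deriv (fun t => hatIso (Λ.toZ (c.val 0).base) (c.val t) ξ) 0) := by
  have h := mfderiv_cot ((c.cov ξ).mdifferentiable (by simp) (0 : ℝ)) (1 : ℝ)
  refine h.trans (Prod.ext c.mfderiv_toZ ?_)
  rw [← fderiv_apply_one_eq_deriv, ← mfderiv_eq_fderiv]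
  rfl

/-- The covariant derivative `∇^α` of the curve `t ↦ c(t) ξ` of covectors, in the chart at `z₀`. -/
def nabla (z₀ : Z) (ξ : 𝔤) : Model n →L[ℝ] ℝ :=
  deriv (fun t => hatIso z₀ (c.val t) ξ) 0 +
    isoBracket (P.coord z₀) (extChartAt (𝓡 n) z₀ (Λ.toZ (c.val 0).base))
      (hat z₀ (α _ c.baseVel : Cot n (Λ.toZ (c.val 0).base))) (hatIso z₀ (c.val 0) ξ)

include hα in
theorem coord_nabla (hz : Λ.toZ (c.val 0).base ∈ (chartAt (Model n) z₀).source) (ξ : 𝔤) :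
    P.coord z₀ (extChartAt (𝓡 n) z₀ (Λ.toZ (c.val 0).base)) (c.nabla α z₀ ξ) = 0 := by
  have h := (P.isPoissonNear_coord hz).hasDerivAt_sharp (c.hasDerivAt_chart α hα hz)
    (c.hasDerivAt_hatIso hz ξ)
  have h₀ : (fun t => P.coord z₀ (extChartAt (𝓡 n) z₀ (Λ.toZ (c.val t).base))
      (hatIso z₀ (c.val t) ξ)) =ᶠ[𝓝 0] fun _ => 0 := by
    filter_upwards [c.eventually_mem_source hz] with t ht using (c.val t).coord_hatIso ht ξ
  have h₁ := h.unique ((hasDerivAt_const (0 : ℝ) (0 : Model n)).congr_of_eventuallyEq h₀)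
  rw [(c.val 0).coord_hatIso hz ξ, map_zero, zero_apply, sub_zero] at h₁
  exact h₁

include hα in
/-- The covariant derivative is a derivation of the isotropy Lie algebras. -/
theorem nabla_lie (hz : Λ.toZ (c.val 0).base ∈ (chartAt (Model n) z₀).source) (ξ η : 𝔤) :
    c.nabla α z₀ ⁅ξ, η⁆ =
      isoBracket (P.coord z₀) (extChartAt (𝓡 n) z₀ (Λ.toZ (c.val 0).base)) (c.nabla α z₀ ξ)
        (hatIso z₀ (c.val 0) η) +
      isoBracket (P.coord z₀) (extChartAt (𝓡 n) z₀ (Λ.toZ (c.val 0).base))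
        (hatIso z₀ (c.val 0) ξ) (c.nabla α z₀ η) := by
  have h := (P.isPoissonNear_coord hz).hasDerivAt_isoBracket (c.hasDerivAt_chart α hα hz)
    (c.hasDerivAt_hatIso hz ξ) (c.hasDerivAt_hatIso hz η) ((c.val 0).coord_hatIso hz ξ)
    ((c.val 0).coord_hatIso hz η)
  have h₀ : (fun t => isoBracket (P.coord z₀) (extChartAt (𝓡 n) z₀ (Λ.toZ (c.val t).base))
      (hatIso z₀ (c.val t) ξ) (hatIso z₀ (c.val t) η)) =ᶠ[𝓝 0]
      fun t => hatIso z₀ (c.val t) ⁅ξ, η⁆ := by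
    filter_upwards [c.eventually_mem_source hz] with t ht
    exact (c.val t).isoBracket_hatIso ht ξ η
  have h₁ := h.unique ((c.hasDerivAt_hatIso hz ⁅ξ, η⁆).congr_of_eventuallyEq h₀)
  rw [(c.val 0).isoBracket_hatIso hz ξ η] at h₁
  rw [nabla, ← h₁, sub_add_cancel]
  rfl

omit [T2Space Z] in
theorem nabla_add (hz : Λ.toZ (c.val 0).base ∈ (chartAt (Model n) z₀).source) (ξ η : 𝔤) :
    c.nabla α z₀ (ξ + η) = c.nabla α z₀ ξ + c.nabla α z₀ η := by
  have h := (c.hasDerivAt_hatIso hz ξ).add (c.hasDerivAt_hatIso hz η)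
  have h' : deriv (fun t => hatIso z₀ (c.val t) (ξ + η)) 0 =
      deriv (fun t => hatIso z₀ (c.val t) ξ) 0 + deriv (fun t => hatIso z₀ (c.val t) η) 0 := by
    simp only [hatIso_add]
    exact h.deriv
  rw [nabla, nabla, nabla, h', hatIso_add]
  ext w
  simp
  ring

omit [T2Space Z] in
theorem nabla_smul (hz : Λ.toZ (c.val 0).base ∈ (chartAt (Model n) z₀).source) (s : ℝ) (ξ : 𝔤) :
    c.nabla α z₀ (s • ξ) = s • c.nabla α z₀ ξ := by
  have h := (c.hasDerivAt_hatIso hz ξ).const_smul s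
  have h' : deriv (fun t => hatIso z₀ (c.val t) (s • ξ)) 0 =
      s • deriv (fun t => hatIso z₀ (c.val t) ξ) 0 := by
    simp only [hatIso_smul]
    exact h.deriv
  rw [nabla, nabla, h', hatIso_smul]
  ext w
  simp

/-- A description of the covariant derivative without coordinates. -/
theorem nabla_apply (hα : Λ.IsConnectionForm α)
    (hz : Λ.toZ (c.val 0).base ∈ (chartAt (Model n) z₀).source) (ξ : 𝔤) (a : OneForm n Z)
    (ha : a.val (Λ.toZ (c.val 0).base) = (α _ c.baseVel : Cot n (Λ.toZ (c.val 0).base)))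
    (W : VField n Z) :
    c.nabla α z₀ ξ (co z₀ _ (W.val (Λ.toZ (c.val 0).base))) =
      deriv (fun t => ((c.val t).iso ξ : Cot n (Λ.toZ (c.val t).base))
        (W.val (Λ.toZ (c.val t).base))) 0 +
      ((c.val 0).iso ξ : Cot n (Λ.toZ (c.val 0).base)) (VectorField.mlieBracket (𝓡 n)
        (fun z => P.sharp z (a.val z)) W.val (Λ.toZ (c.val 0).base)) := by
  set z := Λ.toZ (c.val 0).base with hzdef
  have hB := P.contDiffAt_coord (extChartAt_mem_target hz)
  have hP := P.isPoissonNear_coord hz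
  have hs : ContMDiffAt (𝓡 n) (𝓡 n).tangent ∞
      (fun z => (⟨z, P.sharp z (a.val z)⟩ : TangentBundle (𝓡 n) Z)) z :=
    P.smooth.contMDiffAt.comp z (a.smooth z)
  have hW := (contDiffAt_vhat hz (W.smooth z)).differentiableAt (by simp)
  have h₁ : (fun t => ((c.val t).iso ξ : Cot n (Λ.toZ (c.val t).base))
      (W.val (Λ.toZ (c.val t).base))) =ᶠ[𝓝 0] fun t => hatIso z₀ (c.val t) ξ
        (vhat z₀ W.val (extChartAt (𝓡 n) z₀ (Λ.toZ (c.val t).base))) := by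
    filter_upwards [c.eventually_mem_source hz] with t ht
    rw [vhat_chart ht, hatIso, hat_co ht]
  have h₂ := (c.hasDerivAt_hatIso hz ξ).clm_apply
    (hW.hasFDerivAt.comp_hasDerivAt 0 (c.hasDerivAt_chart α hα hz))
  have h₂' := h₁.deriv_eq.trans h₂.deriv
  have h₃ : fderiv ℝ (vhat z₀ fun z => P.sharp z (a.val z)) (extChartAt (𝓡 n) z₀ z)
      (co z₀ z (W.val z)) = fderiv ℝ (P.coord z₀) (extChartAt (𝓡 n) z₀ z) (co z₀ z (W.val z))
        (hat z₀ (a.val z)) + P.coord z₀ (extChartAt (𝓡 n) z₀ z)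
          (fderiv ℝ (fhat z₀ a.val) (extChartAt (𝓡 n) z₀ z) (co z₀ z (W.val z))) := by
    have h : (vhat z₀ fun z => P.sharp z (a.val z)) =ᶠ[𝓝 (extChartAt (𝓡 n) z₀ z)]
        fun y => P.coord z₀ y (fhat z₀ a.val y) := by
      filter_upwards [extChartAt_target_mem_nhds_of_mem (extChartAt_mem_target hz)] with y hy
        using P.vhat_sharp hy a.val
    rw [h.fderiv_eq, fderiv_clm_apply (hB.differentiableAt (by simp))
      ((contDiffAt_fhat hz (a.smooth z)).differentiableAt (by simp)), fhat_chart hz]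
    simp [add_comm]
  have h₄ : ((c.val 0).iso ξ : Cot n z) (VectorField.mlieBracket (𝓡 n)
      (fun z => P.sharp z (a.val z)) W.val z) = hatIso z₀ (c.val 0) ξ (co z₀ z
        (VectorField.mlieBracket (𝓡 n) (fun z => P.sharp z (a.val z)) W.val z)) :=
    (hat_co hz _ _).symm
  rw [h₂', h₄, Function.comp_apply, co_mlieBracket hz hs (W.smooth z), h₃, ← P.coord_hat hz, ha,
    vhat_chart hz, map_sub, map_add, P.coord_skew, (c.val 0).coord_hatIso hz, nabla]
  have h₅ := hP.skew_fderiv (co z₀ z (W.val z))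
    (hat z₀ (α _ c.baseVel : Cot n (Λ.toZ (c.val 0).base))) (hatIso z₀ (c.val 0) ξ)
  simp only [add_apply, isoBracket_apply, map_neg, map_zero]
  rw [h₅]
  ring

end Curve

end LieFrame

end Frames

/-! ### The connection form on the Lie frame bundle induced by a splitting -/

section InducedForm

variable {n : ℕ} {Z : Type u} [TopologicalSpace Z] [T2Space Z] [ChartedSpace (Model n) Z]
  [IsManifold (𝓡 n) ∞ Z] {P : PoissonStructure n Z} {k : ℕ} {S : Type v} [TopologicalSpace S]
  [ChartedSpace (Model k) S] [IsManifold (𝓡 k) ∞ S] {L : SymplecticLeaf P k S}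
  {m : ℕ} {X : Type w} [TopologicalSpace X] [ChartedSpace (Model m) X] [IsManifold (𝓡 m) ∞ X]
  {Λ : LagrangianSubmanifold L m X} {𝔤 : Type*} [LieRing 𝔤] [LieAlgebra ℝ 𝔤]

theorem exists_oneForm_eq {z : Z} (β : Cot n z) : ∃ e : OneForm n Z, e.val z = β := by
  obtain ⟨e, he⟩ := exists_oneForm (z₀ := z) (b := fun _ => hat z β)
    (Eventually.of_forall fun _ => contMDiffAt_const)
  exact ⟨e, hat_injective (mem_chart_source _ z) he.self_of_nhds⟩

namespace LieFrame

variable (α : ∀ x : X, TangentSpace (𝓡 m) x →ₗ[ℝ] Λ.EX x) (hα : Λ.IsConnectionForm α)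

include hα in
/-- The covariant derivative of a curve of covectors does not depend on the chart. -/
theorem Curve.nabla_chart (c : Curve Λ 𝔤) {z₀ z₁ : Z}
    (hz₀ : Λ.toZ (c.val 0).base ∈ (chartAt (Model n) z₀).source)
    (hz₁ : Λ.toZ (c.val 0).base ∈ (chartAt (Model n) z₁).source) {ξ : 𝔤}
    {β : Cot n (Λ.toZ (c.val 0).base)} (h : hat z₁ β = c.nabla α z₁ ξ) :
    hat z₀ β = c.nabla α z₀ ξ := by
  obtain ⟨a, ha⟩ := exists_oneForm_eq (α _ c.baseVel : Cot n (Λ.toZ (c.val 0).base))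
  ext w
  obtain ⟨W, hW⟩ := exists_vField_eq (fr z₀ (Λ.toZ (c.val 0).base) w)
  have h₁ := c.nabla_apply α hα hz₀ ξ a ha W
  rw [← c.nabla_apply α hα hz₁ ξ a ha W, ← h, hat_co hz₁, hW, co_fr hz₀] at h₁
  exact h₁.symm

/-- The vector `τ` along the realization of `R_X` projects to `Tu`, and its vertical part is that of
`f ∘ D` after correction by `α(u)`. For the velocity `τ` of a curve of frames `c`, it expresses
`∇^α (c ξ) = c (D ξ)`. The components are those of the chart at the base point itself. -/
def IsCovariant (r : LieFrame Λ 𝔤) (τ : Ambient r) (u : TangentSpace (𝓡 m) r.base)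
    (D : LieDerivation ℝ 𝔤 𝔤) : Prop :=
  ∀ ξ : 𝔤, ((τ ξ : Model n × (Model n →L[ℝ] ℝ)).1 =
      (L.tmap (Λ.incl r.base) (Λ.tmap r.base u) : Model n)) ∧
    hatIso (Λ.toZ r.base) r (D ξ) = (τ ξ : Model n × (Model n →L[ℝ] ℝ)).2 +
      isoBracket (P.coord (Λ.toZ r.base)) (extChartAt (𝓡 n) (Λ.toZ r.base) (Λ.toZ r.base))
        (hat (Λ.toZ r.base) (α r.base u : Cot n (Λ.toZ r.base))) (hatIso (Λ.toZ r.base) r ξ)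

variable {α}

namespace IsCovariant

variable {r : LieFrame Λ 𝔤} {τ τ' : Ambient r} {u u' : TangentSpace (𝓡 m) r.base}
  {D D' : LieDerivation ℝ 𝔤 𝔤}

omit [T2Space Z] in
theorem add (h : IsCovariant α r τ u D) (h' : IsCovariant α r τ' u' D') :
    IsCovariant α r (τ + τ') (u + u') (D + D') := fun ξ => by
  refine ⟨(congrArg₂ (fun a b : Model n => a + b) (h ξ).1 (h' ξ).1).trans
    ((congrArg (L.tmap (Λ.incl r.base)) (map_add (Λ.tmap r.base) u u')).trans
      (map_add (L.tmap (Λ.incl r.base)) _ _)).symm, ?_⟩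
  rw [LieDerivation.add_apply, hatIso_add, (h ξ).2, (h' ξ).2, map_add]
  ext w
  exact add_add_add_comm _ _ _ _

omit [T2Space Z] in
theorem smul (s : ℝ) (h : IsCovariant α r τ u D) : IsCovariant α r (s • τ) (s • u) (s • D) :=
    fun ξ => by
  refine ⟨(congrArg (fun a : Model n => s • a) (h ξ).1).trans
    ((congrArg (L.tmap (Λ.incl r.base)) (map_smul (Λ.tmap r.base) s u)).trans
      (map_smul (L.tmap (Λ.incl r.base)) s _)).symm, ?_⟩
  rw [LieDerivation.smul_apply, hatIso_smul, (h ξ).2, map_smul]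
  ext w
  exact mul_add _ _ _

omit [T2Space Z] in
/-- The horizontal part of a tangent vector of the frame bundle determines its projection to `X`. -/
theorem base_eq (h : IsCovariant α r τ u D)
    (hτ : (τ 0 : Model n × (Model n →L[ℝ] ℝ)).1 = (τ' 0 : Model n × (Model n →L[ℝ] ℝ)).1)
    (h' : IsCovariant α r τ' u' D') : u = u' :=
  Λ.tmap_injective _ (L.tmap_injective _ ((h 0).1.symm.trans (hτ.trans (h' 0).1)))

omit [T2Space Z] in
theorem unique (h : IsCovariant α r τ u D) (h' : IsCovariant α r τ u' D') : D = D' := by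
  obtain rfl := h.base_eq rfl h'
  exact LieDerivation.ext fun ξ =>
    hatIso_injective r (mem_chart_source _ _) ((h ξ).2.trans (h' ξ).2.symm)

omit [T2Space Z] in
theorem zero (r : LieFrame Λ 𝔤) : IsCovariant α r 0 0 0 := fun ξ => by
  refine ⟨((congrArg (L.tmap (Λ.incl r.base)) (map_zero (Λ.tmap r.base))).trans
    (map_zero (L.tmap (Λ.incl r.base)))).symm, ?_⟩
  rw [map_zero (α r.base), LieDerivation.zero_apply]
  have h : hatIso (Λ.toZ r.base) r 0 = 0 := by
    rw [hatIso, map_zero]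
    rfl
  rw [h]
  ext w
  exact (add_zero (0 : ℝ)).symm

omit [T2Space Z] in
/-- Fundamental vectors are vertical. -/
theorem fundamental (r : LieFrame Λ 𝔤) (D : LieDerivation ℝ 𝔤 𝔤) :
    IsCovariant α r (fundamental r D) 0 D := fun ξ => by
  have h := LagrangianSubmanifold.vertical_eq (Λ.toZ r.base)
    (r.iso ξ : Cot n (Λ.toZ r.base)) (r.iso (D ξ) : Cot n (Λ.toZ r.base))
  refine ⟨(congrArg Prod.fst h).trans ((zero (α := α) r ξ).1), ?_⟩
  have h₂ : (LieFrame.fundamental r D ξ : Model n × (Model n →L[ℝ] ℝ)).2 =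
      hatIso (Λ.toZ r.base) r (D ξ) := (congrArg Prod.snd h).trans (hat_self _ _).symm
  rw [h₂, map_zero (α r.base)]
  ext w
  exact (add_zero _).symm

end IsCovariant

/-- The derivation by which the covariant derivative acts along a curve of frames. -/
theorem Curve.exists_isCovariant (hα : Λ.IsConnectionForm α) (c : Curve Λ 𝔤) :
    ∃ D, IsCovariant α (c.val 0) c.vel c.baseVel D := by
  have hz := mem_chart_source (Model n) (Λ.toZ (c.val 0).base)
  choose D hD using fun ξ => (c.val 0).exists_hatIso_eq hz (c.coord_nabla α hα hz ξ)
  have hinj := hatIso_injective (c.val 0) hz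
  refine ⟨LieDerivation.mk
    { toFun := D
      map_add' := fun ξ η => hinj (by rw [hatIso_add, hD, hD, hD, c.nabla_add α hz])
      map_smul' := fun s ξ => hinj (by
        rw [RingHom.id_apply, hatIso_smul, hD, hD, c.nabla_smul α hz]) } ?_, fun ξ => ⟨?_, ?_⟩⟩
  · intro ξ η
    refine hinj ?_
    change hatIso _ _ (D ⁅ξ, η⁆) = hatIso _ _ (⁅ξ, D η⁆ - ⁅η, D ξ⁆)
    rw [hD, c.nabla_lie α hα hz, ← lie_skew η (D ξ), sub_neg_eq_add, hatIso_add, ← hD, ← hD,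
      (c.val 0).isoBracket_hatIso hz, (c.val 0).isoBracket_hatIso hz, add_comm]
  · exact congrArg Prod.fst (c.vel_eq ξ)
  · have h := congrArg Prod.snd (c.vel_eq ξ)
    change hatIso _ _ (D ξ) = _
    rw [hD, h]
    rfl

/-- Every tangent vector of the frame bundle, being a linear combination of velocities of curves, has a
projection to `X` and acts by a derivation. -/
theorem exists_isCovariant (hα : Λ.IsConnectionForm α) (r : LieFrame Λ 𝔤) (τ : tangent r) :
    ∃ u D, IsCovariant α r τ.1 u D := by
  obtain ⟨τ, hτ⟩ := τ
  refine Submodule.span_induction (p := fun τ _ => ∃ u D, IsCovariant α r τ u D) ?_ ?_ ?_ ?_ hτ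
  · rintro _ ⟨c, rfl, rfl⟩
    exact ⟨_, c.exists_isCovariant hα⟩
  · exact ⟨0, 0, IsCovariant.zero r⟩
  · rintro _ _ _ _ ⟨u, D, h⟩ ⟨u', D', h'⟩
    exact ⟨_, _, h.add h'⟩
  · rintro s _ _ ⟨u, D, h⟩
    exact ⟨_, _, h.smul s⟩

set_option synthInstance.maxHeartbeats 200000 in
/-- The connection form on the Lie frame bundle induced by an `E_X`-connection form. -/
def inducedForm (hα : Λ.IsConnectionForm α) (r : LieFrame Λ 𝔤) :
    tangent r →ₗ[ℝ] LieDerivation ℝ 𝔤 𝔤 where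
  toFun τ := (exists_isCovariant hα r τ).choose_spec.choose
  map_add' τ τ' := (exists_isCovariant hα r (τ + τ')).choose_spec.choose_spec.unique
    ((exists_isCovariant hα r τ).choose_spec.choose_spec.add
      (exists_isCovariant hα r τ').choose_spec.choose_spec)
  map_smul' s τ := (exists_isCovariant hα r _).choose_spec.choose_spec.unique
    ((exists_isCovariant hα r τ).choose_spec.choose_spec.smul s)

theorem inducedForm_spec (hα : Λ.IsConnectionForm α) (r : LieFrame Λ 𝔤) (τ : tangent r) :
    ∃ u, IsCovariant α r τ.1 u (inducedForm hα r τ) :=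
  ⟨_, (exists_isCovariant hα r τ).choose_spec.choose_spec⟩

theorem inducedForm_eq (hα : Λ.IsConnectionForm α) {r : LieFrame Λ 𝔤} {τ : tangent r}
    {u : TangentSpace (𝓡 m) r.base} {D : LieDerivation ℝ 𝔤 𝔤} (h : IsCovariant α r τ.1 u D) :
    inducedForm hα r τ = D :=
  (inducedForm_spec hα r τ).choose_spec.unique h

theorem isCovariant_inducedForm (hα : Λ.IsConnectionForm α) (c : Curve Λ 𝔤) :
    IsCovariant α (c.val 0) c.vel c.baseVel (inducedForm hα _ c.tan) := by
  obtain ⟨D, hD⟩ := c.exists_isCovariant hα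
  rwa [inducedForm_eq hα (τ := c.tan) hD]

/-- The induced form computes the covariant derivative of curves of frames, in every chart. -/
theorem hatIso_inducedForm (hα : Λ.IsConnectionForm α) (c : Curve Λ 𝔤) {z₀ : Z}
    (hz : Λ.toZ (c.val 0).base ∈ (chartAt (Model n) z₀).source) (ξ : 𝔤) :
    hatIso z₀ (c.val 0) (inducedForm hα _ c.tan ξ) = c.nabla α z₀ ξ := by
  refine c.nabla_chart α hα hz (mem_chart_source _ _) ?_
  have h := (isCovariant_inducedForm hα c ξ).2
  have h' := congrArg Prod.snd (c.vel_eq ξ)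
  rw [h'] at h
  exact h

theorem inducedForm_equivariant (hα : Λ.IsConnectionForm α) (c : Curve Λ 𝔤) (a : 𝔤 ≃ₗ⁅ℝ⁆ 𝔤) (ξ : 𝔤) :
    inducedForm hα _ (c.act a).tan ξ = a.symm (inducedForm hα _ c.tan (a ξ)) := by
  have hz := mem_chart_source (Model n) (Λ.toZ (c.val 0).base)
  refine hatIso_injective ((c.act a).val 0) hz ?_
  refine (hatIso_inducedForm hα (c.act a) hz ξ).trans
    ((hatIso_inducedForm hα c hz (a ξ)).symm.trans ?_)
  change _ = hatIso _ (c.val 0) (a (a.symm _))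
  rw [LieEquiv.apply_symm_apply]

/-- Where the one-form `e` extends the section `σ ξ`, the bracket `{a, e}` in coordinates is the
covariant derivative of the curve `c ξ`, which lies on this section. -/
theorem inducedForm_induces (hα : Λ.IsConnectionForm α) :
    Induces (𝔤 := 𝔤) (fun r => inducedForm hα r) α := by
  intro U σ hσ c hcU hc ξ V a e hV ha he W
  set z := Λ.toZ (c.val 0).base with hzdef
  have hz := mem_chart_source (Model n) z
  have hσ₀ : (c.val 0) = σ (c.val 0).base := hc.self_of_nhds
  -- along the curve, the one-form `e` takes the values of the frame
  have hb : Tendsto (fun t => (c.val t).base) (𝓝 0) (𝓝 (c.val 0).base) :=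
    c.base.continuous.continuousAt
  have he' : ∀ᶠ t in 𝓝 0, hat z (e.val (Λ.toZ (c.val t).base)) = hatIso z (c.val t) ξ := by
    filter_upwards [hb.eventually he, hc] with t h₁ h₂
    have h₃ : cot n (Λ.toZ (c.val t).base) (e.val (Λ.toZ (c.val t).base)) = (c.val t).cov ξ :=
      h₁.trans (congrArg (fun r => r.cov ξ) h₂.symm)
    exact congrArg (fun p : CotBundle n Z => hat z p.2) h₃
  have ha' : a.val z = (α _ c.baseVel : Cot n z) := by
    have h := ha.self_of_nhds
    rw [hV] at h
    exact h
  have he₀ : e.val z = (c.val 0).iso ξ := hat_injective hz he'.self_of_nhds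
  rw [P.formBracket_eq hz a e W (by rw [he₀]; exact (c.val 0).sharp_iso ξ), ← hat_co hz]
  have h₁ := hatIso_inducedForm hα c hz ξ
  change _ = hatIso z (c.val 0) _ _
  rw [h₁, Curve.nabla, ← ha', he₀]
  have h₂ := ((contDiffAt_fhat hz (e.smooth z)).differentiableAt (by simp)).hasFDerivAt.comp_hasDerivAt
    (0 : ℝ) (c.hasDerivAt_chart α hα hz)
  have h₃ : (fun t => hatIso z (c.val t) ξ) =ᶠ[𝓝 0]
      fhat z e.val ∘ fun t => extChartAt (𝓡 n) z (Λ.toZ (c.val t).base) := by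
    filter_upwards [he', c.eventually_mem_source hz] with t ht ht'
    rw [Function.comp_apply, fhat_chart ht', ht]
  rw [h₃.deriv_eq, h₂.deriv, ← ha', map_neg, add_apply, neg_apply, sub_eq_neg_add]
  rfl

theorem inducedForm_vertical (hα : Λ.IsConnectionForm α) (r : LieFrame Λ 𝔤)
    (D : LieDerivation ℝ 𝔤 𝔤) (τ : tangent r) (h : τ.1 = fundamental r D) :
    inducedForm hα r τ = D :=
  inducedForm_eq hα (h ▸ IsCovariant.fundamental r D)

end LieFrame

end InducedForm

/-! ### Smoothness of the induced connection form -/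

section SmoothForm

variable {n : ℕ} {Z : Type u} [TopologicalSpace Z] [T2Space Z] [ChartedSpace (Model n) Z]
  [IsManifold (𝓡 n) ∞ Z] {P : PoissonStructure n Z} {k : ℕ} {S : Type v} [TopologicalSpace S]
  [ChartedSpace (Model k) S] [IsManifold (𝓡 k) ∞ S] {L : SymplecticLeaf P k S}
  {m : ℕ} {X : Type w} [TopologicalSpace X] [ChartedSpace (Model m) X] [IsManifold (𝓡 m) ∞ X]
  {Λ : LagrangianSubmanifold L m X} {𝔤 : Type*} [LieRing 𝔤] [LieAlgebra ℝ 𝔤]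

namespace LieFrame

variable {α : ∀ x : X, TangentSpace (𝓡 m) x →ₗ[ℝ] Λ.EX x}

omit [T2Space Z] in
theorem finiteDimensional (r : LieFrame Λ 𝔤) : FiniteDimensional ℝ 𝔤 :=
  haveI : FiniteDimensional ℝ (Cot n (Λ.toZ r.base)) :=
    inferInstanceAs (FiniteDimensional ℝ (Model n →L[ℝ] ℝ))
  r.iso.symm.finiteDimensional

/-- The map `ξ ↦ r ξ` in a chart, in coordinates of `𝔤`. -/
def basisMap {ι : Type*} [Fintype ι] (b : Module.Basis ι ℝ 𝔤) (z₀ : Z) (r : LieFrame Λ 𝔤) :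
    (ι → ℝ) →L[ℝ] (Model n →L[ℝ] ℝ) :=
  ∑ i, (ContinuousLinearMap.proj i : (ι → ℝ) →L[ℝ] ℝ).smulRight (hatIso z₀ r (b i))

omit [T2Space Z] in
theorem basisMap_apply {ι : Type*} [Fintype ι] (b : Module.Basis ι ℝ 𝔤) (z₀ : Z)
    (r : LieFrame Λ 𝔤) (ξ : 𝔤) : basisMap b z₀ r (b.equivFun ξ) = hatIso z₀ r ξ := by
  have h : hatIso z₀ r (∑ i, b.equivFun ξ i • b i) = ∑ i, b.equivFun ξ i • hatIso z₀ r (b i) := by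
    let T : 𝔤 →ₗ[ℝ] (Model n →L[ℝ] ℝ) :=
      { toFun := hatIso z₀ r, map_add' := hatIso_add z₀ r, map_smul' := hatIso_smul z₀ r }
    change T _ = ∑ i, _ • T _
    rw [map_sum]
    exact Finset.sum_congr rfl fun i _ => map_smul _ _ _
  rw [b.sum_equivFun] at h
  rw [h, basisMap, sum_apply]
  rfl

omit [T2Space Z] in
theorem IsSmooth.contDiffAt_hatIso {k' : ℕ} {φ : Model k' → LieFrame Λ 𝔤} (hφ : IsSmooth φ)
    {z₀ : Z} {y : Model k'} (hz : Λ.toZ (φ y).base ∈ (chartAt (Model n) z₀).source) (ξ : 𝔤) :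
    ContDiffAt ℝ ∞ (fun y => hatIso z₀ (φ y) ξ) y :=
  ((contMDiffAt_cot_iff (f := fun y => (φ y).cov ξ) z₀ hz).1
    (hφ.cov ξ).contMDiffAt).2.contDiffAt

omit [T2Space Z] in
theorem IsSmooth.tangentBundle_baseVel {k' : ℕ} {φ : Model k' → LieFrame Λ 𝔤} (hφ : IsSmooth φ)
    (y w : Model k') : (⟨((hφ.curve y w).val 0).base, (hφ.curve y w).baseVel⟩ :
      TangentBundle (𝓡 m) X) = tangentMap (𝓡 k') (𝓡 m) (fun y => (φ y).base) ⟨y, w⟩ := by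
  have h₁ : HasMFDerivAt 𝓘(ℝ, ℝ) (𝓡 k') (fun t : ℝ => y + t • w) 0
      ((ContinuousLinearMap.id ℝ ℝ).smulRight w) := by
    have h : HasFDerivAt (fun t : ℝ => y + t • w) ((ContinuousLinearMap.id ℝ ℝ).smulRight w) 0 :=
      ((hasFDerivAt_id (0 : ℝ)).smul_const w).const_add y
    exact h.hasMFDerivAt
  have h₂ := ((hφ.base.mdifferentiable (by simp) (y + (0 : ℝ) • w)).hasMFDerivAt.comp
    (0 : ℝ) h₁).mfderiv
  have h₃ : (hφ.curve y w).baseVel =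
      mfderiv (𝓡 k') (𝓡 m) (fun y => (φ y).base) (y + (0 : ℝ) • w) w :=
    (congrArg (fun T => T (1 : ℝ)) h₂).trans
      (congrArg (mfderiv (𝓡 k') (𝓡 m) (fun y => (φ y).base) (y + (0 : ℝ) • w)) (one_smul ℝ w))
  rw [h₃]
  change tangentMap (𝓡 k') (𝓡 m) (fun y => (φ y).base) ⟨y + (0 : ℝ) • w, w⟩ = _
  rw [zero_smul, add_zero]

omit [T2Space Z] in
theorem IsSmooth.curve_val_zero {k' : ℕ} {φ : Model k' → LieFrame Λ 𝔤} (hφ : IsSmooth φ)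
    (y w : Model k') : (hφ.curve y w).val 0 = φ y := by
  change φ (y + (0 : ℝ) • w) = φ y
  rw [zero_smul, add_zero]

omit [T2Space Z] in
theorem IsSmooth.deriv_curve {k' : ℕ} {φ : Model k' → LieFrame Λ 𝔤} (hφ : IsSmooth φ)
    {z₀ : Z} {y : Model k'} (hz : Λ.toZ (φ y).base ∈ (chartAt (Model n) z₀).source) (ξ : 𝔤)
    (w : Model k') : deriv (fun t => hatIso z₀ ((hφ.curve y w).val t) ξ) 0 =
      fderiv ℝ (fun y => hatIso z₀ (φ y) ξ) y w := by
  have h₃ : HasDerivAt (fun t : ℝ => y + t • w) w 0 := by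
    simpa using ((hasDerivAt_id (0 : ℝ)).smul_const w).const_add y
  have h₄ : HasFDerivAt (fun y => hatIso z₀ (φ y) ξ)
      (fderiv ℝ (fun y => hatIso z₀ (φ y) ξ) y) (y + (0 : ℝ) • w) := by
    rw [zero_smul, add_zero]
    exact ((hφ.contDiffAt_hatIso hz ξ).differentiableAt (by simp)).hasFDerivAt
  exact (h₄.comp_hasDerivAt (0 : ℝ) h₃).deriv

/-- The value of `α` on a tangent vector of `X`, in a chart. -/
def baseForm (α : ∀ x : X, TangentSpace (𝓡 m) x →ₗ[ℝ] Λ.EX x) (z₀ : Z) (p : TangentBundle (𝓡 m) X) :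
    Model n →L[ℝ] ℝ := hat z₀ (α p.1 p.2 : Cot n (Λ.toZ p.1))

theorem contMDiff_tangent_const {k' : ℕ} (w : Model k') : ContMDiff (𝓡 k') (𝓡 k').tangent ∞
    (fun y => (⟨y, w⟩ : TangentBundle (𝓡 k') (Model k'))) := fun y =>
  (contMDiffAt_tangent_iff y (mem_chart_source _ y)).2 ⟨contMDiffAt_id,
    (contMDiffAt_const (c := w)).congr_of_eventuallyEq (Eventually.of_forall fun y' => by
      simp [co]
      rfl)⟩

omit [T2Space Z] in
theorem IsSmooth.contDiffAt_baseForm (hα : Λ.IsConnectionForm α) {k' : ℕ}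
    {φ : Model k' → LieFrame Λ 𝔤} (hφ : IsSmooth φ) {z₀ : Z} {y₀ : Model k'}
    (hz : Λ.toZ (φ y₀).base ∈ (chartAt (Model n) z₀).source) (w : Model k') :
    ContDiffAt ℝ ∞ (fun y => baseForm α z₀
      (tangentMap (𝓡 k') (𝓡 m) (fun y => (φ y).base) ⟨y, w⟩)) y₀ := by
  have hp : ContMDiff (𝓡 k') (𝓡 m).tangent ∞
      (fun y => tangentMap (𝓡 k') (𝓡 m) (fun y => (φ y).base) ⟨y, w⟩) :=
    (hφ.base.contMDiff_tangentMap (m := ∞) (by simp)).comp (contMDiff_tangent_const w)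
  have h := (hα.smooth.comp hp).contMDiffAt (x := y₀)
  exact ((contMDiffAt_cot_iff z₀ hz).1 h).2.contDiffAt

/-- In a chart, the induced form is the solution of a linear system with smooth coefficients. -/
theorem IsSmooth.hatIso_inducedForm (hα : Λ.IsConnectionForm α) {k' : ℕ}
    {φ : Model k' → LieFrame Λ 𝔤} (hφ : IsSmooth φ) {z₀ : Z} {y : Model k'}
    (hz : Λ.toZ (φ y).base ∈ (chartAt (Model n) z₀).source) (w : Model k') (ξ : 𝔤) :
    hatIso z₀ (φ y) (inducedForm hα _ (hφ.curve y w).tan ξ) =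
      fderiv ℝ (fun y => hatIso z₀ (φ y) ξ) y w +
      isoBracketL (P.coord z₀) (extChartAt (𝓡 n) z₀ (Λ.toZ (φ y).base))
        (baseForm α z₀ (tangentMap (𝓡 k') (𝓡 m) (fun y => (φ y).base) ⟨y, w⟩))
        (hatIso z₀ (φ y) ξ) := by
  have hz' : Λ.toZ ((hφ.curve y w).val 0).base ∈ (chartAt (Model n) z₀).source := by
    rwa [hφ.curve_val_zero]
  have h₁ := LieFrame.hatIso_inducedForm hα (hφ.curve y w) hz' ξ
  have h₅ : hat z₀ (α _ (hφ.curve y w).baseVel : Cot n (Λ.toZ ((hφ.curve y w).val 0).base)) =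
      baseForm α z₀ (tangentMap (𝓡 k') (𝓡 m) (fun y => (φ y).base) ⟨y, w⟩) :=
    congrArg (baseForm α z₀) (hφ.tangentBundle_baseVel y w)
  rw [Curve.nabla, hφ.deriv_curve hz, h₅] at h₁
  generalize inducedForm hα _ (hφ.curve y w).tan ξ = η at h₁ ⊢
  rw [hφ.curve_val_zero] at h₁
  exact h₁

theorem contDiff_inducedForm (hα : Λ.IsConnectionForm α) {k' : ℕ} {φ : Model k' → LieFrame Λ 𝔤}
    (hφ : IsSmooth φ) (w : Model k') (ξ : 𝔤) (l : Module.Dual ℝ 𝔤) :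
    ContDiff ℝ ∞ (fun y : Model k' => l (inducedForm hα _ (hφ.curve y w).tan ξ)) := by
  refine contDiff_iff_contDiffAt.2 fun y₀ => ?_
  have hfin := (φ y₀).finiteDimensional
  let b := Module.finBasis ℝ 𝔤
  set z₀ := Λ.toZ (φ y₀).base with hz₀
  have hz : Λ.toZ (φ y₀).base ∈ (chartAt (Model n) z₀).source := mem_chart_source _ _
  have hbase : ContMDiff (𝓡 k') (𝓡 n) ∞ (fun y => Λ.toZ (φ y).base) :=
    Λ.contMDiff_toZ.comp hφ.base
  have hsrc : ∀ᶠ y in 𝓝 y₀, Λ.toZ (φ y).base ∈ (chartAt (Model n) z₀).source :=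
    hbase.continuous.continuousAt.eventually ((chartAt (Model n) z₀).open_source.mem_nhds hz)
  have hC : ContDiffAt ℝ ∞ (fun y => basisMap b z₀ (φ y)) y₀ :=
    ContDiffAt.sum fun i _ => contDiffAt_const.smulRight (hφ.contDiffAt_hatIso hz (b i))
  have h₁ : ContDiffAt ℝ ∞ (fun y => extChartAt (𝓡 n) z₀ (Λ.toZ (φ y).base)) y₀ :=
    ((contMDiffAt_extChartAt' (I := 𝓡 n) hz).comp y₀ hbase.contMDiffAt).contDiffAt
  have hbr := ((((P.isPoissonNear_coord hz).contDiffAt_isoBracketL.comp y₀ h₁).clm_apply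
    (hφ.contDiffAt_baseForm hα hz w)).clm_apply (hφ.contDiffAt_hatIso hz ξ))
  have hrhs := (((hφ.contDiffAt_hatIso hz ξ).fderiv_right (m := ∞) (by simp)).clm_apply
    (contDiffAt_const (c := w))).add hbr
  have hv : ContMDiffAt (𝓡 k') 𝓘(ℝ, Fin (Module.finrank ℝ 𝔤) → ℝ) ∞
      (fun y => b.equivFun (inducedForm hα _ (hφ.curve y w).tan ξ)) y₀ := by
    refine contMDiffAt_of_clm_apply_eq hC.contMDiffAt hrhs.contMDiffAt ?_ ?_
    · intro a a' h
      rw [← b.equivFun.apply_symm_apply a, ← b.equivFun.apply_symm_apply a', basisMap_apply,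
        basisMap_apply] at h
      exact b.equivFun.symm.injective ((φ y₀).hatIso_injective hz h)
    · filter_upwards [hsrc] with y hy
      rw [basisMap_apply]
      exact hφ.hatIso_inducedForm hα hy w ξ
  have hl : ∀ D : 𝔤, l D = ∑ i, b.equivFun D i * l (b i) := fun D => by
    conv_lhs => rw [← b.sum_equivFun D, map_sum]
    exact Finset.sum_congr rfl fun i _ => map_smul _ _ _
  refine ContDiffAt.congr_of_eventuallyEq (f := fun y => ∑ i,
    b.equivFun (inducedForm hα _ (hφ.curve y w).tan ξ) i * l (b i)) ?_
    (Eventually.of_forall fun y => hl _)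
  exact ContDiffAt.sum fun i _ => ((contDiffAt_pi.1 hv.contDiffAt) i).mul contDiffAt_const

theorem isPrincipalConnectionForm_inducedForm (hα : Λ.IsConnectionForm α) :
    IsPrincipalConnectionForm (𝔤 := 𝔤) (fun r => inducedForm hα r) :=
  ⟨fun _ _ hφ w ξ l => contDiff_inducedForm hα hφ w ξ l, inducedForm_vertical hα,
    inducedForm_equivariant hα⟩

end LieFrame

end SmoothForm

/-! ### Local sections of the Lie frame bundle -/

section Principal

variable {n : ℕ} {Z : Type u} [TopologicalSpace Z] [T2Space Z] [ChartedSpace (Model n) Z]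
  [IsManifold (𝓡 n) ∞ Z] {P : PoissonStructure n Z} {k : ℕ} {S : Type v} [TopologicalSpace S]
  [ChartedSpace (Model k) S] [IsManifold (𝓡 k) ∞ S] {L : SymplecticLeaf P k S}
  {m : ℕ} {X : Type w} [TopologicalSpace X] [ChartedSpace (Model m) X] [IsManifold (𝓡 m) ∞ X]
  {Λ : LagrangianSubmanifold L m X} {𝔤 : Type*} [LieRing 𝔤] [LieAlgebra ℝ 𝔤]

omit [T2Space Z] in
/-- The isomorphism of isotropy algebras with a given coordinate expression. -/
theorem SymplecticLeaf.exists_isotropy_equiv {z₀ : Z} {s₀ s : S}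
    (hz₀ : L.incl s₀ ∈ (chartAt (Model n) z₀).source)
    (hz : L.incl s ∈ (chartAt (Model n) z₀).source)
    (g : (Model n →L[ℝ] ℝ) →L[ℝ] (Model n →L[ℝ] ℝ)) (hinj : Function.Injective g)
    (hker : ∀ β, P.coord z₀ (extChartAt (𝓡 n) z₀ (L.incl s₀)) β = 0 →
      P.coord z₀ (extChartAt (𝓡 n) z₀ (L.incl s)) (g β) = 0)
    (hsurj : ∀ γ, P.coord z₀ (extChartAt (𝓡 n) z₀ (L.incl s)) γ = 0 →
      ∃ β, P.coord z₀ (extChartAt (𝓡 n) z₀ (L.incl s₀)) β = 0 ∧ g β = γ) :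
    ∃ e : L.isotropy s₀ ≃ₗ[ℝ] L.isotropy s, ∀ β, hat z₀ (e β : Cot n (L.incl s)) =
      g (hat z₀ (β : Cot n (L.incl s₀))) := by
  have hmem : ∀ β : L.isotropy s₀, ∃ γ : L.isotropy s, hat z₀ (γ : Cot n (L.incl s)) =
      g (hat z₀ (β : Cot n (L.incl s₀))) := fun β => by
    let γ : Cot n (L.incl s) := (g (hat z₀ (β : Cot n (L.incl s₀)))).comp (co z₀ (L.incl s))
    have hγ : hat z₀ γ = g (hat z₀ (β : Cot n (L.incl s₀))) := hat_of_comp_co hz _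
    refine ⟨⟨γ, L.mem_isotropy_iff.2 ((P.coord_eq_zero_iff hz _).1 ?_)⟩, hγ⟩
    rw [hγ]
    exact hker _ ((P.coord_eq_zero_iff hz₀ _).2 (L.mem_isotropy_iff.1 β.2))
  choose T hT using hmem
  have hext : ∀ γ γ' : L.isotropy s, hat z₀ (γ : Cot n (L.incl s)) =
      hat z₀ (γ' : Cot n (L.incl s)) → γ = γ' := fun γ γ' h => Subtype.ext (hat_injective hz h)
  let T' : L.isotropy s₀ →ₗ[ℝ] L.isotropy s :=
    { toFun := T
      map_add' := fun β γ => hext _ _ (by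
        rw [hT, Submodule.coe_add, Submodule.coe_add, hat_add, hat_add, map_add, hT, hT])
      map_smul' := fun c β => hext _ _ (by
        rw [hT, RingHom.id_apply, Submodule.coe_smul, Submodule.coe_smul, hat_smul, hat_smul,
          map_smul, hT]) }
  refine ⟨LinearEquiv.ofBijective T' ⟨fun β γ hβγ => ?_, fun γ => ?_⟩, hT⟩
  · refine Subtype.ext (hat_injective hz₀ (hinj ?_))
    rw [← hT, ← hT]
    exact congrArg (fun γ : L.isotropy s => hat z₀ (γ : Cot n (L.incl s))) hβγ
  · obtain ⟨b, hb, hb'⟩ := hsurj (hat z₀ (γ : Cot n (L.incl s)))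
      ((P.coord_eq_zero_iff hz _).2 (L.mem_isotropy_iff.1 γ.2))
    let β : Cot n (L.incl s₀) := b.comp (co z₀ (L.incl s₀))
    have hβ : hat z₀ β = b := hat_of_comp_co hz₀ b
    have hβm : β ∈ L.isotropy s₀ :=
      L.mem_isotropy_iff.2 ((P.coord_eq_zero_iff hz₀ _).1 (by rw [hβ, hb]))
    exact ⟨⟨β, hβm⟩, hext _ _ ((hT ⟨β, hβm⟩).trans ((congrArg g hβ).trans hb'))⟩

variable (L) in
/-- The bundle of isotropy algebras of a leaf is locally trivial. -/
theorem SymplecticLeaf.exists_isotropy_trivialization (s₀ : S) :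
    ∃ G : Model k → ((Model n →L[ℝ] ℝ) →L[ℝ] (Model n →L[ℝ] ℝ)),
      (∀ᶠ y in 𝓝 (extChartAt (𝓡 k) s₀ s₀), ContDiffAt ℝ ∞ G y) ∧
      ∀ᶠ s in 𝓝 s₀, ∃ e : L.isotropy s₀ ≃ₗ[ℝ] L.isotropy s,
        (∀ β, hat (L.incl s₀) (e β : Cot n (L.incl s)) =
          G (extChartAt (𝓡 k) s₀ s) (hat (L.incl s₀) (β : Cot n (L.incl s₀)))) ∧
        ∀ f : 𝔤 ≃ₗ[ℝ] L.isotropy s₀, L.IsLieIso s (f.trans e) ↔ L.IsLieIso s₀ f := by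
  have hs₀ := mem_chart_source (Model k) s₀
  have hz₀ := mem_chart_source (Model n) (L.incl s₀)
  have hj₀ : L.jmap s₀ (extChartAt (𝓡 k) s₀ s₀) = extChartAt (𝓡 n) (L.incl s₀) (L.incl s₀) := by
    rw [jmap, coordMap_chart _ _ hs₀]
  obtain ⟨G, hG, -, h⟩ := exists_local_trivialization (B := P.coord (L.incl s₀))
    (j := L.jmap s₀) (y₀ := extChartAt (𝓡 k) s₀ s₀)
    (by rw [hj₀]; exact P.isPoissonNear_coord hz₀)
    (by
      filter_upwards [L.eventually_chart s₀]
      rintro _ ⟨s, hs, hz, rfl⟩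
      exact L.contDiffAt_jmap hs hz)
    (by
      filter_upwards [L.eventually_chart s₀]
      rintro _ ⟨s, hs, hz, rfl⟩
      exact L.fderiv_jmap_injective hs hz)
    (by
      filter_upwards [L.eventually_chart s₀]
      rintro _ ⟨s, hs, hz, rfl⟩
      exact L.range_fderiv_jmap hs hz)
  refine ⟨G, hG, ?_⟩
  filter_upwards [L.eventually_mem_charts s₀,
    (continuousAt_extChartAt (I := 𝓡 k) s₀).eventually h] with s hs hGs
  obtain ⟨hinj, hker, hsurj, hlie⟩ := hGs
  rw [hj₀] at hker hsurj hlie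
  have hj : L.jmap s₀ (extChartAt (𝓡 k) s₀ s) = extChartAt (𝓡 n) (L.incl s₀) (L.incl s) := by
    rw [jmap, coordMap_chart _ _ hs.1]
  rw [hj] at hker hsurj hlie
  have hmem₀ : ∀ β : L.isotropy s₀, P.coord (L.incl s₀)
      (extChartAt (𝓡 n) (L.incl s₀) (L.incl s₀)) (hat (L.incl s₀) (β : Cot n (L.incl s₀))) = 0 :=
    fun β => (P.coord_eq_zero_iff hz₀ _).2 (L.mem_isotropy_iff.1 β.2)
  obtain ⟨e, he⟩ := exists_isotropy_equiv hz₀ hs.2 _ hinj hker hsurj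
  refine ⟨e, he, fun f => ?_⟩
  rw [L.isLieIso_iff hs.2, L.isLieIso_iff hz₀]
  refine forall₂_congr fun ξ η => ?_
  change isoBracket _ _ (hat _ (e (f ξ) : Cot n (L.incl s))) (hat _ (e (f η) : Cot n (L.incl s))) =
    hat _ (e (f ⁅ξ, η⁆) : Cot n (L.incl s)) ↔ _
  rw [he, he, he, hlie _ _ (hmem₀ _) (hmem₀ _)]
  exact hinj.eq_iff

variable (L) in
/-- The isotropy algebras of a leaf are isomorphic to each other: by local triviality, the points with
an isotropy algebra isomorphic to `𝔤` form an open and closed subset of the connected leaf. -/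
theorem SymplecticLeaf.exists_isLieIso
    (h𝔤 : ∃ (s : S) (f : 𝔤 ≃ₗ[ℝ] L.isotropy s), L.IsLieIso s f) (s : S) :
    ∃ f : 𝔤 ≃ₗ[ℝ] L.isotropy s, L.IsLieIso s f := by
  have := L.connected
  have hloc : ∀ s₀ : S, ∀ᶠ s in 𝓝 s₀, (∃ f : 𝔤 ≃ₗ[ℝ] L.isotropy s, L.IsLieIso s f) ↔
      ∃ f : 𝔤 ≃ₗ[ℝ] L.isotropy s₀, L.IsLieIso s₀ f := by
    intro s₀
    obtain ⟨G, -, h⟩ := L.exists_isotropy_trivialization (𝔤 := 𝔤) s₀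
    filter_upwards [h]
    rintro s ⟨e, -, he⟩
    constructor
    · rintro ⟨f, hf⟩
      refine ⟨f.trans e.symm, (he _).1 ?_⟩
      rwa [LinearEquiv.trans_assoc, LinearEquiv.symm_trans_self, LinearEquiv.trans_refl]
    · rintro ⟨f, hf⟩
      exact ⟨f.trans e, (he f).2 hf⟩
  have hclopen : IsClopen {s : S | ∃ f : 𝔤 ≃ₗ[ℝ] L.isotropy s, L.IsLieIso s f} := by
    refine ⟨⟨isOpen_iff_mem_nhds.2 fun s₀ hs₀ => ?_⟩, isOpen_iff_mem_nhds.2 fun s₀ hs₀ => ?_⟩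
    · filter_upwards [hloc s₀] with s hs h using hs₀ (hs.1 h)
    · filter_upwards [hloc s₀] with s hs using hs.2 hs₀
  have h : s ∈ {s : S | ∃ f : 𝔤 ≃ₗ[ℝ] L.isotropy s, L.IsLieIso s f} := by
    rw [hclopen.eq_univ h𝔤]
    trivial
  exact h

namespace LieFrame

/-- The automorphism group of `𝔤` acts simply transitively on the fibres: `r' = r ∘ (r⁻¹ r')`. -/
theorem exists_act_eq (r r' : LieFrame Λ 𝔤) (h : r.base = r'.base) :
    ∃! a : 𝔤 ≃ₗ⁅ℝ⁆ 𝔤, r' = r.act a := by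
  obtain ⟨x, f, hf⟩ := r
  obtain ⟨x', f', hf'⟩ := r'
  obtain rfl : x = x' := h
  have hz := mem_chart_source (Model n) (Λ.toZ x)
  let r : LieFrame Λ 𝔤 := ⟨x, f, hf⟩
  have hinj := r.hatIso_injective hz
  have hr : ∀ ξ, hatIso (Λ.toZ x) r (f.symm (f' ξ)) =
      hatIso (Λ.toZ x) (⟨x, f', hf'⟩ : LieFrame Λ 𝔤) ξ := fun ξ =>
    congrArg (fun β : Λ.LX x => hat (Λ.toZ x) (β : Cot n (Λ.toZ x))) (f.apply_symm_apply (f' ξ))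
  refine ⟨{ (f'.trans f.symm) with
    map_lie' := fun {ξ η} => hinj ?_ }, ?_, fun a ha => ?_⟩
  · change hatIso _ r (f.symm (f' ⁅ξ, η⁆)) = hatIso _ r ⁅f.symm (f' ξ), f.symm (f' η)⁆
    rw [hr, ← r.isoBracket_hatIso hz, hr, hr]
    exact (isoBracket_hatIso (⟨x, f', hf'⟩ : LieFrame Λ 𝔤) hz ξ η).symm
  · have key : ∀ g hg, f' = g → (⟨x, f', hf'⟩ : LieFrame Λ 𝔤) = ⟨x, g, hg⟩ := by
      rintro _ _ rfl
      rfl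
    exact key _ _ (LinearEquiv.ext fun ξ => (f.apply_symm_apply (f' ξ)).symm)
  · refine LieEquiv.ext fun ξ => hinj ?_
    exact (congrArg (fun r => hatIso (Λ.toZ x) r ξ) ha).symm.trans (hr ξ).symm

/-- A local section is given by a frame at `x` and the local trivialization of the isotropy algebras. -/
theorem exists_isLocalSection
    (h𝔤 : ∃ (s : S) (f : 𝔤 ≃ₗ[ℝ] L.isotropy s), L.IsLieIso s f) (x : X) :
    ∃ (U : Set X) (σ : X → LieFrame Λ 𝔤), x ∈ U ∧ IsLocalSection σ U := by
  classical
  obtain ⟨f, hf⟩ := L.exists_isLieIso h𝔤 (Λ.incl x)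
  obtain ⟨G, hG, h⟩ := L.exists_isotropy_trivialization (𝔤 := 𝔤) (Λ.incl x)
  have hincl := Λ.incl.contMDiff.continuous.continuousAt (x := x)
  have hev := (hincl.eventually h).and ((hincl.eventually (L.eventually_mem_charts _)).and
    (hincl.eventually ((continuousAt_extChartAt (I := 𝓡 k) (Λ.incl x)).eventually hG)))
  obtain ⟨U, hU, hUo, hxU⟩ := eventually_nhds_iff.1 hev
  choose e he he' using fun y (hy : y ∈ U) => (hU y hy).1
  let σ : X → LieFrame Λ 𝔤 := fun y =>
    if hy : y ∈ U then ⟨y, f.trans (e y hy), (he' y hy f).2 hf⟩ else ⟨x, f, hf⟩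
  have hσ : ∀ y (hy : y ∈ U), σ y = ⟨y, f.trans (e y hy), (he' y hy f).2 hf⟩ := fun y hy => dif_pos hy
  refine ⟨U, σ, hxU, hUo, fun y hy => by rw [hσ y hy], fun ξ y hy => ?_⟩
  refine ContMDiffAt.contMDiffWithinAt ?_
  have hUy := hUo.mem_nhds hy
  have hb : ∀ y' ∈ U, ((σ y').cov ξ).1 = Λ.toZ y' := fun y' hy' => by
    rw [hσ y' hy']
    rfl
  refine (contMDiffAt_cot_iff (Λ.toZ x) (by rw [hb y hy]; exact (hU y hy).2.1.2)).2 ⟨?_, ?_⟩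
  · refine Λ.contMDiff_toZ.contMDiffAt.congr_of_eventuallyEq ?_
    filter_upwards [hUy] with y' hy' using hb y' hy'
  · have h₁ := (contMDiffAt_of_contDiffAt_chart (hU y hy).2.1.1 (hU y hy).2.2).comp y
      Λ.incl.contMDiff.contMDiffAt
    refine (h₁.clm_apply (contMDiffAt_const
      (c := hat (L.incl (Λ.incl x)) (f ξ : Cot n (L.incl (Λ.incl x)))))).congr_of_eventuallyEq ?_
    filter_upwards [hUy] with y' hy'
    rw [hσ y' hy']
    exact he y' hy' (f ξ)

theorem isPrincipalBundle
    (h𝔤 : ∃ (s : S) (f : 𝔤 ≃ₗ[ℝ] L.isotropy s), L.IsLieIso s f) : IsPrincipalBundle Λ 𝔤 :=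
  ⟨exists_act_eq, exists_isLocalSection h𝔤⟩

end LieFrame

end Principal

/-! ### Uniqueness of the induced connection form -/

section Uniqueness

variable {n : ℕ} {Z : Type u} [TopologicalSpace Z] [T2Space Z] [ChartedSpace (Model n) Z]
  [IsManifold (𝓡 n) ∞ Z] {P : PoissonStructure n Z} {k : ℕ} {S : Type v} [TopologicalSpace S]
  [ChartedSpace (Model k) S] [IsManifold (𝓡 k) ∞ S] {L : SymplecticLeaf P k S}
  {m : ℕ} {X : Type w} [TopologicalSpace X] [ChartedSpace (Model m) X] [IsManifold (𝓡 m) ∞ X]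
  {Λ : LagrangianSubmanifold L m X} {𝔤 : Type*} [LieRing 𝔤] [LieAlgebra ℝ 𝔤]

omit [T2Space Z] in
theorem cotBundle_ext {z₀ : Z} {p q : CotBundle n Z} (h : p.1 = q.1)
    (hz : q.1 ∈ (chartAt (Model n) z₀).source) (h' : hat z₀ p.2 = hat z₀ q.2) : p = q := by
  obtain ⟨z, β⟩ := p
  obtain ⟨z', γ⟩ := q
  obtain rfl : z = z' := h
  exact congrArg _ (hat_injective hz h')

/-- Sections of `T*Z` over `X` extend to one-forms. -/
theorem LagrangianSubmanifold.exists_oneForm_extension (Λ : LagrangianSubmanifold L m X) {x : X}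
    {s : X → CotBundle n Z} (hs : ∀ᶠ y in 𝓝 x, ContMDiffAt (𝓡 m) (cotModel n) ∞ s y)
    (hb : ∀ᶠ y in 𝓝 x, (s y).1 = Λ.toZ y) :
    ∃ e : OneForm n Z, ∀ᶠ y in 𝓝 x, cot n (Λ.toZ y) (e.val (Λ.toZ y)) = s y := by
  obtain ⟨ρ, hρ, hρ'⟩ := Λ.exists_retraction x
  have hsrc : ∀ᶠ y in 𝓝 x, Λ.toZ y ∈ (chartAt (Model n) (Λ.toZ x)).source :=
    Λ.contMDiff_toZ.continuous.continuousAt.eventually (chart_source_mem_nhds _ _)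
  have hc : Tendsto ρ (𝓝 (Λ.toZ x)) (𝓝 x) := by
    have h := hρ.self_of_nhds.continuousAt
    rwa [ContinuousAt, hρ'.self_of_nhds] at h
  obtain ⟨e, he⟩ := exists_oneForm (z₀ := Λ.toZ x) (b := fun z => hat (Λ.toZ x) (s (ρ z)).2) (by
    filter_upwards [hρ, hc.eventually (hs.and (hb.and hsrc))] with z hz hz'
    exact ((contMDiffAt_cot_iff (Λ.toZ x) (by rw [hz'.2.1]; exact hz'.2.2)).1 hz'.1).2.comp z hz)
  refine ⟨e, ?_⟩
  filter_upwards [hb, hsrc, hρ', Λ.contMDiff_toZ.continuous.continuousAt.eventually he]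
    with y h₁ h₂ h₃ h₄
  refine cotBundle_ext (z₀ := Λ.toZ x) h₁.symm (by rwa [h₁]) ?_
  rw [h₃] at h₄
  exact h₄

namespace LieFrame

variable {α : ∀ x : X, TangentSpace (𝓡 m) x →ₗ[ℝ] Λ.EX x}

/-- On velocities of curves in the image of a local section, a form that induces `∇^α` is determined
by `α`. -/
theorem eq_of_induces [T2Space X] (hα : Λ.IsConnectionForm α)
    {A A' : ∀ r : LieFrame Λ 𝔤, tangent r →ₗ[ℝ] LieDerivation ℝ 𝔤 𝔤} (hA : Induces A α)
    (hA' : Induces A' α) {U : Set X} {σ : X → LieFrame Λ 𝔤} (hσ : IsLocalSection σ U)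
    (c : Curve Λ 𝔤) (hcU : (c.val 0).base ∈ U) (hc : ∀ᶠ t in 𝓝 (0 : ℝ), c.val t = σ (c.val t).base) :
    A _ c.tan = A' _ c.tan := by
  obtain ⟨V, hV⟩ := exists_vField_eq c.baseVel
  obtain ⟨a, ha⟩ := Λ.exists_oneForm_extension (x := (c.val 0).base)
    (s := fun y => cot n (Λ.toZ y) (α y (V.val y) : Cot n (Λ.toZ y)))
    (Eventually.of_forall fun y => (hα.smooth.comp V.smooth).contMDiffAt)
    (Eventually.of_forall fun y => rfl)
  have ha' : ∀ᶠ y in 𝓝 (c.val 0).base, a.val (Λ.toZ y) = (α y (V.val y) : Cot n (Λ.toZ y)) :=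
    ha.mono fun y hy => eq_of_heq (TotalSpace.mk.inj hy).2
  have hU := hσ.isOpen.mem_nhds hcU
  refine LieDerivation.ext fun ξ => ?_
  obtain ⟨e, he⟩ := Λ.exists_oneForm_extension (x := (c.val 0).base) (s := fun y => (σ y).cov ξ)
    (by
      filter_upwards [hσ.isOpen.mem_nhds hcU] with y hy
      exact (hσ.smooth ξ).contMDiffAt (hσ.isOpen.mem_nhds hy))
    (by
      filter_upwards [hU] with y hy
      exact congrArg Λ.toZ (hσ.base y hy))
  refine (c.val 0).iso.injective (Subtype.ext (ContinuousLinearMap.ext fun v => ?_))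
  obtain ⟨W, rfl⟩ := exists_vField_eq v
  exact (hA U σ hσ c hcU hc ξ V a e hV ha' he W).symm.trans
    (hA' U σ hσ c hcU hc ξ V a e hV ha' he W)

theorem exists_isLocalSection_through
    (h𝔤 : ∃ (s : S) (f : 𝔤 ≃ₗ[ℝ] L.isotropy s), L.IsLieIso s f) (r : LieFrame Λ 𝔤) :
    ∃ (U : Set X) (σ : X → LieFrame Λ 𝔤), r.base ∈ U ∧ IsLocalSection σ U ∧ σ r.base = r := by
  obtain ⟨U, σ, hx, hσ⟩ := exists_isLocalSection (Λ := Λ) h𝔤 r.base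
  obtain ⟨a, ha, -⟩ := exists_act_eq (σ r.base) r (hσ.base _ hx)
  exact ⟨U, fun y => (σ y).act a, hx, ⟨hσ.isOpen, hσ.base, fun ξ => hσ.smooth (a ξ)⟩, ha.symm⟩

/-- The velocity of the base of a curve, as a point of `TX`. -/
def Curve.baseVelTotal (c : Curve Λ 𝔤) : TangentBundle (𝓡 m) X := ⟨(c.val 0).base, c.baseVel⟩

/-- Through every frame `c(0)` there is a curve in the image of a local section whose base curve has
the same velocity as that of `c`. -/
theorem Curve.exists_along_section
    (h𝔤 : ∃ (s : S) (f : 𝔤 ≃ₗ[ℝ] L.isotropy s), L.IsLieIso s f) (c : Curve Λ 𝔤) :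
    ∃ (U : Set X) (σ : X → LieFrame Λ 𝔤) (c' : Curve Λ 𝔤), IsLocalSection σ U ∧
      (c'.val 0).base ∈ U ∧ (∀ t, c'.val t = σ (c'.val t).base) ∧ c'.val 0 = c.val 0 ∧
      c'.baseVelTotal = c.baseVelTotal := by
  obtain ⟨U, σ, hx, hσ, hr⟩ := exists_isLocalSection_through h𝔤 (c.val 0)
  obtain ⟨ε, hε, hεU⟩ := Metric.nhds_basis_closedBall.mem_iff.1
    (c.base.continuous.continuousAt.preimage_mem_nhds (hσ.isOpen.mem_nhds hx))
  -- a reparametrization that keeps the base curve inside `U` for all times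
  let h : ℝ → ℝ := fun t => ε * Real.sin (t / ε)
  have hh : ContDiff ℝ ∞ h := contDiff_const.mul (Real.contDiff_sin.comp (contDiff_id.div_const ε))
  have h0 : h 0 = 0 := by simp [h]
  have hmem : ∀ t, (c.val (h t)).base ∈ U := fun t => by
    refine hεU (mem_closedBall_zero_iff.2 ?_)
    rw [Real.norm_eq_abs, abs_mul, abs_of_pos hε]
    exact mul_le_of_le_one_right hε.le (Real.abs_sin_le_one _)
  have hbase : ∀ t, (σ (c.val (h t)).base).base = (c.val (h t)).base := fun t => hσ.base _ (hmem t)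
  have hγ : ContMDiff 𝓘(ℝ, ℝ) (𝓡 m) ∞ (fun t => (c.val (h t)).base) := c.base.comp hh.contMDiff
  let c' : Curve Λ 𝔤 :=
    { val := fun t => σ (c.val (h t)).base
      base := by
        simp only [hbase]
        exact hγ
      cov := fun ξ => (hσ.smooth ξ).comp_contMDiff hγ hmem }
  refine ⟨U, σ, c', hσ, ?_, fun t => congrArg σ (hbase t).symm, ?_, ?_⟩
  · exact (hbase 0).symm ▸ hmem 0
  · change σ (c.val (h 0)).base = _
    rw [h0, hr]
  · have h₁ : c'.baseVelTotal = tangentMap 𝓘(ℝ, ℝ) (𝓡 m) ((fun t => (c.val t).base) ∘ h)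
        ⟨0, (1 : ℝ)⟩ := by
      change tangentMap 𝓘(ℝ, ℝ) (𝓡 m) (fun t => (c'.val t).base) ⟨0, (1 : ℝ)⟩ = _
      exact congrArg (fun g => tangentMap 𝓘(ℝ, ℝ) (𝓡 m) g ⟨0, (1 : ℝ)⟩) (funext hbase)
    have h₂ : tangentMap 𝓘(ℝ, ℝ) 𝓘(ℝ, ℝ) h ⟨0, (1 : ℝ)⟩ =
        (⟨0, (1 : ℝ)⟩ : TangentBundle 𝓘(ℝ, ℝ) ℝ) := by
      have hd : HasDerivAt h 1 0 := by
        have h₃ := ((Real.hasDerivAt_sin (0 / ε)).comp (0 : ℝ)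
          ((hasDerivAt_id (0 : ℝ)).div_const ε)).const_mul ε
        refine h₃.congr_deriv ?_
        rw [zero_div, Real.cos_zero]
        field_simp
      have hm : mfderiv 𝓘(ℝ, ℝ) 𝓘(ℝ, ℝ) h 0 (1 : ℝ) = (1 : ℝ) := by
        rw [mfderiv_eq_fderiv]
        exact hd.hasFDerivAt.fderiv ▸ one_smul ℝ (1 : ℝ)
      change (⟨h 0, mfderiv 𝓘(ℝ, ℝ) 𝓘(ℝ, ℝ) h 0 (1 : ℝ)⟩ : TangentBundle 𝓘(ℝ, ℝ) ℝ) = _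
      rw [hm]
      rw [h0]
    rw [h₁, tangentMap_comp_at _ (c.base.mdifferentiable (by simp) _)
      (hh.contMDiff.mdifferentiable (by simp) _), h₂]
    rfl

omit [T2Space Z] in
/-- A tangent vector of the frame bundle is determined by its projection to `X` and its derivation. -/
theorem IsCovariant.eq {r : LieFrame Λ 𝔤} {τ τ' : Ambient r} {u : TangentSpace (𝓡 m) r.base}
    {D : LieDerivation ℝ 𝔤 𝔤} (h : IsCovariant α r τ u D) (h' : IsCovariant α r τ' u D) :
    τ = τ' := by
  funext ξ
  exact Prod.ext ((h ξ).1.trans (h' ξ).1.symm)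
    (add_right_cancel ((h ξ).2.symm.trans (h' ξ).2))

/-- The velocity of a curve `c'` in the image of a section, as a tangent vector at any `r` equal to
`c' 0`. On such vectors `A` agrees with the induced form. -/
theorem exists_tangent_of_curve [T2Space X] (hα : Λ.IsConnectionForm α)
    {A : ∀ r : LieFrame Λ 𝔤, tangent r →ₗ[ℝ] LieDerivation ℝ 𝔤 𝔤} (hA : Induces A α)
    {U : Set X} {σ : X → LieFrame Λ 𝔤} (hσ : IsLocalSection σ U)
    (c' : Curve Λ 𝔤) (hcU : (c'.val 0).base ∈ U) (hc : ∀ t, c'.val t = σ (c'.val t).base)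
    {r : LieFrame Λ 𝔤} (h : c'.val 0 = r) :
    ∃ (τ : tangent r) (u : TangentSpace (𝓡 m) r.base), IsCovariant α r τ.1 u (A r τ) ∧
      (⟨r.base, u⟩ : TangentBundle (𝓡 m) X) = c'.baseVelTotal := by
  subst h
  refine ⟨c'.tan, c'.baseVel, ?_, rfl⟩
  rw [eq_of_induces hα hA (inducedForm_induces hα) hσ c' hcU (Eventually.of_forall hc)]
  exact isCovariant_inducedForm hα c'

omit [T2Space Z] in
set_option synthInstance.maxHeartbeats 200000 in
/-- A tangent vector differs from another one with the same projection to `X` by a fundamental vector,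
on which the value of `A` is prescribed. -/
theorem IsCovariant.apply_eq {A : ∀ r : LieFrame Λ 𝔤, tangent r →ₗ[ℝ] LieDerivation ℝ 𝔤 𝔤}
    (hv : ∀ (r : LieFrame Λ 𝔤) (D : LieDerivation ℝ 𝔤 𝔤) (τ : tangent r),
      τ.1 = LieFrame.fundamental r D → A r τ = D) {r : LieFrame Λ 𝔤} {τ τ' : tangent r}
    {u : TangentSpace (𝓡 m) r.base} {D : LieDerivation ℝ 𝔤 𝔤} (h : IsCovariant α r τ.1 u D)
    (h' : IsCovariant α r τ'.1 u (A r τ')) : A r τ = D := by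
  have h₁ := h.add (h'.smul (-1))
  rw [neg_one_smul ℝ u, add_neg_cancel] at h₁
  have h₂ : A r (τ + (-1 : ℝ) • τ') = D + (-1 : ℝ) • A r τ' :=
    hv _ _ _ (h₁.eq (IsCovariant.fundamental _ _))
  have h₃ := (A r).map_add τ ((-1 : ℝ) • τ')
  have h₄ := (A r).map_smul (-1) τ'
  rw [h₄] at h₃
  exact add_right_cancel (h₃.symm.trans h₂)

omit [T2Space Z] in
theorem eq_of_forall_curve {A A' : ∀ r : LieFrame Λ 𝔤, tangent r →ₗ[ℝ] LieDerivation ℝ 𝔤 𝔤}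
    (h : ∀ c : Curve Λ 𝔤, A _ c.tan = A' _ c.tan) : A = A' := by
  refine funext fun r => LinearMap.ext_on (s := {τ : tangent r | ∃ c : Curve Λ 𝔤,
    ∃ h : c.val 0 = r, h ▸ c.vel = τ.1}) ?_ ?_
  · exact Submodule.span_span_coe_preimage
  · rintro ⟨_, _⟩ ⟨c, rfl, rfl⟩
    exact h c

/-- A form that induces `∇^α` and reproduces the generators of fundamental vectors is determined by
`α`: every velocity of a curve of frames is the sum of a velocity along a local section and of a
fundamental vector. -/
theorem eq_inducedForm [T2Space X] (hα : Λ.IsConnectionForm α)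
    (h𝔤 : ∃ (s : S) (f : 𝔤 ≃ₗ[ℝ] L.isotropy s), L.IsLieIso s f)
    {A : ∀ r : LieFrame Λ 𝔤, tangent r →ₗ[ℝ] LieDerivation ℝ 𝔤 𝔤} (hA : Induces A α)
    (hv : ∀ (r : LieFrame Λ 𝔤) (D : LieDerivation ℝ 𝔤 𝔤) (τ : tangent r),
      τ.1 = fundamental r D → A r τ = D) : A = fun r => inducedForm hα r := by
  refine eq_of_forall_curve fun c => ?_
  obtain ⟨U, σ, c', hσ, hcU, hc, h0, hvel⟩ := c.exists_along_section h𝔤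
  obtain ⟨τ, u, hτ, hu⟩ := exists_tangent_of_curve hα hA hσ c' hcU hc h0
  obtain rfl : u = c.baseVel := eq_of_heq (TotalSpace.mk.inj (hu.trans hvel)).2
  exact IsCovariant.apply_eq hv (isCovariant_inducedForm hα c) hτ

end LieFrame

end Uniqueness

end PoissonGauge

end

theorem mainTheorem1
    {n : ℕ} {Z : Type*} [TopologicalSpace Z] [T2Space Z] [SecondCountableTopology Z]
    [ChartedSpace (EuclideanSpace ℝ (Fin n)) Z] [IsManifold (𝓡 n) ∞ Z]
    (P : PoissonGauge.PoissonStructure n Z)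
    {k : ℕ} {S : Type*} [TopologicalSpace S]
    [ChartedSpace (EuclideanSpace ℝ (Fin k)) S] [IsManifold (𝓡 k) ∞ S]
    (L : PoissonGauge.SymplecticLeaf P k S)
    {m : ℕ} {X : Type*} [TopologicalSpace X]
    [ChartedSpace (EuclideanSpace ℝ (Fin m)) X] [IsManifold (𝓡 m) ∞ X]
    (Λ : PoissonGauge.LagrangianSubmanifold L m X)
    (𝔤 : Type*) [LieRing 𝔤] [LieAlgebra ℝ 𝔤]
    (h𝔤 : ∃ (s : S) (f : 𝔤 ≃ₗ[ℝ] L.isotropy s), L.IsLieIso s f)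
    (H : Z → ℝ) (hH : ContMDiff (𝓡 n) 𝓘(ℝ, ℝ) ∞ H)
    (hcrit : ∀ x : X, PoissonGauge.diff n H (Λ.toZ x) = 0) :
    ∃ tVH : ∀ x : X, Λ.Normal x →ₗ[ℝ] Λ.EX x,
      Λ.IsTransverseDerivative H tVH ∧
      (∀ t' : ∀ x : X, Λ.Normal x →ₗ[ℝ] Λ.EX x, Λ.IsTransverseDerivative H t' → t' = tVH) ∧
      Λ.IsBundleMorphism tVH ∧
      ∀ hinv : ∀ x : X, Function.Bijective (Λ.compose tVH x),
        PoissonGauge.IsMetric m (Λ.gammaFlat tVH hinv) ∧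
        Λ.IsConnectionForm (Λ.alphaFlat tVH hinv) ∧
        PoissonGauge.LieFrame.IsPrincipalBundle Λ 𝔤 ∧
        ∃! A : ∀ r : PoissonGauge.LieFrame Λ 𝔤,
            PoissonGauge.LieFrame.tangent r →ₗ[ℝ] LieDerivation ℝ 𝔤 𝔤,
          PoissonGauge.LieFrame.IsPrincipalConnectionForm A ∧
          PoissonGauge.LieFrame.Induces A (Λ.alphaFlat tVH hinv) := by
  have hS : T2Space S := L.embedding.isEmbedding.t2Space
  have hX : T2Space X := Λ.embedding.isEmbedding.t2Space
  refine ⟨Λ.transverse hH hcrit, Λ.isTransverseDerivative_transverse hH hcrit,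
    fun t' ht' => Λ.transverse_unique (Λ.isTransverseDerivative_transverse hH hcrit) ht',
    Λ.isBundleMorphism_transverse hH hcrit, fun hinv => ?_⟩
  have hα := Λ.isConnectionForm_alphaFlat hH hcrit hinv
  exact ⟨Λ.isMetric_gammaFlat hH hcrit hinv, hα,
    PoissonGauge.LieFrame.isPrincipalBundle h𝔤,
    fun r => PoissonGauge.LieFrame.inducedForm hα r,
    ⟨PoissonGauge.LieFrame.isPrincipalConnectionForm_inducedForm hα,
      PoissonGauge.LieFrame.inducedForm_induces hα⟩,
    fun A hA => PoissonGauge.LieFrame.eq_inducedForm hα h𝔤 hA.2 hA.1.vertical⟩
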